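/- Let $G$ be a finite-dimensional Lie group with Lie algebra $\mathfrak g$. For a principal $G$-bundle $P\to M$ with connection form $\omega$ (equivariant under the right action, reproducing fundamental vector fields) let $\Omega=d\omega+\tfrac12[\omega,\omega]$ be its curvature. For an absolutely continuous loop $\gamma:[0,1]\to M$ at $x$ and $p\in P_x$, the holonomy $\mathrm{Hol}_p^\omega(\gamma)\in G$ is defined by $\tilde\gamma(1)=p\cdot \mathrm{Hol}_p^\omega(\gamma)$, where $\tilde\gamma$ is the horizontal lift of $\gamma$ starting at $p$. For a length $\ell$ on loops at $x$ with values in $[0,\infty]$, and a $\mathfrak g$-valued functional $F$ of these loops, write $\mathrm{Hol}_p^\omega=\exp(-F+O(\ell^q))$ if there are $\varepsilon,C>0$ such that for every absolutely continuous loop $\gamma$ at $x$ with $\ell(\gamma)<\varepsilon$ the holonomy is well defined and equals $\exp X$ for some $X\in\mathfrak g$ with $\|X+F(\gamma)\|\le C\,\ell(\gamma)^q$. **(a) Carnot groups.** Let $N$ be a Carnot group: a simply connected Lie group whose Lie algebra is stratified, $\mathfrak n=\mathfrak n_1\oplus\dots\oplus\mathfrak n_\lambda$ with $[\mathfrak n_1,\mathfrak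 n_j]=\mathfrak n_{j+1}$ for $1\le j<\lambda$ and $[\mathfrak n_1,\mathfrak n_\lambda]=0$, with an inner product on $\mathfrak n_1$. Left translation of $\mathfrak n_1$ and of its inner product defines horizontal curves (absolutely continuous, almost everywhere tangent to the left-invariant distribution), their lengths, and the Carnot–Carathéodory metric $\mathsf d$. Let $\ell(\gamma)$ be the length of $\gamma$ relative to $\mathsf d$, that is, the supremum of $\sum_j \mathsf d(\gamma(t_{j-1}),\gamma(t_j))$ over the partitions of $[0,1]$. Let $\delta_s$, $s>0$, be the dilations, i.e. the Lie group automorphisms of $N$ whose derivative at the identity is $A\mapsto s^jA$ on $\mathfrak n_j$, and put $\delta_s^x=l_x\circ\delta_s\circ l_{x^{-1}}$, where $l_x$ is left translation by $x\in N$. Let $P\to N$ be a principal $G$-bundle with connection $\omega$, $x\in N$ and $p\in P_x$. Let $\sigma:N\to P$ be the radial gauge centred at $x$ with $\sigma(x)=p$, i.e. the smooth section with $(\sigma^*\omega)(S)=0$ for the radial vector field $S(y)=\frac{d}{ds}\big|_{s=1}\delta_s^x(y)$. Let $m\ge0$ be an integer such that $\sigma^*\Omega$ is of weight $\ge m$,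 i.e. $\lim_{s\downarrow0}s^{-k}(\delta_s^x)^*\sigma^*\Omega=0$ for all integers $k<m$. Then $$\mathrm{Hol}_p^\omega=\exp\Big(-\int_{\mathrm{disk}(\gamma)}\sigma^*\Omega+O(\ell^{2m})\Big),$$ where $\mathrm{disk}(\gamma):[0,1]^2\to N$, $(s,t)\mapsto\delta_s^x(\gamma(t))$, is the radial filling disk. **(b) Euclidean space.** Let $P\to\mathbb R^n$ be a principal $G$-bundle with connection $\omega$, $x\in\mathbb R^n$, and let $\sigma:\mathbb R^n\to P$ be a smooth section with $(\sigma^*\omega)_y(y-x)=0$ for all $y$; put $p=\sigma(x)$. Let $\ell$ be the Euclidean length and $\mathrm{disk}(\gamma)(s,t)=x+s(\gamma(t)-x)$. Then $$\mathrm{Hol}_p^\omega=\exp\Big(-\int_{\mathrm{disk}(\gamma)}\sigma^*\Omega+O(\ell^{4})\Big),$$ and for every integer $k\ge0$ such that $\Omega$ and all its covariant derivatives of order $\le k$ vanish at $x$, $$\mathrm{Hol}_p^\omega=\exp\Big(-\int_{\mathrm{disk}(\gamma)}\sigma^*\Omega+O(\ell^{2(3+k)})\Big).$$ Here the covariant derivatives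 are those of the components $\Omega(\partial_i,\partial_j)$, as sections of $\mathrm{Ad}(P)$, in the coordinate directions. -/

import Mathlib

open MeasureTheory Set Filter Topology
open scoped Manifold ContDiff ENNReal

noncomputable section

/-! ### Curves -/

section Curves

variable (E : Type*) [NormedAddCommGroup E] [NormedSpace ℝ E]
  {M : Type*} [TopologicalSpace M] [ChartedSpace E M]

/-- The velocity `ċ(t)` of a curve in a manifold. -/
def velocity (c : ℝ → M) (t : ℝ) : TangentSpace 𝓘(ℝ, E) (c t) :=
  mfderiv 𝓘(ℝ, ℝ) 𝓘(ℝ, E) c t (1 : ℝ)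

/-- Absolute continuity on `[0, 1]` of a curve in a manifold: the curve is continuous and, around
every parameter, it is absolutely continuous in a chart. Only the values on `[0, 1]` matter. -/
def IsAbsContCurve (c : ℝ → M) : Prop :=
  ContinuousOn c (Icc 0 1) ∧
  ∀ t₀ ∈ Icc (0 : ℝ) 1, ∃ r > 0,
    MapsTo c (Icc (max 0 (t₀ - r)) (min 1 (t₀ + r))) (chartAt E (c t₀)).source ∧
    AbsolutelyContinuousOnInterval (fun t => chartAt E (c t₀) (c t))
      (max 0 (t₀ - r)) (min 1 (t₀ + r))

/-- The absolutely continuous loops `[0, 1] → M` based at `x`. -/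
def IsLoopAt (x : M) (c : ℝ → M) : Prop :=
  IsAbsContCurve E c ∧ c 0 = x ∧ c 1 = x

end Curves

/-- The length of a curve `[0, 1] → M` relative to a (possibly infinite) metric `d`. -/
def metricLength {M : Type*} (d : M → M → ℝ≥0∞) (c : ℝ → M) : ℝ≥0∞ :=
  ⨆ (k : ℕ) (t : Fin (k + 1) → ℝ) (_ : StrictMono t ∧ t 0 = 0 ∧ t (Fin.last k) = 1),
    ∑ j : Fin k, d (c (t j.castSucc)) (c (t j.succ))

/-! ### Lie groups -/

section LieGroups

variable (E : Type*) [NormedAddCommGroup E] [NormedSpace ℝ E]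
  {G : Type*} [TopologicalSpace G] [ChartedSpace E G] [Group G]

/-- The bracket of the Lie algebra of `G`. By definition `T₁G` is the model space `E`; we work with
`E`, since Mathlib puts no norm on `T₁G`. -/
def lieBracketModel (G : Type*) [TopologicalSpace G] [ChartedSpace E G] [Group G] (A B : E) : E :=
  let A' : GroupLieAlgebra 𝓘(ℝ, E) G := A
  let B' : GroupLieAlgebra 𝓘(ℝ, E) G := B
  let C' : GroupLieAlgebra 𝓘(ℝ, E) G := ⁅A', B'⁆
  C'

/-- The adjoint action `Ad(a)`, the derivative of `b ↦ a b a⁻¹` at the identity. -/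
def lieAd (a : G) (A : E) : E :=
  mfderiv 𝓘(ℝ, E) 𝓘(ℝ, E) (fun b : G => a * b * a⁻¹) 1 A

/-- `c` is the one-parameter subgroup of `G` generated by `A`. -/
def IsOneParameterSubgroup (A : E) (c : ℝ → G) : Prop :=
  ContMDiff 𝓘(ℝ, ℝ) 𝓘(ℝ, E) ∞ c ∧ (∀ s t, c (s + t) = c s * c t) ∧ velocity E c 0 = A

open Classical in
variable (G) in
/-- The exponential map of `G`: the value at time `1` of the one-parameter subgroup
generated by `A`. -/
def lieExp (A : E) : G :=
  if h : ∃ c : ℝ → G, IsOneParameterSubgroup E A c then h.choose 1 else 1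

end LieGroups

/-! ### Principal bundles and connections -/

section Bundles

variable (EG G EP P EM M : Type*)
  [NormedAddCommGroup EG] [NormedSpace ℝ EG]
  [TopologicalSpace G] [ChartedSpace EG G] [Group G]
  [NormedAddCommGroup EP] [NormedSpace ℝ EP] [TopologicalSpace P] [ChartedSpace EP P]
  [NormedAddCommGroup EM] [NormedSpace ℝ EM] [TopologicalSpace M] [ChartedSpace EM M]

/-- A smooth principal `G`-bundle `P → M`. -/
structure PrincipalBundle where
  /-- the bundle projection -/
  proj : P → M
  /-- the right action of the structure group -/
  act : P → G → P
  act_one : ∀ p, act p 1 = p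
  act_mul : ∀ p a b, act p (a * b) = act (act p a) b
  contMDiff_proj : ContMDiff 𝓘(ℝ, EP) 𝓘(ℝ, EM) ∞ proj
  contMDiff_act :
    ContMDiff (𝓘(ℝ, EP).prod 𝓘(ℝ, EG)) 𝓘(ℝ, EP) ∞ (fun q : P × G => act q.1 q.2)
  /-- `ψ : U × G → π⁻¹(U)` is an equivariant diffeomorphism over `U`, with inverse `φ`. -/
  locallyTrivial : ∀ x : M, ∃ U : Set M, IsOpen U ∧ x ∈ U ∧
    ∃ (ψ : M × G → P) (φ : P → M × G),
      ContMDiffOn (𝓘(ℝ, EM).prod 𝓘(ℝ, EG)) 𝓘(ℝ, EP) ∞ ψ (U ×ˢ univ) ∧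
      ContMDiffOn 𝓘(ℝ, EP) (𝓘(ℝ, EM).prod 𝓘(ℝ, EG)) ∞ φ (proj ⁻¹' U) ∧
      (∀ y ∈ U, ∀ a, proj (ψ (y, a)) = y ∧ φ (ψ (y, a)) = (y, a)) ∧
      (∀ p, proj p ∈ U → (φ p).1 = proj p ∧ ψ (φ p) = p) ∧
      (∀ y ∈ U, ∀ a b, ψ (y, a * b) = act (ψ (y, a)) b)

variable {EG G EP P EM M}

variable [IsManifold 𝓘(ℝ, EP) ∞ P]

/-- A principal connection, given by its connection form with values in the Lie algebra of `G`. -/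
structure PrincipalConnection (B : PrincipalBundle EG G EP P EM M) where
  form : ∀ p : P, TangentSpace 𝓘(ℝ, EP) p →L[ℝ] EG
  /-- smoothness of the one-form, as a function on the tangent bundle -/
  smooth : ContMDiff 𝓘(ℝ, EP).tangent 𝓘(ℝ, EG) ∞
    (fun v : TangentBundle 𝓘(ℝ, EP) P => form v.proj v.2)
  /-- the form reproduces the generators of the fundamental vector fields -/
  vertical : ∀ (p : P) (A : EG),
    form (B.act p 1) (mfderiv 𝓘(ℝ, EG) 𝓘(ℝ, EP) (fun a : G => B.act p a) 1 A) = A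
  equivariant : ∀ (p : P) (a : G) (v : TangentSpace 𝓘(ℝ, EP) p),
    form (B.act p a) (mfderiv 𝓘(ℝ, EP) 𝓘(ℝ, EP) (fun q => B.act q a) p v)
      = lieAd EG a⁻¹ (form p v)

/-- The exterior derivative `(dα)_p(u, v)` of a vector-valued one-form on a manifold, computed in
the preferred chart at `p`. -/
def extDerivOneForm (α : ∀ p : P, TangentSpace 𝓘(ℝ, EP) p →L[ℝ] EG) (p : P)
    (u v : TangentSpace 𝓘(ℝ, EP) p) : EG :=
  let φ := extChartAt 𝓘(ℝ, EP) p
  let β : EP → EP → EG := fun z w => α (φ.symm z) (mfderiv 𝓘(ℝ, EP) 𝓘(ℝ, EP) φ.symm z w)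
  let u' : EP := mfderiv 𝓘(ℝ, EP) 𝓘(ℝ, EP) φ p u
  let v' : EP := mfderiv 𝓘(ℝ, EP) 𝓘(ℝ, EP) φ p v
  fderiv ℝ (fun z => β z v') (φ p) u' - fderiv ℝ (fun z => β z u') (φ p) v'

variable {B : PrincipalBundle EG G EP P EM M} (conn : PrincipalConnection B)

namespace PrincipalConnection

/-- The curvature form `Ω = dω + ½ [ω, ω]`. -/
def curvature (p : P) (u v : TangentSpace 𝓘(ℝ, EP) p) : EG :=
  extDerivOneForm conn.form p u v + lieBracketModel EG G (conn.form p u) (conn.form p v)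

/-- `c'` is a horizontal lift of the curve `c : [0, 1] → M` starting at `p`. -/
def IsHorizontalLift (p : P) (c : ℝ → M) (c' : ℝ → P) : Prop :=
  IsAbsContCurve EP c' ∧ c' 0 = p ∧ (∀ t ∈ Icc (0 : ℝ) 1, B.proj (c' t) = c t) ∧
  ∀ᵐ t ∂(volume.restrict (Icc (0 : ℝ) 1)), conn.form (c' t) (velocity EP c' t) = 0

/-- `a` is the holonomy at `p` of the loop `c`: a horizontal lift of `c` that starts at `p` ends
at `p · a`. -/
def IsHolonomy (p : P) (c : ℝ → M) (a : G) : Prop :=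
  ∃ c' : ℝ → P, conn.IsHorizontalLift p c c' ∧ c' 1 = B.act p a

/-- The pull-back `σ^* Ω` of the curvature. -/
def pullbackCurvature (σ : M → P) (y : M) (u v : TangentSpace 𝓘(ℝ, EM) y) : EG :=
  conn.curvature (σ y) (mfderiv 𝓘(ℝ, EM) 𝓘(ℝ, EP) σ y u) (mfderiv 𝓘(ℝ, EM) 𝓘(ℝ, EP) σ y v)

/-- `σ` is a (global, smooth) gauge, radial with respect to the family of dilations `δ`:
`(σ^* ω)(S) = 0` for the radial vector field `S(y) = d/ds δ_s(y)` at `s = 1`. -/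
def IsRadialGauge (δ : ℝ → M → M) (σ : M → P) : Prop :=
  ContMDiff 𝓘(ℝ, EM) 𝓘(ℝ, EP) ∞ σ ∧ (∀ y, B.proj (σ y) = y) ∧
  ∀ y, conn.form (σ (δ 1 y))
    (mfderiv 𝓘(ℝ, EM) 𝓘(ℝ, EP) σ (δ 1 y) (velocity EM (fun s => δ s y) 1)) = 0

open Classical in
/-- The horizontal lift to `p` of a tangent vector of the base. -/
def horizontalLift (p : P) (v : TangentSpace 𝓘(ℝ, EM) (B.proj p)) : TangentSpace 𝓘(ℝ, EP) p :=
  if h : ∃ u : TangentSpace 𝓘(ℝ, EP) p,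
      mfderiv 𝓘(ℝ, EP) 𝓘(ℝ, EM) B.proj p u = v ∧ conn.form p u = 0
    then h.choose else 0

end PrincipalConnection

/-- The integral over the filling disk `(s, t) ↦ δ_s(c(t))`, `(s, t) ∈ [0, 1]²`, of a two-form
with values in the Lie algebra. -/
def diskIntegral (δ : ℝ → M → M)
    (α : ∀ y : M, TangentSpace 𝓘(ℝ, EM) y → TangentSpace 𝓘(ℝ, EM) y → EG) (c : ℝ → M) : EG :=
  ∫ t in (0 : ℝ)..1, ∫ s in (0 : ℝ)..1,
    α (δ s (c t)) (velocity EM (fun r => δ r (c t)) s) (velocity EM (fun r => δ s (c r)) t)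

/-- A two-form `α` is of weight `≥ m` with respect to the dilations `δ`:
`s^{-k} δ_s^* α → 0` as `s ↓ 0`, for every integer `k < m`. -/
def IsOfWeightGE (δ : ℝ → M → M)
    (α : ∀ y : M, TangentSpace 𝓘(ℝ, EM) y → TangentSpace 𝓘(ℝ, EM) y → EG) (m : ℕ) : Prop :=
  ∀ k : ℤ, k < m → ∀ (y : M) (u v : TangentSpace 𝓘(ℝ, EM) y),
    Tendsto (fun s : ℝ => s ^ (-k) •
      α (δ s y) (mfderiv 𝓘(ℝ, EM) 𝓘(ℝ, EM) (δ s) y u) (mfderiv 𝓘(ℝ, EM) 𝓘(ℝ, EM) (δ s) y v))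
      (𝓝[>] 0) (𝓝 0)

/-- `Hol_p = exp(-F + O(ℓ^N))` on loops at `x`, as `ℓ → 0`: for loops `γ` at `x` with `ℓ(γ) < ε`,
the holonomy of `γ` at `p` exists, is unique, and equals `exp X` for some `X` in the Lie algebra
with `‖X + F(γ)‖ ≤ C ℓ(γ)^N`. -/
def HolonomyExpansion (x : M) (p : P) (ℓ : (ℝ → M) → ℝ≥0∞) (F : (ℝ → M) → EG) (N : ℕ) : Prop :=
  ∃ ε > 0, ∃ C > 0, ∀ γ : ℝ → M, IsLoopAt EM x γ → ℓ γ < ENNReal.ofReal ε →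
    ∃ X : EG, (∀ a : G, conn.IsHolonomy p γ a ↔ a = lieExp EG G X) ∧
      ‖X + F γ‖ ≤ C * (ℓ γ).toReal ^ N

end Bundles

/-! ### Carnot groups -/

section Carnot

variable (E N : Type*) [NormedAddCommGroup E] [NormedSpace ℝ E]
  [TopologicalSpace N] [ChartedSpace E N] [Group N]

/-- A stratification `𝔫 = 𝔫₁ ⊕ ⋯ ⊕ 𝔫_λ` of the Lie algebra of a Lie group `N`, with an inner
product on `𝔫₁`. -/
structure CarnotStructure where
  /-- the number `λ` of layers -/
  step : ℕ
  /-- the layers `𝔫_j`, extended by zero to `j = 0` and `j > λ` -/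
  layer : ℕ → Submodule ℝ (GroupLieAlgebra 𝓘(ℝ, E) N)
  layer_zero : layer 0 = ⊥
  layer_of_gt : ∀ j, step < j → layer j = ⊥
  isInternal : DirectSum.IsInternal layer
  /-- `[𝔫₁, 𝔫_j] = 𝔫_{j+1}` for `1 ≤ j`; for `j = λ` this says `[𝔫₁, 𝔫_λ] = 0` -/
  bracket : ∀ j, 1 ≤ j →
    Submodule.span ℝ {C | ∃ A ∈ layer 1, ∃ A' ∈ layer j, ⁅A, A'⁆ = C} = layer (j + 1)
  /-- the inner product on `𝔫₁` -/
  inner : layer 1 →ₗ[ℝ] layer 1 →ₗ[ℝ] ℝ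
  inner_symm : ∀ A A', inner A A' = inner A' A
  inner_pos : ∀ A, A ≠ 0 → 0 < inner A A

namespace CarnotStructure

variable {E N} (S : CarnotStructure E N)

/-- A horizontal curve on `[0, 1]`: absolutely continuous and almost everywhere tangent to the
left-invariant distribution spanned by `𝔫₁`. -/
def IsHorizontal (c : ℝ → N) : Prop :=
  IsAbsContCurve E c ∧ ∀ᵐ t ∂(volume.restrict (Icc (0 : ℝ) 1)),
    ∃ A : S.layer 1, mulInvariantVectorField (A : GroupLieAlgebra 𝓘(ℝ, E) N) (c t) = velocity E c t

open Classical in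
/-- The left-invariant sub-Riemannian norm of a horizontal tangent vector. -/
def horizontalNorm (y : N) (v : TangentSpace 𝓘(ℝ, E) y) : ℝ :=
  if h : ∃ A : S.layer 1, mulInvariantVectorField (A : GroupLieAlgebra 𝓘(ℝ, E) N) y = v
    then Real.sqrt (S.inner h.choose h.choose) else 0

/-- The Carnot–Carathéodory metric: the infimum of the lengths of the horizontal curves from
`y` to `z`. -/
def ccDist (y z : N) : ℝ≥0∞ :=
  ⨅ (c : ℝ → N) (_ : S.IsHorizontal c ∧ c 0 = y ∧ c 1 = z),
    ∫⁻ t in Icc (0 : ℝ) 1, ENNReal.ofReal (S.horizontalNorm (c t) (velocity E c t))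

/-- `δ_s`, `s > 0`, are the dilations of `N`: `δ_s` is the Lie group automorphism, unique since
`N` is connected, whose derivative at the identity is `A ↦ s^j A` on `𝔫_j`. Values `δ_s` for
`s ≤ 0` are irrelevant. -/
def IsDilation (δ : ℝ → N → N) : Prop :=
  ∀ s : ℝ, 0 < s →
    Function.Bijective (δ s) ∧ (∀ y z, δ s (y * z) = δ s y * δ s z) ∧
    ContMDiff 𝓘(ℝ, E) 𝓘(ℝ, E) ∞ (δ s) ∧
    ∀ j, ∀ A ∈ S.layer j, (mfderiv 𝓘(ℝ, E) 𝓘(ℝ, E) (δ s) 1 A : E) = s ^ j • (A : E)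

end CarnotStructure

variable {N} in
/-- The dilations `δ^x_s = l_x ∘ δ_s ∘ l_{x⁻¹}` centred at `x`. -/
def dilationAt (δ : ℝ → N → N) (x : N) (s : ℝ) (y : N) : N := x * δ s (x⁻¹ * y)

end Carnot

/-! ### Euclidean space -/

section Euclidean

/-- The dilations of a vector space centred at `x`. -/
def vectorDilationAt {V : Type*} [NormedAddCommGroup V] [NormedSpace ℝ V]
    (x : V) (s : ℝ) (y : V) : V := x + s • (y - x)

variable {EG G EP P V : Type*}
  [NormedAddCommGroup EG] [NormedSpace ℝ EG]
  [TopologicalSpace G] [ChartedSpace EG G] [Group G]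
  [NormedAddCommGroup EP] [NormedSpace ℝ EP] [TopologicalSpace P] [ChartedSpace EP P]
  [IsManifold 𝓘(ℝ, EP) ∞ P]
  [NormedAddCommGroup V] [NormedSpace ℝ V]
  {B : PrincipalBundle EG G EP P V V} (conn : PrincipalConnection B)

namespace PrincipalConnection

/-- The iterated covariant derivative, in the directions of constant vector fields of the base
vector space, of an equivariant function `φ` on `P` (a section of `Ad(P)`): in one direction `v`
it is the derivative of `φ` along the horizontal lift of `v`. -/
def iterCovDeriv (φ : P → EG) : List V → P → EG
  | [] => φ
  | v :: vs => fun p =>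
      mfderiv 𝓘(ℝ, EP) 𝓘(ℝ, EG) (iterCovDeriv φ vs) p (conn.horizontalLift p v)

/-- The component `Ω(hu, hw)` of the curvature, for constant vector fields `u`, `w`. -/
def curvatureComponent (u w : V) (p : P) : EG :=
  conn.curvature p (conn.horizontalLift p u) (conn.horizontalLift p w)

/-- `Ω` and all its covariant derivatives of order `≤ k` vanish at `x`. -/
def CurvatureVanishesToOrder (x : V) (k : ℕ) : Prop :=
  ∀ (u w : V) (vs : List V), vs.length ≤ k → ∀ p : P, B.proj p = x →
    conn.iterCovDeriv (conn.curvatureComponent u w) vs p = 0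

end PrincipalConnection

end Euclidean

end

/-! Put A = σ^*ω. A horizontal lift of γ has the form σ(γ(t))·g(t), where g(0) = 1 and g' =
dR_g(-A(γ')); for a loop the holonomy is g(1). In the chart at the identity this is a Carathéodory
equation z' = R(z) a(t) with a = -A(γ') integrable and R = id at the base point. Comparison with the
equations of constant coefficient X, whose solutions are one-parameter subgroups, shows for small
∫‖A(γ')‖ that g(1) = exp X with X = -∫A(γ') + O((∫‖A(γ')‖)²): see `exists_caratheodory_expansion`,
`exists_rightTrans_solution` and `exists_holonomy_expansion`.

The radial gauge then serves twice. Since A(S) = 0, the bracket drops out of ι_SΩ and Cartan's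
formula reads s d/ds δ_s^*A = δ_s^*(ι_SΩ). As δ_s^*A tends to 0 at s = 0, integration over the rays
gives ∫_γ A = ∫_disk σ^*Ω exactly (`DilationChart.integral_pullCurv`), so the only error is the
quadratic one. Moreover, an order of vanishing of Ω passes to A: weight ≥ m gives ‖δ_s^*A‖ ≤ C s^m
locally uniformly (`form_isLittleO_of_weight`, `exists_form_le`). A loop of length ℓ is the
dilation, with factor s of order ℓ, of a loop of bounded length. Hence ∫‖A(γ')‖ = O(ℓ^m), and the
quadratic error is O(ℓ^(2m)) (`form_estimate`, `DilationChart.holonomyExpansion`).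

Both cases of the theorem are instances of `DilationChart`, which records coordinates that linearise
the dilations and are Lipschitz for the metric. On a vector space the radial gauge forces A = 0 at
x, which amounts to weight 2; σ is horizontal along rays, so there covariant derivatives of Ω are
ordinary ones, and vanishing up to order k amounts to weight 3 + k. On a Carnot group the
coordinates of the second kind for a graded basis linearise the dilations, and they are Lipschitz
near x because compactly supported smooth functions are Lipschitz for the Carnot–Carathéodory
metric. -/

set_option linter.unusedSectionVars false

noncomputable section

/-! ### Derivatives between manifolds, in the model spaces -/

section ModelDerivative

variable (E E' : Type*) [NormedAddCommGroup E] [NormedSpace ℝ E]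
  [NormedAddCommGroup E'] [NormedSpace ℝ E']
  {M M' : Type*} [TopologicalSpace M] [ChartedSpace E M] [TopologicalSpace M'] [ChartedSpace E' M']

/-- The derivative of a map between manifolds, as a linear map between the model spaces. -/
def md (f : M → M') (x : M) : E →L[ℝ] E' := mfderiv 𝓘(ℝ, E) 𝓘(ℝ, E') f x

/-- `f` has derivative `A` at `x`, as a linear map between the model spaces. -/
def HasMD (f : M → M') (x : M) (A : E →L[ℝ] E') : Prop :=
  HasMFDerivAt 𝓘(ℝ, E) 𝓘(ℝ, E') f x A

variable {E E'}
variable {E'' : Type*} [NormedAddCommGroup E''] [NormedSpace ℝ E'']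
  {M'' : Type*} [TopologicalSpace M''] [ChartedSpace E'' M'']
  {f f₁ : M → M'} {x : M} {A A' : E →L[ℝ] E'}

theorem HasMD.md_eq (h : HasMD E E' f x A) : md E E' f x = A := HasMFDerivAt.mfderiv h

theorem HasMD.unique (h : HasMD E E' f x A) (h' : HasMD E E' f x A') : A = A' :=
  hasMFDerivAt_unique h h'

theorem MDifferentiableAt.hasMD (h : MDifferentiableAt 𝓘(ℝ, E) 𝓘(ℝ, E') f x) :
    HasMD E E' f x (md E E' f x) := h.hasMFDerivAt

theorem ContMDiffAt.hasMD {n : WithTop ℕ∞} (h : ContMDiffAt 𝓘(ℝ, E) 𝓘(ℝ, E') n f x)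
    (hn : n ≠ 0 := by simp) : HasMD E E' f x (md E E' f x) :=
  (h.mdifferentiableAt hn).hasMFDerivAt

theorem HasMD.mdifferentiableAt (h : HasMD E E' f x A) :
    MDifferentiableAt 𝓘(ℝ, E) 𝓘(ℝ, E') f x := HasMFDerivAt.mdifferentiableAt h

theorem HasMD.continuousAt (h : HasMD E E' f x A) : ContinuousAt f x :=
  h.mdifferentiableAt.continuousAt

theorem HasMD.comp {g : M' → M''} {B : E' →L[ℝ] E''} (hg : HasMD E' E'' g (f x) B)
    (hf : HasMD E E' f x A) : HasMD E E'' (fun y => g (f y)) x (B.comp A) :=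
  HasMFDerivAt.comp x hg hf

theorem HasMD.comp_of_eq {g : M' → M''} {B : E' →L[ℝ] E''} {y : M'} (hg : HasMD E' E'' g y B)
    (hf : HasMD E E' f x A) (hy : f x = y) : HasMD E E'' (fun y => g (f y)) x (B.comp A) := by
  subst hy; exact hg.comp hf

theorem HasMD.congr (h : HasMD E E' f x A) (hf : f₁ =ᶠ[𝓝 x] f) : HasMD E E' f₁ x A :=
  HasMFDerivAt.congr_of_eventuallyEq h hf

theorem hasMD_id : HasMD E E (fun y : M => y) x (ContinuousLinearMap.id ℝ E) := hasMFDerivAt_id x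

theorem hasMD_const (c : M') : HasMD E E' (fun _ : M => c) x 0 := hasMFDerivAt_const c x

theorem hasMD_iff_hasFDerivAt {f : E → E'} {x : E} : HasMD E E' f x A ↔ HasFDerivAt f A x :=
  hasMFDerivAt_iff_hasFDerivAt

theorem md_eq_fderiv {f : E → E'} {x : E} : md E E' f x = fderiv ℝ f x := mfderiv_eq_fderiv

theorem md_congr (hf : f₁ =ᶠ[𝓝 x] f) : md E E' f₁ x = md E E' f x := hf.mfderiv_eq

theorem HasMD.comp₂ {N : Type*} {F : Type*} [NormedAddCommGroup F] [NormedSpace ℝ F]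
    [TopologicalSpace N] [ChartedSpace F N] {g : M → M''} {C : E →L[ℝ] E''} {H : M' × M'' → N}
    (hH : MDifferentiableAt (𝓘(ℝ, E').prod 𝓘(ℝ, E'')) 𝓘(ℝ, F) H (f x, g x))
    (hf : HasMD E E' f x A) (hg : HasMD E E'' g x C) :
    HasMD E F (fun y => H (f y, g y)) x
      ((md E' F (fun y => H (y, g x)) (f x)).comp A
        + (md E'' F (fun z => H (f x, z)) (g x)).comp C) := by
  have h1 := HasMFDerivAt.comp x hH.hasMFDerivAt (HasMFDerivAt.prodMk hf hg)
  rw [mfderiv_prod_eq_add_comp hH] at h1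
  have : ((md E' F (fun y => H (y, g x)) (f x)).comp A
        + (md E'' F (fun z => H (f x, z)) (g x)).comp C : E →L[ℝ] F) =
      ((md E' F (fun y => H (y, g x)) (f x)).comp (ContinuousLinearMap.fst ℝ E' E'')
        + (md E'' F (fun z => H (f x, z)) (g x)).comp (ContinuousLinearMap.snd ℝ E' E'')).comp
          (A.prod C) := by
    ext v; simp
  rw [this]
  exact h1

variable (E) in
/-- The velocity of a curve, in the model space. -/
def vel (c : ℝ → M) (t : ℝ) : E := md ℝ E c t 1

theorem vel_eq_deriv (c : ℝ → E) (t : ℝ) : vel E c t = deriv c t := by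
  rw [vel, md_eq_fderiv]; rfl

theorem vel_congr {c c' : ℝ → M} {t : ℝ} (h : c =ᶠ[𝓝 t] c') : vel E c t = vel E c' t := by
  rw [vel, md_congr h, vel]

theorem MDifferentiableAt.vel_comp {g : M → M'} {c : ℝ → M} {t : ℝ} {B : E →L[ℝ] E'}
    (hg : HasMD E E' g (c t) B) (hc : MDifferentiableAt 𝓘(ℝ, ℝ) 𝓘(ℝ, E) c t) :
    vel E' (fun r => g (c r)) t = B (vel E c t) := by
  rw [vel, (hg.comp hc.hasMD).md_eq]; rfl

theorem HasMD.vel_eq {c : ℝ → M} {t : ℝ} {B : ℝ →L[ℝ] E} (h : HasMD ℝ E c t B) :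
    vel E c t = B 1 := by rw [vel, h.md_eq]

variable [IsManifold 𝓘(ℝ, E) ∞ M]

theorem contMDiffAt_extChartAt_symm {x : M} {z : E} (hz : z ∈ (extChartAt 𝓘(ℝ, E) x).target) :
    ContMDiffAt 𝓘(ℝ, E) 𝓘(ℝ, E) ∞ (extChartAt 𝓘(ℝ, E) x).symm z :=
  (contMDiffOn_extChartAt_symm x).contMDiffAt ((isOpen_extChartAt_target x).mem_nhds hz)

theorem contMDiffAt_extChartAt_of_mem {x y : M} (hy : y ∈ (extChartAt 𝓘(ℝ, E) x).source) :
    ContMDiffAt 𝓘(ℝ, E) 𝓘(ℝ, E) ∞ (extChartAt 𝓘(ℝ, E) x) y :=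
  contMDiffAt_extChartAt' (by simpa using hy)

theorem md_extChartAt_self (x : M) :
    md E E (extChartAt 𝓘(ℝ, E) x) x = ContinuousLinearMap.id ℝ E := by
  have : IsManifold 𝓘(ℝ, E) 1 M := .of_le (n := ∞) (by simp)
  exact mfderiv_extChartAt_self

theorem md_extChartAt_symm_comp {x y : M} (hy : y ∈ (extChartAt 𝓘(ℝ, E) x).source) (v : E) :
    md E E (extChartAt 𝓘(ℝ, E) x).symm (extChartAt 𝓘(ℝ, E) x y)
      (md E E (extChartAt 𝓘(ℝ, E) x) y v) = v := by
  have h1 := (contMDiffAt_extChartAt_symm ((extChartAt 𝓘(ℝ, E) x).map_source hy)).hasMD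
  have h2 := (h1.comp (contMDiffAt_extChartAt_of_mem hy).hasMD).congr (f₁ := fun y => y) ?_
  · simpa using DFunLike.congr_fun (h2.unique hasMD_id) v
  · filter_upwards [(isOpen_extChartAt_source (I := 𝓘(ℝ, E)) x).mem_nhds hy] with z hz
    exact ((extChartAt 𝓘(ℝ, E) x).left_inv hz).symm

end ModelDerivative

/-! ### Smoothness of pulled back one-forms -/

section TangentSmooth

variable {E F W : Type*} [NormedAddCommGroup E] [NormedSpace ℝ E]
  [NormedAddCommGroup F] [NormedSpace ℝ F] [NormedAddCommGroup W] [NormedSpace ℝ W]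
  {P : Type*} [TopologicalSpace P] [ChartedSpace E P] [IsManifold 𝓘(ℝ, E) ∞ P]

/-- Pulling back a smooth one-form along a smooth map from an open set of a vector space. -/
theorem contDiffOn_pullback_oneForm [FiniteDimensional ℝ W]
    {α : ∀ p : P, TangentSpace 𝓘(ℝ, E) p →L[ℝ] F}
    (hα : ContMDiff 𝓘(ℝ, E).tangent 𝓘(ℝ, F) ∞
      (fun v : TangentBundle 𝓘(ℝ, E) P => α v.proj v.2))
    {Q : W → P} {O : Set W} (hO : IsOpen O) (hQ : ContMDiffOn 𝓘(ℝ, W) 𝓘(ℝ, E) ∞ Q O) :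
    ContDiffOn ℝ ∞ (fun w => (show E →L[ℝ] F from α (Q w)).comp (md W E Q w)) O := by
  rw [contDiffOn_clm_apply]
  intro v
  have h1 : ContMDiffOn 𝓘(ℝ, W).tangent 𝓘(ℝ, E).tangent ∞ (tangentMapWithin 𝓘(ℝ, W) 𝓘(ℝ, E) Q O)
      (Bundle.TotalSpace.proj ⁻¹' O) :=
    hQ.contMDiffOn_tangentMapWithin (by simp) hO.uniqueMDiffOn
  have h2 : ContMDiff 𝓘(ℝ, W) 𝓘(ℝ, W).tangent ∞
      (fun w : W => (⟨w, v⟩ : TangentBundle 𝓘(ℝ, W) W)) := by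
    exact contMDiff_vectorSpace_iff_contDiff.2 contDiff_const
  have h3 := hα.comp_contMDiffOn (h1.comp h2.contMDiffOn (s := O) (fun w hw => hw))
  rw [contMDiffOn_iff_contDiffOn] at h3
  refine h3.congr fun w hw => ?_
  simp only [Function.comp, tangentMapWithin, mfderivWithin_of_isOpen hO hw]
  rfl

end TangentSmooth

/-! ### Absolutely continuous curves -/

section AbsCont

/-- The oscillation sums of f over any family of disjoint intervals are at most C times those of g
and h together. Used for Lipschitz functions of two curves and for primitives. -/
theorem AbsolutelyContinuousOnInterval.of_dist_le {X Y Z : Type*} [PseudoMetricSpace X]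
    [PseudoMetricSpace Y] [PseudoMetricSpace Z] {f : ℝ → Z} {g : ℝ → X} {h : ℝ → Y} {a b C : ℝ}
    (hg : AbsolutelyContinuousOnInterval g a b) (hh : AbsolutelyContinuousOnInterval h a b)
    (hf : ∀ s ∈ uIcc a b, ∀ t ∈ uIcc a b,
      dist (f s) (f t) ≤ C * (dist (g s) (g t) + dist (h s) (h t))) :
    AbsolutelyContinuousOnInterval f a b := by
  have h1 := (Tendsto.add hg hh).const_mul C
  simp only [add_zero, mul_zero] at h1
  refine squeeze_zero' (Eventually.of_forall fun _ => Finset.sum_nonneg fun _ _ => dist_nonneg)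
    ?_ h1
  filter_upwards [mem_inf_of_right (mem_principal_self _)] with I hI
  rw [← Finset.sum_add_distrib, Finset.mul_sum]
  refine Finset.sum_le_sum fun i hi => hf _ ?_ _ ?_
  · exact (hI.1 i hi).1
  · exact (hI.1 i hi).2

variable {E E' F : Type*} [NormedAddCommGroup E] [NormedSpace ℝ E]
  [NormedAddCommGroup E'] [NormedSpace ℝ E'] [NormedAddCommGroup F] [NormedSpace ℝ F]
  {M M' N : Type*} [TopologicalSpace M] [ChartedSpace E M] [TopologicalSpace M']
  [ChartedSpace E' M'] [TopologicalSpace N] [ChartedSpace F N]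

theorem uIcc_max_min {t r : ℝ} (ht : t ∈ Icc (0 : ℝ) 1) (hr : 0 < r) :
    uIcc (max 0 (t - r)) (min 1 (t + r)) = Icc (max 0 (t - r)) (min 1 (t + r)) := by
  apply uIcc_of_le
  have := ht.1; have := ht.2
  apply max_le <;> apply le_min <;> linarith

theorem mem_Icc_max_min {t r s : ℝ} :
    s ∈ Icc (max 0 (t - r)) (min 1 (t + r)) ↔ s ∈ Icc (0 : ℝ) 1 ∧ |s - t| ≤ r := by
  simp only [mem_Icc, max_le_iff, le_min_iff, abs_le]
  constructor
  · rintro ⟨⟨h1, h2⟩, h3, h4⟩; refine ⟨⟨h1, h3⟩, ?_, ?_⟩ <;> linarith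
  · rintro ⟨⟨h1, h2⟩, h3, h4⟩; refine ⟨⟨h1, ?_⟩, h2, ?_⟩ <;> linarith

theorem exists_pos_forall_of_eventually {p : ℝ → Prop} {t : ℝ}
    (h : ∀ᶠ s in 𝓝[Icc (0 : ℝ) 1] t, p s) :
    ∃ r > 0, ∀ s ∈ Icc (0 : ℝ) 1, |s - t| ≤ r → p s := by
  rw [eventually_nhdsWithin_iff, Metric.eventually_nhds_iff] at h
  obtain ⟨r, hr, h⟩ := h
  refine ⟨r / 2, by positivity, fun s hs hst => h ?_ hs⟩
  rw [Real.dist_eq]; linarith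

/-- A smooth function of two absolutely continuous curves is absolutely continuous. -/
theorem IsAbsContCurve.comp₂ [IsManifold 𝓘(ℝ, E) ∞ M] [IsManifold 𝓘(ℝ, E') ∞ M']
    [IsManifold 𝓘(ℝ, F) ∞ N] {c : ℝ → M} {c' : ℝ → M'} {H : M × M' → N}
    (hc : IsAbsContCurve E c) (hc' : IsAbsContCurve E' c')
    (hH : ∀ t ∈ Icc (0 : ℝ) 1,
      ContMDiffAt (𝓘(ℝ, E).prod 𝓘(ℝ, E')) 𝓘(ℝ, F) ∞ H (c t, c' t)) :
    IsAbsContCurve F (fun t => H (c t, c' t)) := by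
  have hcont : ContinuousOn (fun t => H (c t, c' t)) (Icc 0 1) := fun t ht =>
    (hH t ht).continuousAt.comp_continuousWithinAt (f := fun t => (c t, c' t))
      ((hc.1 t ht).prodMk (hc'.1 t ht))
  refine ⟨hcont, fun t₀ ht₀ => ?_⟩
  obtain ⟨r, hr, hm, ha⟩ := hc.2 t₀ ht₀
  obtain ⟨r', hr', hm', ha'⟩ := hc'.2 t₀ ht₀
  set φ := extChartAt 𝓘(ℝ, E) (c t₀) with hφ
  set φ' := extChartAt 𝓘(ℝ, E') (c' t₀) with hφ'
  set ψ := extChartAt 𝓘(ℝ, F) (H (c t₀, c' t₀)) with hψ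
  let K : E × E' → F := fun z => ψ (H (φ.symm z.1, φ'.symm z.2))
  have hz : φ (c t₀) ∈ φ.target := mem_extChartAt_target _
  have hz' : φ' (c' t₀) ∈ φ'.target := mem_extChartAt_target _
  have e1 : φ.symm (φ (c t₀)) = c t₀ := extChartAt_to_inv _
  have e2 : φ'.symm (φ' (c' t₀)) = c' t₀ := extChartAt_to_inv _
  have hK : ContDiffAt ℝ 1 K (φ (c t₀), φ' (c' t₀)) := by
    have h1 : ContMDiffAt 𝓘(ℝ, E × E') 𝓘(ℝ, E) ∞ (fun z : E × E' => φ.symm z.1)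
        (φ (c t₀), φ' (c' t₀)) :=
      (contMDiffAt_extChartAt_symm hz).comp (φ (c t₀), φ' (c' t₀))
        contDiff_fst.contMDiff.contMDiffAt
    have h2 : ContMDiffAt 𝓘(ℝ, E × E') 𝓘(ℝ, E') ∞ (fun z : E × E' => φ'.symm z.2)
        (φ (c t₀), φ' (c' t₀)) :=
      (contMDiffAt_extChartAt_symm hz').comp (φ (c t₀), φ' (c' t₀))
        contDiff_snd.contMDiff.contMDiffAt
    have h3 : ContMDiffAt 𝓘(ℝ, E × E') 𝓘(ℝ, F) ∞ (fun z : E × E' => H (φ.symm z.1, φ'.symm z.2))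
        (φ (c t₀), φ' (c' t₀)) := by
      refine ContMDiffAt.comp (φ (c t₀), φ' (c' t₀)) (g := H)
        (f := fun z : E × E' => (φ.symm z.1, φ'.symm z.2)) ?_ (h1.prodMk h2)
      simp only [e1, e2]; exact hH t₀ ht₀
    have h4 : ContMDiffAt 𝓘(ℝ, E × E') 𝓘(ℝ, F) ∞ K (φ (c t₀), φ' (c' t₀)) := by
      refine ContMDiffAt.comp (φ (c t₀), φ' (c' t₀)) (g := ψ)
        (f := fun z : E × E' => H (φ.symm z.1, φ'.symm z.2)) ?_ h3
      simp only [e1, e2]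
      exact contMDiffAt_extChartAt
    exact (contMDiffAt_iff_contDiffAt.1 h4).of_le (by simp)
  -- In charts H is C¹, hence Lipschitz near the point. The radius R below keeps both curves in
  -- their charts and in the Lipschitz neighbourhood, and the image curve in its chart.
  obtain ⟨L, V, hV, hL⟩ := hK.exists_lipschitzOnWith
  have cφ : ContinuousWithinAt (fun t => (φ (c t), φ' (c' t))) (Icc 0 1) t₀ :=
    ((continuousAt_extChartAt _).comp_continuousWithinAt (hc.1 t₀ ht₀)).prodMk
      ((continuousAt_extChartAt _).comp_continuousWithinAt (hc'.1 t₀ ht₀))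
  obtain ⟨r₁, hr₁, h₁⟩ := exists_pos_forall_of_eventually (cφ hV)
  obtain ⟨r₂, hr₂, h₂⟩ := exists_pos_forall_of_eventually
    (hcont t₀ ht₀ ((chartAt F (H (c t₀, c' t₀))).open_source.mem_nhds (mem_chart_source F _)))
  let R := min (min r r') (min r₁ r₂)
  have hR : 0 < R := lt_min (lt_min hr hr') (lt_min hr₁ hr₂)
  have sub : Icc (max 0 (t₀ - R)) (min 1 (t₀ + R)) ⊆ Icc (max 0 (t₀ - r)) (min 1 (t₀ + r)) :=
    fun s hs => by
      rw [mem_Icc_max_min] at hs ⊢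
      exact ⟨hs.1, hs.2.trans ((min_le_left _ _).trans (min_le_left _ _))⟩
  have sub' : Icc (max 0 (t₀ - R)) (min 1 (t₀ + R)) ⊆ Icc (max 0 (t₀ - r')) (min 1 (t₀ + r')) :=
    fun s hs => by
      rw [mem_Icc_max_min] at hs ⊢
      exact ⟨hs.1, hs.2.trans ((min_le_left _ _).trans (min_le_right _ _))⟩
  refine ⟨R, hR, fun s hs => ?_, ?_⟩
  · rw [mem_Icc_max_min] at hs
    exact h₂ s hs.1 (hs.2.trans ((min_le_right _ _).trans (min_le_right _ _)))
  · have ha₁ := ha.mono (c := max 0 (t₀ - R)) (d := min 1 (t₀ + R)) (by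
      rw [uIcc_max_min ht₀ hR, uIcc_max_min ht₀ hr]; exact sub)
    have ha₂ := ha'.mono (c := max 0 (t₀ - R)) (d := min 1 (t₀ + R)) (by
      rw [uIcc_max_min ht₀ hR, uIcc_max_min ht₀ hr']; exact sub')
    have key : ∀ s ∈ Icc (max 0 (t₀ - R)) (min 1 (t₀ + R)),
        chartAt F (H (c t₀, c' t₀)) (H (c s, c' s)) = K (φ (c s), φ' (c' s)) ∧
          (φ (c s), φ' (c' s)) ∈ V := by
      intro s hs
      have i1 : φ.symm (φ (c s)) = c s := φ.left_inv (by
        rw [hφ, extChartAt_source]; exact hm (sub hs))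
      have i2 : φ'.symm (φ' (c' s)) = c' s := φ'.left_inv (by
        rw [hφ', extChartAt_source]; exact hm' (sub' hs))
      refine ⟨by simp only [K, i1, i2]; rfl, ?_⟩
      rw [mem_Icc_max_min] at hs
      exact h₁ s hs.1 (hs.2.trans ((min_le_right _ _).trans (min_le_left _ _)))
    refine ha₁.of_dist_le ha₂ (C := L) fun s hs t ht => ?_
    rw [uIcc_max_min ht₀ hR] at hs ht
    rw [(key s hs).1, (key t ht).1]
    refine (hL.dist_le_mul _ (key s hs).2 _ (key t ht).2).trans ?_
    gcongr
    rw [Prod.dist_eq]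
    exact max_le_add_of_nonneg dist_nonneg dist_nonneg

theorem IsAbsContCurve.comp [IsManifold 𝓘(ℝ, E) ∞ M] [IsManifold 𝓘(ℝ, F) ∞ N]
    {c : ℝ → M} {H : M → N} (hc : IsAbsContCurve E c)
    (hH : ∀ t ∈ Icc (0 : ℝ) 1, ContMDiffAt 𝓘(ℝ, E) 𝓘(ℝ, F) ∞ H (c t)) :
    IsAbsContCurve F (fun t => H (c t)) :=
  hc.comp₂ hc (H := fun q => H q.1) fun t ht =>
    ContMDiffAt.comp (c t, c t) (f := Prod.fst) (hH t ht) contMDiffAt_fst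

/-- A locally null set is null, as the line is second countable. This globalises almost everywhere
statements proved chart by chart. -/
theorem ae_restrict_Icc_of_local {p : ℝ → Prop}
    (h : ∀ t₀ ∈ Icc (0 : ℝ) 1, ∃ r > 0, ∀ᵐ t, t ∈ Icc (max 0 (t₀ - r)) (min 1 (t₀ + r)) → p t) :
    ∀ᵐ t ∂(volume.restrict (Icc (0 : ℝ) 1)), p t := by
  rw [ae_restrict_iff' measurableSet_Icc, ae_iff]
  refine measure_null_of_locally_null _ fun t₀ ht₀ => ?_
  simp only [Classical.not_imp, mem_ofPred_eq] at ht₀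
  obtain ⟨r, hr, h⟩ := h t₀ ht₀.1
  refine ⟨_, inter_mem_nhdsWithin _ (Metric.ball_mem_nhds t₀ hr), ?_⟩
  rw [ae_iff] at h
  refine measure_mono_null (fun t ht => ?_) h
  simp only [Classical.not_imp, mem_ofPred_eq, mem_inter_iff, Metric.mem_ball, Real.dist_eq] at ht ⊢
  exact ⟨mem_Icc_max_min.2 ⟨ht.1.1, ht.2.le⟩, ht.1.2⟩

/-- Velocities are two-sided derivatives, while curves are controlled on `[0, 1]` only; discarding
the two endpoints reconciles this. -/
theorem ae_mem_Ioo_zero_one : ∀ᵐ t ∂(volume.restrict (Icc (0 : ℝ) 1)), t ∈ Ioo (0 : ℝ) 1 := by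
  rw [← restrict_Ioo_eq_restrict_Icc]
  exact ae_restrict_mem measurableSet_Ioo

theorem IsAbsContCurve.eventually_mem_source {c : ℝ → M} (hc : IsAbsContCurve E c) {t t₀ : ℝ}
    (ht : t ∈ Ioo (0 : ℝ) 1) (h : c t ∈ (extChartAt 𝓘(ℝ, E) (c t₀)).source) :
    ∀ᶠ s in 𝓝 t, c s ∈ (extChartAt 𝓘(ℝ, E) (c t₀)).source :=
  (hc.1.continuousAt (Icc_mem_nhds ht.1 ht.2)).eventually
    ((isOpen_extChartAt_source (I := 𝓘(ℝ, E)) _).mem_nhds h)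

/-- An absolutely continuous curve is differentiable almost everywhere. -/
theorem IsAbsContCurve.ae_mdifferentiableAt [FiniteDimensional ℝ E] [IsManifold 𝓘(ℝ, E) ∞ M]
    {c : ℝ → M} (hc : IsAbsContCurve E c) :
    ∀ᵐ t ∂(volume.restrict (Icc (0 : ℝ) 1)), MDifferentiableAt 𝓘(ℝ, ℝ) 𝓘(ℝ, E) c t := by
  have h : ∀ᵐ t ∂(volume.restrict (Icc (0 : ℝ) 1)),
      t ∈ Ioo (0 : ℝ) 1 → MDifferentiableAt 𝓘(ℝ, ℝ) 𝓘(ℝ, E) c t := by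
    refine ae_restrict_Icc_of_local fun t₀ ht₀ => ?_
    obtain ⟨r, hr, hm, ha⟩ := hc.2 t₀ ht₀
    refine ⟨r, hr, ?_⟩
    -- In the chart, absolute continuity gives bounded variation, and Lebesgue's theorem applies;
    -- the inverse chart carries differentiability back to M.
    filter_upwards [ha.boundedVariationOn.ae_differentiableAt_of_mem_uIcc] with t ht h1 h2
    rw [uIcc_max_min ht₀ hr] at ht
    have hs : c t ∈ (extChartAt 𝓘(ℝ, E) (c t₀)).source := by
      rw [extChartAt_source]; exact hm h1
    have hd : HasMD ℝ E (fun t => extChartAt 𝓘(ℝ, E) (c t₀) (c t)) t _ :=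
      hasMD_iff_hasFDerivAt.2 (ht h1).hasFDerivAt
    have h3 := (contMDiffAt_extChartAt_symm ((extChartAt 𝓘(ℝ, E) (c t₀)).map_source hs)).hasMD
    refine ((h3.comp_of_eq hd rfl).congr ?_).mdifferentiableAt
    filter_upwards [hc.eventually_mem_source h2 hs] with s hs
    exact ((extChartAt 𝓘(ℝ, E) (c t₀)).left_inv hs).symm
  filter_upwards [h, ae_mem_Ioo_zero_one] with t h1 h2 using h1 h2

/-- Connectedness of `[0, 1]`: a locally constant function on it is constant. -/
theorem eq_of_locally_eq_Icc {X : Type*} {f : ℝ → X}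
    (h : ∀ t₀ ∈ Icc (0 : ℝ) 1, ∃ r > 0, ∀ s ∈ Icc (0 : ℝ) 1, |s - t₀| ≤ r → f s = f t₀)
    {s t : ℝ} (hs : s ∈ Icc (0 : ℝ) 1) (ht : t ∈ Icc (0 : ℝ) 1) : f s = f t := by
  have : IsLocallyConstant (fun t : Icc (0 : ℝ) 1 => f t) := by
    rw [IsLocallyConstant.iff_eventually_eq]
    intro t₀
    obtain ⟨r, hr, h⟩ := h t₀ t₀.2
    filter_upwards [Metric.ball_mem_nhds t₀ hr] with s hs
    exact h s s.2 (by rw [Metric.mem_ball, Subtype.dist_eq, Real.dist_eq] at hs; exact hs.le)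
  exact this.apply_eq_of_preconnectedSpace ⟨s, hs⟩ ⟨t, ht⟩

/-- An absolutely continuous curve whose velocity vanishes almost everywhere is constant. -/
theorem IsAbsContCurve.eq_of_ae_vel_eq_zero [FiniteDimensional ℝ E] [IsManifold 𝓘(ℝ, E) ∞ M]
    {c : ℝ → M} (hc : IsAbsContCurve E c)
    (h0 : ∀ᵐ t ∂(volume.restrict (Icc (0 : ℝ) 1)), vel E c t = 0) {s t : ℝ}
    (hs : s ∈ Icc (0 : ℝ) 1) (ht : t ∈ Icc (0 : ℝ) 1) : c s = c t := by
  refine eq_of_locally_eq_Icc (fun t₀ ht₀ => ?_) hs ht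
  obtain ⟨r, hr, hm, ha⟩ := hc.2 t₀ ht₀
  have hd := hc.ae_mdifferentiableAt
  have hi := ae_mem_Ioo_zero_one
  rw [ae_restrict_iff' measurableSet_Icc] at h0 hd hi
  have h1 : ∀ᵐ t, t ∈ uIcc (max 0 (t₀ - r)) (min 1 (t₀ + r)) →
      HasDerivAt (fun t => chartAt E (c t₀) (c t)) 0 t := by
    filter_upwards [h0, hd] with t h2 h3 h4
    rw [uIcc_max_min ht₀ hr] at h4
    have ht := (mem_Icc_max_min.1 h4).1
    have hs : c t ∈ (extChartAt 𝓘(ℝ, E) (c t₀)).source := by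
      rw [extChartAt_source]; exact hm h4
    have h5 := (contMDiffAt_extChartAt_of_mem hs).hasMD.comp (h3 ht).hasMD
    have h6 := (hasMD_iff_hasFDerivAt.1 h5).hasDerivAt
    have h7 := h2 ht
    rw [vel] at h7
    simpa [h7] using h6
  obtain ⟨C, hC⟩ := ha.const_of_ae_hasDerivAt_zero h1
  rw [uIcc_max_min ht₀ hr] at hC
  refine ⟨r, hr, fun s hs hst => ?_⟩
  have i1 : s ∈ Icc (max 0 (t₀ - r)) (min 1 (t₀ + r)) := mem_Icc_max_min.2 ⟨hs, hst⟩
  have i2 : t₀ ∈ Icc (max 0 (t₀ - r)) (min 1 (t₀ + r)) :=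
    mem_Icc_max_min.2 ⟨ht₀, by simpa using hr.le⟩
  exact (chartAt E (c t₀)).injOn (hm i1) (hm i2) ((hC s i1).trans (hC t₀ i2).symm)

end AbsCont

/-! ### Bounded variation, primitives and Carathéodory equations in vector spaces -/

section VectorCurves

variable {E : Type*} [NormedAddCommGroup E] [NormedSpace ℝ E]

/-- Compare right difference quotients. No differentiability of f is assumed. -/
theorem norm_deriv_le_of_norm_sub_le {f : ℝ → E} {v : ℝ → ℝ} {t : ℝ}
    (hv : DifferentiableAt ℝ v t) (h : ∀ᶠ s in 𝓝[>] t, ‖f s - f t‖ ≤ v s - v t) :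
    ‖deriv f t‖ ≤ deriv v t := by
  have hgt : 𝓝[>] t ≤ 𝓝[≠] t := nhdsWithin_mono t fun s hs => ne_of_gt hs
  have hv' := hv.hasDerivAt.tendsto_slope.mono_left hgt
  by_cases hf : DifferentiableAt ℝ f t
  · have hf' := hf.hasDerivAt.tendsto_slope.mono_left hgt
    refine le_of_tendsto_of_tendsto hf'.norm hv' ?_
    filter_upwards [h, self_mem_nhdsWithin] with s hs hst
    have hst : 0 < s - t := sub_pos.2 hst
    rw [slope_def_module, slope_def_module, norm_smul, smul_eq_mul, norm_inv, Real.norm_eq_abs,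
      abs_of_pos hst]
    gcongr
  -- Here `deriv f t` has the default value 0, and v has nonnegative increments to the right of t.
  · rw [deriv_zero_of_not_differentiableAt hf, norm_zero]
    refine ge_of_tendsto hv' ?_
    filter_upwards [h, self_mem_nhdsWithin] with s hs hst
    have hst : 0 < s - t := sub_pos.2 hst
    rw [slope_def_module, smul_eq_mul]
    exact mul_nonneg (inv_nonneg.2 hst.le) ((norm_nonneg _).trans hs)

/-- The variation function v is monotone and its increments dominate those of f, so ‖f'‖ ≤ v' almost
everywhere. Lebesgue's inequality ∫v' ≤ v(b) - v(a) for monotone functions concludes. -/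
theorem BoundedVariationOn.intervalIntegrable_deriv_and_integral_le [CompleteSpace E] {f : ℝ → E}
    {a b : ℝ} (hab : a ≤ b) (hf : BoundedVariationOn f (Icc a b)) :
    IntervalIntegrable (deriv f) volume a b ∧
      ∫ t in a..b, ‖deriv f t‖ ≤ (eVariationOn f (Icc a b)).toReal := by
  set v := variationOnFromTo f (Icc a b) a with hv
  have hl := hf.locallyBoundedVariationOn
  have ha : a ∈ Icc a b := left_mem_Icc.2 hab
  have hm : MonotoneOn v (Icc a b) := variationOnFromTo.monotoneOn hl ha
  have hvb : v b - v a = (eVariationOn f (Icc a b)).toReal := by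
    rw [hv, variationOnFromTo.self, sub_zero, variationOnFromTo.eq_of_le _ _ hab, inter_self]
  have hd : ∀ s ∈ Icc a b, ∀ t ∈ Icc a b, s ≤ t → ‖f t - f s‖ ≤ v t - v s := by
    intro s hs t ht hst
    have h1 := variationOnFromTo.add hl ha hs ht
    have h2 : v t - v s = variationOnFromTo f (Icc a b) s t := by rw [hv]; linarith
    rw [h2, variationOnFromTo.eq_of_le _ _ hst, ← dist_eq_norm, dist_comm, dist_edist]
    exact ENNReal.toReal_mono (hl s t hs ht)
      (eVariationOn.edist_le f ⟨hs, left_mem_Icc.2 hst⟩ ⟨ht, right_mem_Icc.2 hst⟩)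
  have hvi : IntervalIntegrable (deriv v) volume a b :=
    MonotoneOn.intervalIntegrable_deriv (by rwa [uIcc_of_le hab])
  have hae : ∀ᵐ t ∂(volume.restrict (Ioc a b)), ‖deriv f t‖ ≤ deriv v t := by
    rw [← restrict_Ioo_eq_restrict_Ioc, ae_restrict_iff' measurableSet_Ioo]
    filter_upwards [hm.ae_differentiableWithinAt_of_mem] with t ht hti
    have hn : Icc a b ∈ 𝓝 t := Icc_mem_nhds hti.1 hti.2
    refine norm_deriv_le_of_norm_sub_le ((ht (Ioo_subset_Icc_self hti)).differentiableAt hn) ?_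
    filter_upwards [nhdsWithin_le_nhds hn, self_mem_nhdsWithin] with s hs hst
    exact hd t (Ioo_subset_Icc_self hti) s hs (le_of_lt hst)
  have hfi : IntervalIntegrable (deriv f) volume a b := by
    rw [intervalIntegrable_iff_integrableOn_Ioc_of_le hab] at hvi ⊢
    exact Integrable.mono' hvi (aestronglyMeasurable_deriv f _) hae
  refine ⟨hfi, ?_⟩
  have h3 : ∫ t in a..b, ‖deriv f t‖ ≤ ∫ t in a..b, deriv v t := by
    rw [intervalIntegral.integral_of_le hab, intervalIntegral.integral_of_le hab]
    rw [intervalIntegrable_iff_integrableOn_Ioc_of_le hab] at hvi hfi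
    exact integral_mono_ae hfi.norm hvi hae
  have h4 := MonotoneOn.intervalIntegral_deriv_mem_uIcc (f := v) (a := a) (b := b)
    (by rwa [uIcc_of_le hab])
  rw [hvb, uIcc_of_le ENNReal.toReal_nonneg] at h4
  exact h3.trans h4.2

theorem AbsolutelyContinuousOnInterval.isAbsContCurve {f : ℝ → E}
    (hf : AbsolutelyContinuousOnInterval f 0 1) : IsAbsContCurve E f := by
  refine ⟨by simpa [uIcc_of_le] using hf.continuousOn, fun t₀ ht₀ =>
    ⟨1, one_pos, fun t _ => mem_univ _, ?_⟩⟩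
  change AbsolutelyContinuousOnInterval f _ _
  refine hf.mono ?_
  rw [uIcc_max_min ht₀ one_pos, uIcc_of_le zero_le_one]
  intro s hs
  exact (mem_Icc_max_min.1 hs).1

theorem IsAbsContCurve.exists_absCont {f : ℝ → E} (hf : IsAbsContCurve E f) {t₀ : ℝ}
    (ht₀ : t₀ ∈ Icc (0 : ℝ) 1) :
    ∃ r > 0, AbsolutelyContinuousOnInterval f (max 0 (t₀ - r)) (min 1 (t₀ + r)) := by
  obtain ⟨r, hr, -, h⟩ := hf.2 t₀ ht₀
  exact ⟨r, hr, h⟩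

theorem isAbsContCurve_primitive [CompleteSpace E] {g : ℝ → E}
    (hg : IntervalIntegrable g volume 0 1) (z : E) :
    IsAbsContCurve E (fun t => z + ∫ τ in (0 : ℝ)..t, g τ) := by
  have h1 := hg.norm.absolutelyContinuousOnInterval_intervalIntegral (c := 0) (by simp)
  refine AbsolutelyContinuousOnInterval.isAbsContCurve
    -- The primitive of ‖g‖ dominates the increments; it plays the role of both comparison
    -- functions.
    (h1.of_dist_le h1 (C := 1) fun s hs t ht => ?_)
  have i0 : (0 : ℝ) ∈ uIcc (0 : ℝ) 1 := by simp
  have hi : ∀ {u v}, u ∈ uIcc (0 : ℝ) 1 → v ∈ uIcc (0 : ℝ) 1 → IntervalIntegrable g volume u v :=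
    fun hu hv => hg.mono_set (uIcc_subset_uIcc hu hv)
  rw [dist_add_left, dist_eq_norm, intervalIntegral.integral_interval_sub_left (hi i0 hs)
    (hi i0 ht), Real.dist_eq, intervalIntegral.integral_interval_sub_left (hi i0 hs).norm
    (hi i0 ht).norm]
  have := intervalIntegral.norm_integral_le_abs_integral_norm (f := g) (a := t) (b := s)
    (μ := volume)
  have h0 := abs_nonneg (∫ τ in t..s, ‖g τ‖)
  linarith

theorem ae_hasDerivAt_primitive [CompleteSpace E] {g : ℝ → E}
    (hg : IntervalIntegrable g volume 0 1) (z : E) :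
    ∀ᵐ t ∂(volume.restrict (Icc (0 : ℝ) 1)),
      HasDerivAt (fun t => z + ∫ τ in (0 : ℝ)..t, g τ) (g t) t := by
  rw [ae_restrict_iff' measurableSet_Icc]
  filter_upwards [hg.ae_hasDerivAt_integral] with t ht h
  exact (ht (by rwa [uIcc_of_le zero_le_one]) 0 (by simp)).const_add z

/-- The fundamental theorem of calculus for absolutely continuous curves in a vector space. -/
theorem IsAbsContCurve.integral_deriv [FiniteDimensional ℝ E] {f : ℝ → E}
    (hf : IsAbsContCurve E f) :
    IntervalIntegrable (deriv f) volume 0 1 ∧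
      ∀ t ∈ Icc (0 : ℝ) 1, f t = f 0 + ∫ τ in (0 : ℝ)..t, deriv f τ := by
  have : CompleteSpace E := FiniteDimensional.complete ℝ E
  -- Absolute continuity is only given near each parameter; compactness turns local integrability
  -- into integrability.
  have hi : IntervalIntegrable (deriv f) volume 0 1 := by
    rw [intervalIntegrable_iff_integrableOn_Icc_of_le zero_le_one]
    refine LocallyIntegrableOn.integrableOn_isCompact (fun t ht => ?_) isCompact_Icc
    obtain ⟨r, hr, ha⟩ := hf.exists_absCont ht
    refine ⟨Icc (max 0 (t - r)) (min 1 (t + r)), ?_, ?_⟩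
    · refine mem_of_superset (inter_mem_nhdsWithin _ (Metric.ball_mem_nhds t hr)) fun s hs => ?_
      exact mem_Icc_max_min.2 ⟨hs.1, le_of_lt (by simpa [Real.dist_eq] using hs.2)⟩
    · have hle : max 0 (t - r) ≤ min 1 (t + r) := by
        have := mem_Icc_max_min (t := t) (r := r).2 ⟨ht, by simpa using hr.le⟩
        exact this.1.trans this.2
      have hb := ha.boundedVariationOn
      rw [uIcc_of_le hle] at hb
      have := (hb.intervalIntegrable_deriv_and_integral_le hle).1
      rwa [intervalIntegrable_iff_integrableOn_Icc_of_le hle] at this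
  refine ⟨hi, fun t ht => ?_⟩
  have hp := isAbsContCurve_primitive hi 0
  -- The difference from the primitive is absolutely continuous with velocity 0 almost everywhere,
  -- hence constant.
  have hs : IsAbsContCurve E (fun t => f t - (0 + ∫ τ in (0 : ℝ)..t, deriv f τ)) := by
    refine hf.comp₂ hp (H := fun q : E × E => q.1 - q.2) fun t _ => ?_
    exact contMDiffAt_fst.sub contMDiffAt_snd
  have h0 := hs.eq_of_ae_vel_eq_zero ?_ ht (left_mem_Icc.2 zero_le_one)
  · simp only [intervalIntegral.integral_same, zero_add, sub_zero] at h0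
    rw [← h0]; abel
  · filter_upwards [hf.ae_mdifferentiableAt, ae_hasDerivAt_primitive hi 0] with t h1 h2
    rw [vel_eq_deriv]
    have h3 := (mdifferentiableAt_iff_differentiableAt.1 h1).hasDerivAt.sub h2
    rw [sub_self] at h3
    exact h3.deriv

end VectorCurves

/-! ### Carathéodory equations: existence and comparison of solutions -/

section Caratheodory

variable {E : Type*} [NormedAddCommGroup E] [NormedSpace ℝ E]
  {R : E → E →L[ℝ] E} {L : NNReal} {K : ℝ} {z₀ : E}

theorem integrable_clm_apply {a : ℝ → E} (hR : Continuous R) (hK : ∀ z, ‖R z‖ ≤ K)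
    (ha : Integrable a) {z : ℝ → E} (hz : Continuous z) :
    Integrable (fun τ => R (z τ) (a τ)) := by
  refine Integrable.mono' (ha.norm.const_mul K) ?_ (Eventually.of_forall fun τ =>
    ((R (z τ)).le_opNorm _).trans (by gcongr; exact hK _))
  exact (isBoundedBilinearMap_apply (𝕜 := ℝ) (E := E) (F := E)).continuous.comp_aestronglyMeasurable₂
    (hR.comp hz).aestronglyMeasurable ha.1

/-- Bounding by the integral over the whole line makes all later estimates uniform in time. -/
theorem norm_intervalIntegral_le_of_norm_le {f : ℝ → E} {g : ℝ → ℝ} (hg : Integrable g)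
    (h : ∀ τ, ‖f τ‖ ≤ g τ) (s t : ℝ) : ‖∫ τ in s..t, f τ‖ ≤ ∫ τ, g τ := by
  have h0 : ∀ τ, 0 ≤ g τ := fun τ => (norm_nonneg _).trans (h τ)
  refine (intervalIntegral.norm_integral_le_integral_norm_uIoc).trans
    ((integral_mono_of_nonneg (Eventually.of_forall fun _ => norm_nonneg _) hg.integrableOn
      (Eventually.of_forall h)).trans
        (setIntegral_le_integral hg (Eventually.of_forall h0)))

/-- Existence for Carathéodory equations `z' = R(z) a(t)` with small integrable `a`. -/
theorem exists_caratheodory_solution [CompleteSpace E] (hL : LipschitzWith L R) (hK : ∀ z, ‖R z‖ ≤ K)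
    {a : ℝ → E} (ha : Integrable a) (hsmall : L * ∫ τ, ‖a τ‖ ≤ 1 / 2) (z₀ : E) :
    ∃ z : ℝ → E, Continuous z ∧ ∀ t, z t = z₀ + ∫ τ in (0 : ℝ)..t, R (z τ) (a τ) := by
  have hi : ∀ z : BoundedContinuousFunction ℝ E, Integrable (fun τ => R (z τ) (a τ)) := fun z =>
    integrable_clm_apply hL.continuous hK ha z.continuous
  -- The Picard operator on bounded continuous functions on the whole line. It contracts by 1/2
  -- because L ∫‖a‖ ≤ 1/2, so no subdivision of time is needed.
  let T : BoundedContinuousFunction ℝ E → BoundedContinuousFunction ℝ E := fun z =>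
    BoundedContinuousFunction.ofNormedAddCommGroup
      (fun t => z₀ + ∫ τ in (0 : ℝ)..t, R (z τ) (a τ))
      (continuous_const.add (intervalIntegral.continuous_primitive
        (fun _ _ => (hi z).intervalIntegrable) 0))
      (‖z₀‖ + ∫ τ, K * ‖a τ‖) (fun t => (norm_add_le _ _).trans (by
        gcongr
        exact norm_intervalIntegral_le_of_norm_le (ha.norm.const_mul K) (fun τ =>
          ((R (z τ)).le_opNorm _).trans (by gcongr; exact hK _)) 0 t))
  have hT : ContractingWith (1 / 2) T := by
    refine ⟨by norm_num, LipschitzWith.of_dist_le_mul fun z w => ?_⟩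
    rw [BoundedContinuousFunction.dist_le (by positivity)]
    intro t
    have h1 : dist (T z t) (T w t) = ‖∫ τ in (0 : ℝ)..t, (R (z τ) (a τ) - R (w τ) (a τ))‖ := by
      rw [intervalIntegral.integral_sub (hi z).intervalIntegrable (hi w).intervalIntegrable]
      show dist (z₀ + _) (z₀ + _) = _
      rw [dist_add_left, dist_eq_norm]
    rw [h1]
    refine (norm_intervalIntegral_le_of_norm_le (g := fun τ => L * dist z w * ‖a τ‖)
      (ha.norm.const_mul _) (fun τ => ?_) 0 t).trans ?_
    · rw [← sub_apply]
      refine ((R (z τ) - R (w τ)).le_opNorm _).trans ?_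
      gcongr
      rw [← dist_eq_norm]
      refine (hL.dist_le_mul _ _).trans ?_
      gcongr
      exact BoundedContinuousFunction.dist_coe_le_dist τ
    · rw [integral_const_mul]
      calc L * dist z w * ∫ τ, ‖a τ‖ = (L * ∫ τ, ‖a τ‖) * dist z w := by ring
        _ ≤ 1 / 2 * dist z w := by gcongr
        _ = _ := by norm_num
  let y : BoundedContinuousFunction ℝ E := ContractingWith.fixedPoint T hT
  refine ⟨y, y.continuous, fun t => ?_⟩
  have h : T y = y := ContractingWith.fixedPoint_isFixedPt hT
  exact (DFunLike.congr_fun h t).symm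

variable {a b z w : ℝ → E}

theorem norm_caratheodory_sub_le (hK : ∀ z, ‖R z‖ ≤ K) (ha : Integrable a)
    (h : ∀ t, z t = z₀ + ∫ τ in (0 : ℝ)..t, R (z τ) (a τ)) (t : ℝ) :
    ‖z t - z₀‖ ≤ K * ∫ τ, ‖a τ‖ := by
  rw [h t, add_sub_cancel_left, ← integral_const_mul]
  exact norm_intervalIntegral_le_of_norm_le (ha.norm.const_mul K) (fun τ =>
          ((R (z τ)).le_opNorm _).trans (by gcongr; exact hK _)) 0 t

/-- With D the supremum of ‖z - w‖, the integral equations give D ≤ D/2 + K ∫‖a - b‖, since L ∫‖a‖ ≤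
1/2. Absorbing D/2 replaces Grönwall's inequality. -/
theorem norm_caratheodory_sub_caratheodory_le (hL : LipschitzWith L R) (hK : ∀ z, ‖R z‖ ≤ K)
    (ha : Integrable a) (hb : Integrable b) (hsmall : L * ∫ τ, ‖a τ‖ ≤ 1 / 2)
    (hz : Continuous z) (hw : Continuous w)
    (h : ∀ t, z t = z₀ + ∫ τ in (0 : ℝ)..t, R (z τ) (a τ))
    (h' : ∀ t, w t = z₀ + ∫ τ in (0 : ℝ)..t, R (w τ) (b τ)) (t : ℝ) :
    ‖z t - w t‖ ≤ 2 * K * ∫ τ, ‖a τ - b τ‖ := by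
  have hz1 := norm_caratheodory_sub_le hK ha h
  have hw1 := norm_caratheodory_sub_le hK hb h'
  -- Finiteness of the supremum is what allows D/2 to be absorbed.
  have hbd : BddAbove (range fun t => ‖z t - w t‖) := by
    refine ⟨K * (∫ τ, ‖a τ‖) + K * ∫ τ, ‖b τ‖, ?_⟩
    rintro _ ⟨t, rfl⟩
    calc ‖z t - w t‖ = ‖(z t - z₀) - (w t - z₀)‖ := by congr 1; abel
      _ ≤ _ := (norm_sub_le _ _).trans (add_le_add (hz1 t) (hw1 t))
  set D := ⨆ t, ‖z t - w t‖ with hD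
  have hDt : ∀ t, ‖z t - w t‖ ≤ D := fun t => le_ciSup hbd t
  have hD0 : 0 ≤ D := (norm_nonneg _).trans (hDt 0)
  have hia := integrable_clm_apply hL.continuous hK ha hz
  have hib := integrable_clm_apply hL.continuous hK hb hw
  have hab : Integrable (fun τ => a τ - b τ) := ha.sub hb
  have key : ∀ t, ‖z t - w t‖ ≤ D / 2 + K * ∫ τ, ‖a τ - b τ‖ := by
    intro t
    have e : z t - w t = ∫ τ in (0 : ℝ)..t, (R (z τ) (a τ) - R (w τ) (b τ)) := by
      rw [intervalIntegral.integral_sub hia.intervalIntegrable hib.intervalIntegrable, h t, h' t]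
      abel
    rw [e]
    refine (norm_intervalIntegral_le_of_norm_le
      (g := fun τ => L * D * ‖a τ‖ + K * ‖a τ - b τ‖)
      ((ha.norm.const_mul _).add (hab.norm.const_mul K)) (fun τ => ?_) 0 t).trans ?_
    · have : R (z τ) (a τ) - R (w τ) (b τ) =
          (R (z τ) - R (w τ)) (a τ) + R (w τ) (a τ - b τ) := by simp
      rw [this]
      refine (norm_add_le _ _).trans (add_le_add ?_ ?_)
      · refine ((R (z τ) - R (w τ)).le_opNorm _).trans ?_
        gcongr
        rw [← dist_eq_norm]
        refine (hL.dist_le_mul _ _).trans ?_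
        gcongr
        rw [dist_eq_norm]; exact hDt τ
      · exact ((R (w τ)).le_opNorm _).trans (by gcongr; exact hK _)
    · rw [integral_add (ha.norm.const_mul _) (hab.norm.const_mul K), integral_const_mul,
        integral_const_mul]
      gcongr
      calc L * D * ∫ τ, ‖a τ‖ = (L * ∫ τ, ‖a τ‖) * D := by ring
        _ ≤ 1 / 2 * D := by gcongr
        _ = D / 2 := by ring
  have hD2 : D ≤ D / 2 + K * ∫ τ, ‖a τ - b τ‖ := ciSup_le key
  linarith [hDt t]

/-- The integrand splits as (R(z) - R(w))a + (R(w) - R(z₀))(a - b) because R(z₀) = id. Both terms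
are products of two small quantities: ‖z - w‖ is controlled by ∫‖a - b‖, and ‖w - z₀‖ by ∫‖b‖. This
is the source of the quadratic error. -/
theorem norm_caratheodory_sub_sub_integral_le (hL : LipschitzWith L R) (hK : ∀ z, ‖R z‖ ≤ K)
    (hR : R z₀ = ContinuousLinearMap.id ℝ E)
    (ha : Integrable a) (hb : Integrable b) (hsmall : L * ∫ τ, ‖a τ‖ ≤ 1 / 2)
    (hz : Continuous z) (hw : Continuous w)
    (h : ∀ t, z t = z₀ + ∫ τ in (0 : ℝ)..t, R (z τ) (a τ))
    (h' : ∀ t, w t = z₀ + ∫ τ in (0 : ℝ)..t, R (w τ) (b τ)) (t : ℝ) :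
    ‖z t - w t - ∫ τ in (0 : ℝ)..t, (a τ - b τ)‖ ≤
      2 * L * K * ((∫ τ, ‖a τ‖) + ∫ τ, ‖b τ‖) * ∫ τ, ‖a τ - b τ‖ := by
  have hia := integrable_clm_apply hL.continuous hK ha hz
  have hib := integrable_clm_apply hL.continuous hK hb hw
  have hab : Integrable (fun τ => a τ - b τ) := ha.sub hb
  have hK0 : 0 ≤ K := (norm_nonneg _).trans (hK z₀)
  have e : z t - w t - ∫ τ in (0 : ℝ)..t, (a τ - b τ) =
      ∫ τ in (0 : ℝ)..t, (R (z τ) (a τ) - R (w τ) (b τ) - (a τ - b τ)) := by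
    have hi : Integrable (fun τ => R (z τ) (a τ) - R (w τ) (b τ)) := hia.sub hib
    rw [intervalIntegral.integral_sub hi.intervalIntegrable hab.intervalIntegrable,
      intervalIntegral.integral_sub hia.intervalIntegrable hib.intervalIntegrable, h t, h' t]
    abel
  set A := ∫ τ, ‖a τ‖
  set B := ∫ τ, ‖b τ‖
  set D := ∫ τ, ‖a τ - b τ‖
  have hB : 0 ≤ B := integral_nonneg fun _ => norm_nonneg _
  have hD : 0 ≤ D := integral_nonneg fun _ => norm_nonneg _
  rw [e]
  refine (norm_intervalIntegral_le_of_norm_le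
    (g := fun τ => L * (2 * K * D) * ‖a τ‖ + L * (K * B) * ‖a τ - b τ‖)
    ((ha.norm.const_mul _).add (hab.norm.const_mul _)) (fun τ => ?_) 0 t).trans ?_
  · have : R (z τ) (a τ) - R (w τ) (b τ) - (a τ - b τ) =
        (R (z τ) - R (w τ)) (a τ) + (R (w τ) - R z₀) (a τ - b τ) := by
      rw [hR]; simp; abel
    rw [this]
    refine (norm_add_le _ _).trans (add_le_add ?_ ?_)
    · refine ((R (z τ) - R (w τ)).le_opNorm _).trans ?_
      gcongr
      rw [← dist_eq_norm]
      refine (hL.dist_le_mul _ _).trans ?_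
      gcongr
      rw [dist_eq_norm]
      exact norm_caratheodory_sub_caratheodory_le hL hK ha hb hsmall hz hw h h' τ
    · refine ((R (w τ) - R z₀).le_opNorm _).trans ?_
      gcongr
      rw [← dist_eq_norm]
      refine (hL.dist_le_mul _ _).trans ?_
      gcongr
      rw [dist_eq_norm]
      exact norm_caratheodory_sub_le hK hb h' τ
  · rw [integral_add (ha.norm.const_mul _) (hab.norm.const_mul _), integral_const_mul,
      integral_const_mul]
    have : 0 ≤ L * K * B * D := by positivity
    show L * (2 * K * D) * A + L * (K * B) * D ≤ _
    nlinarith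

end Caratheodory

/-! ### Second order expansion of the time-one value -/

section CaratheodoryExpansion

variable {E : Type*} [NormedAddCommGroup E] [NormedSpace ℝ E]

theorem integrable_indicator_Ioc_const (X : E) :
    Integrable ((Ioc (0 : ℝ) 1).indicator fun _ => X) :=
  (integrableOn_const (by simp) (by simp)).integrable_indicator measurableSet_Ioc

theorem integral_norm_indicator_Ioc_const (X : E) :
    ∫ τ, ‖(Ioc (0 : ℝ) 1).indicator (fun _ => X) τ‖ = ‖X‖ := by
  simp_rw [norm_indicator_eq_indicator_norm]
  rw [integral_indicator measurableSet_Ioc]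
  simp

theorem intervalIntegral_indicator_Ioc_const [CompleteSpace E] (X : E) :
    ∫ τ in (0 : ℝ)..1, (Ioc (0 : ℝ) 1).indicator (fun _ => X) τ = X := by
  rw [intervalIntegral.integral_of_le zero_le_one, setIntegral_indicator measurableSet_Ioc]
  simp

theorem indicator_Ioc_const_sub (X Y : E) (τ : ℝ) :
    (Ioc (0 : ℝ) 1).indicator (fun _ => X) τ - (Ioc (0 : ℝ) 1).indicator (fun _ => Y) τ =
      (Ioc (0 : ℝ) 1).indicator (fun _ => X - Y) τ := by
  by_cases h : τ ∈ Ioc (0 : ℝ) 1 <;> simp [h]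

/-- Cutting off a `C¹` family of endomorphisms to the identity away from a point. -/
theorem exists_lipschitz_cutoff [FiniteDimensional ℝ E] {R₀ : E → E →L[ℝ] E} {z₀ : E}
    (hR : ContDiffAt ℝ 1 R₀ z₀) :
    ∃ (R : E → E →L[ℝ] E) (L : NNReal) (K : ℝ), 1 ≤ K ∧ LipschitzWith L R ∧ (∀ z, ‖R z‖ ≤ K) ∧
      ∀ᶠ z in 𝓝 z₀, R z = R₀ z := by
  obtain ⟨r, hr, hball⟩ := Metric.eventually_nhds_iff_ball.1 (hR.eventually (by simp))
  -- The bump lives inside the ball where R₀ is C¹, so χ(R₀ - id) is C¹ with compact support, hence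
  -- globally Lipschitz and bounded.
  let χ : ContDiffBump z₀ := ⟨r / 4, r / 2, by positivity, by linarith⟩
  let R₁ : E → E →L[ℝ] E := fun z => χ z • (R₀ z - ContinuousLinearMap.id ℝ E)
  have hsupp : HasCompactSupport R₁ := χ.hasCompactSupport.smul_right
  have hsm : ContDiff ℝ 1 R₁ := by
    rw [contDiff_iff_contDiffAt]
    intro z
    by_cases hz : z ∈ Metric.ball z₀ r
    · exact χ.contDiffAt.smul ((hball z hz).sub contDiffAt_const)
    · have h0 : R₁ =ᶠ[𝓝 z] fun _ => 0 := by
        have : (Metric.closedBall z₀ (r / 2))ᶜ ∈ 𝓝 z := by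
          refine Metric.isClosed_closedBall.isOpen_compl.mem_nhds fun h => hz ?_
          exact Metric.closedBall_subset_ball (by linarith) h
        filter_upwards [this] with y hy
        have : χ y = 0 := χ.zero_of_le_dist (by
          simp only [mem_compl_iff, Metric.mem_closedBall, not_le] at hy; exact hy.le)
        simp [R₁, this]
      exact contDiffAt_const.congr_of_eventuallyEq h0
  obtain ⟨L, hL⟩ := hsm.lipschitzWith_of_hasCompactSupport hsupp (by simp)
  obtain ⟨K, hK⟩ := hsupp.exists_bound_of_continuous hsm.continuous
  refine ⟨fun z => ContinuousLinearMap.id ℝ E + R₁ z, L, 1 + max K 0, by simp, ?_, fun z => ?_, ?_⟩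
  · simpa using (LipschitzWith.const (ContinuousLinearMap.id ℝ E)).add hL
  · exact (norm_add_le _ _).trans (add_le_add ContinuousLinearMap.norm_id_le
      ((hK z).trans (le_max_left _ _)))
  · filter_upwards [χ.eventuallyEq_one] with z hz
    have : χ z = 1 := hz
    simp [R₁, this]

/-- The solution of a Carathéodory equation `z' = R(z) a(t)` with `R(z₀) = id` agrees at time `1`
with the solution of `w' = R(w) X` for a vector `X` that equals `∫ a` up to second order. -/
theorem exists_caratheodory_expansion [FiniteDimensional ℝ E] {R₀ : E → E →L[ℝ] E} {z₀ : E}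
    (hR : ContDiffAt ℝ 1 R₀ z₀) (h₀ : R₀ z₀ = ContinuousLinearMap.id ℝ E) {U : Set E}
    (hU : U ∈ 𝓝 z₀) :
    ∃ ε > 0, ∃ C > 0, ∀ a : ℝ → E, Integrable a → ∫ τ, ‖a τ‖ ≤ ε →
      ∃ z : ℝ → E, Continuous z ∧ (∀ t, z t ∈ U) ∧ Integrable (fun τ => R₀ (z τ) (a τ)) ∧
        (∀ t, z t = z₀ + ∫ τ in (0 : ℝ)..t, R₀ (z τ) (a τ)) ∧
        ∃ (X : E) (w : ℝ → E), Continuous w ∧ (∀ t, w t ∈ U) ∧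
          Integrable (fun τ => R₀ (w τ) ((Ioc (0 : ℝ) 1).indicator (fun _ => X) τ)) ∧
          (∀ t, w t = z₀ + ∫ τ in (0 : ℝ)..t, R₀ (w τ) ((Ioc (0 : ℝ) 1).indicator (fun _ => X) τ)) ∧
          w 1 = z 1 ∧ ‖X - ∫ τ in (0 : ℝ)..1, a τ‖ ≤ C * (∫ τ, ‖a τ‖) ^ 2 := by
  have : CompleteSpace E := FiniteDimensional.complete ℝ E
  obtain ⟨R, L, K, hK1, hL, hK, hRR⟩ := exists_lipschitz_cutoff hR
  obtain ⟨ρ, hρ, hball⟩ := Metric.nhds_basis_closedBall.mem_iff.1 (inter_mem hRR hU)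
  have hRz : R z₀ = ContinuousLinearMap.id ℝ E := by
    rw [← h₀]; exact (hball (Metric.mem_closedBall_self hρ.le)).1
  have hK0 : 0 < K := by linarith
  -- The first bound keeps solutions in the ball where the cut-off family agrees with R₀. The second
  -- gives L K e₁ ≤ 1/8, enough for the contraction and for the Lipschitz constant 1/2 in `happ`.
  set e₁ : ℝ := min (ρ / K) (1 / (8 * (L + 1) * K)) with he₁
  have he₁0 : 0 < e₁ := by positivity
  have hLe : L * K * e₁ ≤ 1 / 8 := by
    calc L * K * e₁ ≤ (L + 1) * K * (1 / (8 * (L + 1) * K)) := by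
          gcongr
          · linarith
          · exact min_le_right _ _
      _ = 1 / 8 := by field_simp
  have hLe' : L * e₁ ≤ 1 / 2 := by
    have : L * 1 * e₁ ≤ L * K * e₁ := by gcongr
    linarith
  have hsol : ∀ a : ℝ → E, Integrable a → ∫ τ, ‖a τ‖ ≤ e₁ → ∃ z : ℝ → E, Continuous z ∧
      (∀ t, z t ∈ U) ∧ (∀ t, z t = z₀ + ∫ τ in (0 : ℝ)..t, R (z τ) (a τ)) ∧
      (fun τ => R (z τ) (a τ)) = (fun τ => R₀ (z τ) (a τ)) := by
    intro a ha hae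
    obtain ⟨z, hz, hz'⟩ := exists_caratheodory_solution hL hK ha
      ((mul_le_mul_of_nonneg_left hae L.2).trans hLe') z₀
    have hzb : ∀ t, z t ∈ Metric.closedBall z₀ ρ := by
      intro t
      rw [Metric.mem_closedBall, dist_eq_norm]
      refine (norm_caratheodory_sub_le hK ha hz' t).trans ?_
      calc K * ∫ τ, ‖a τ‖ ≤ K * (ρ / K) := by
            gcongr
            exact hae.trans (min_le_left _ _)
        _ = ρ := by field_simp
    exact ⟨z, hz, fun t => (hball (hzb t)).2, hz', funext fun τ => by
      rw [show R (z τ) = R₀ (z τ) from (hball (hzb τ)).1]⟩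
  -- The constant coefficient X, extended by 0 so as to be integrable on the line; its L¹ norm is
  -- ‖X‖.
  let b : E → ℝ → E := fun X => (Ioc (0 : ℝ) 1).indicator fun _ => X
  have hb : ∀ X, Integrable (b X) := integrable_indicator_Ioc_const
  have hbn : ∀ X, ∫ τ, ‖b X τ‖ = ‖X‖ := integral_norm_indicator_Ioc_const
  have hex : ∀ X : E, ∃ w : ℝ → E, ‖X‖ ≤ e₁ → (Continuous w ∧
      (∀ t, w t ∈ U) ∧ (∀ t, w t = z₀ + ∫ τ in (0 : ℝ)..t, R (w τ) (b X τ)) ∧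
      (fun τ => R (w τ) (b X τ)) = (fun τ => R₀ (w τ) (b X τ))) := by
    intro X
    by_cases hX : ‖X‖ ≤ e₁
    · obtain ⟨w, hw⟩ := hsol (b X) (hb X) (by rwa [hbn])
      exact ⟨w, fun _ => hw⟩
    · exact ⟨0, fun h => absurd h hX⟩
  choose w hw using hex
  have hbsub : ∀ X Y : E, ∫ τ, ‖b X τ - b Y τ‖ = ‖X - Y‖ := by
    intro X Y
    simp_rw [b, indicator_Ioc_const_sub]
    exact hbn _
  have hbsub' : ∀ X Y : E, ∫ τ in (0 : ℝ)..1, (b X τ - b Y τ) = X - Y := by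
    intro X Y
    simp_rw [b, indicator_Ioc_const_sub]
    exact intervalIntegral_indicator_Ioc_const _
  -- The time-one map X ↦ w_X(1) differs from the identity by a map of Lipschitz constant 1/2. It
  -- therefore covers a ball of half the radius around its value z₀ at 0.
  have happ : ApproximatesLinearOn (fun X => w X 1) (ContinuousLinearMap.id ℝ E)
      (Metric.closedBall 0 e₁) (1 / 2) := by
    intro X hX Y hY
    rw [mem_closedBall_zero_iff] at hX hY
    have h1 := norm_caratheodory_sub_sub_integral_le hL hK hRz (hb X) (hb Y)
      (by rw [hbn]; exact (mul_le_mul_of_nonneg_left hX L.2).trans hLe') (hw X hX).1 (hw Y hY).1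
      (hw X hX).2.2.1 (hw Y hY).2.2.1 1
    rw [hbsub, hbsub', hbn, hbn] at h1
    refine h1.trans ?_
    push_cast
    gcongr
    calc 2 * L * K * (‖X‖ + ‖Y‖) ≤ 2 * L * K * (e₁ + e₁) := by gcongr
      _ = 4 * (L * K * e₁) := by ring
      _ ≤ 1 / 2 := by linarith
  have h0z : w 0 1 = z₀ := by
    rw [(hw 0 (by simpa using he₁0.le)).2.2.1 1]
    simp [b]
  let inv : (ContinuousLinearMap.id ℝ E).NonlinearRightInverse :=
    ⟨fun x => x, 1, fun x => by simp, fun x => by simp⟩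
  -- The point z(1) lies within K A of z₀, so X is found in the ball of radius 2 K A, which must not
  -- exceed e₁. The constant comes from 2 L K · (3 K A)², as A + ‖X‖ ≤ 3 K A.
  refine ⟨e₁ / (2 * K), by positivity, 18 * (L + 1) * K ^ 3, by positivity, fun a ha hae => ?_⟩
  set A := ∫ τ, ‖a τ‖ with hA
  have hA0 : 0 ≤ A := integral_nonneg fun _ => norm_nonneg _
  have hKA : 2 * K * A ≤ e₁ := by
    calc 2 * K * A ≤ 2 * K * (e₁ / (2 * K)) := by gcongr
      _ = e₁ := by field_simp
  have hAe : A ≤ e₁ := by nlinarith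
  obtain ⟨z, hz, hzU, hz', hzR⟩ := hsol a ha hAe
  have hz1 : ‖z 1 - z₀‖ ≤ K * A := norm_caratheodory_sub_le hK ha hz' 1
  obtain ⟨X, hX, hXz⟩ := happ.surjOn_closedBall_of_nonlinearRightInverse inv
    (ε := 2 * K * A) (b := 0) (by positivity) (Metric.closedBall_subset_closedBall hKA)
    (a := z 1) (by
      rw [Metric.mem_closedBall, dist_eq_norm]
      show ‖z 1 - w 0 1‖ ≤ (((1 : NNReal) : ℝ)⁻¹ - ((1 / 2 : NNReal) : ℝ)) * (2 * K * A)
      rw [h0z]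
      push_cast
      linarith)
  rw [mem_closedBall_zero_iff] at hX
  have hXe := hX.trans hKA
  obtain ⟨hwc, hwU, hw', hwR⟩ := hw X hXe
  have hi1 := integrable_clm_apply hL.continuous hK ha hz
  have hi2 := integrable_clm_apply hL.continuous hK (hb X) hwc
  refine ⟨z, hz, hzU, by rwa [hzR] at hi1, by rwa [hzR] at hz', X, w X, hwc, hwU,
    by rwa [hwR] at hi2, by rwa [hwR] at hw', hXz, ?_⟩
  -- Since w(1) = z(1), the second order comparison leaves exactly ‖X - ∫a‖ on the left.
  have h1 := norm_caratheodory_sub_sub_integral_le hL hK hRz ha (hb X)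
    ((mul_le_mul_of_nonneg_left hAe L.2).trans hLe') hz hwc hz' hw' 1
  rw [show w X 1 = z 1 from hXz, sub_self, zero_sub, norm_neg, hbn,
    intervalIntegral.integral_sub ha.intervalIntegrable (hb X).intervalIntegrable,
    intervalIntegral_indicator_Ioc_const, norm_sub_rev] at h1
  have h2 : ∫ τ, ‖a τ - b X τ‖ ≤ A + ‖X‖ := by
    rw [← hbn X, hA, ← integral_add ha.norm (hb X).norm]
    exact integral_mono (ha.sub (hb X)).norm (ha.norm.add (hb X).norm) fun τ => norm_sub_le _ _
  refine h1.trans ?_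
  have h3 : A + ‖X‖ ≤ 3 * K * A := by nlinarith
  have h4 : 0 ≤ ∫ τ, ‖a τ - b X τ‖ := integral_nonneg fun _ => norm_nonneg _
  calc 2 * L * K * (A + ‖X‖) * ∫ τ, ‖a τ - b X τ‖
      ≤ 2 * L * K * (3 * K * A) * (3 * K * A) := by
        have := h2.trans h3
        gcongr
    _ = 18 * L * K ^ 3 * A ^ 2 := by ring
    _ ≤ _ := by
      gcongr; linarith

end CaratheodoryExpansion

/-! ### Lie groups -/

section LieGroupCalculus

variable {E : Type*} [NormedAddCommGroup E] [NormedSpace ℝ E]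
  {G : Type*} [TopologicalSpace G] [ChartedSpace E G] [Group G] [LieGroup 𝓘(ℝ, E) ∞ G]

theorem hasMD_mul_left (g b : G) : HasMD E E (fun y : G => g * y) b (md E E (fun y : G => g * y) b) :=
  ContMDiffAt.hasMD (contMDiff_mul_left (I := 𝓘(ℝ, E)) (n := ∞)).contMDiffAt

theorem hasMD_mul_right (g b : G) : HasMD E E (fun y : G => y * g) b (md E E (fun y : G => y * g) b) :=
  ContMDiffAt.hasMD (contMDiff_mul_right (I := 𝓘(ℝ, E)) (n := ∞)).contMDiffAt

variable (E) in
/-- The derivative at `1` of the left translation by `g`. -/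
def leftTrans (g : G) : E →L[ℝ] E := md E E (fun b : G => g * b) 1

variable (E) in
/-- The derivative at `1` of the right translation by `g`. -/
def rightTrans (g : G) : E →L[ℝ] E := md E E (fun b : G => b * g) 1

theorem md_mul_left_leftTrans (g h : G) (A : E) :
    md E E (fun y : G => g * y) h (leftTrans E h A) = leftTrans E (g * h) A := by
  have h1 := (hasMD_mul_left (E := E) g h).comp_of_eq (hasMD_mul_left h 1) (mul_one h)
  rw [leftTrans, leftTrans]
  simp only [← mul_assoc] at h1
  rw [h1.md_eq]; rfl

theorem md_mul_right_rightTrans (g h : G) (A : E) :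
    md E E (fun y : G => y * g) h (rightTrans E h A) = rightTrans E (h * g) A := by
  have h1 := (hasMD_mul_right (E := E) g h).comp_of_eq (hasMD_mul_right h 1) (one_mul h)
  rw [rightTrans, rightTrans]
  simp only [mul_assoc] at h1
  rw [h1.md_eq]; rfl

theorem md_mul_left_inv_md_mul_left (g h : G) (A : E) :
    md E E (fun y : G => g⁻¹ * y) (g * h) (md E E (fun y : G => g * y) h A) = A := by
  have h1 := (hasMD_mul_left (E := E) g⁻¹ (g * h)).comp_of_eq (hasMD_mul_left g h) rfl
  simp only [inv_mul_cancel_left] at h1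
  simpa using DFunLike.congr_fun (h1.unique hasMD_id) A

theorem md_mul_left_injective (g h : G) {A : E} (hA : md E E (fun y : G => g * y) h A = 0) :
    A = 0 := by
  rw [← md_mul_left_inv_md_mul_left g h A, hA, map_zero]

theorem contMDiffAt_mul_pair (q : G × G) : ContMDiffAt (𝓘(ℝ, E).prod 𝓘(ℝ, E)) 𝓘(ℝ, E) ∞
    (fun q : G × G => q.1 * q.2) q :=
  (contMDiff_mul 𝓘(ℝ, E) ∞).contMDiffAt

theorem vel_mul {g h : ℝ → G} {t : ℝ} (hg : MDifferentiableAt 𝓘(ℝ, ℝ) 𝓘(ℝ, E) g t)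
    (hh : MDifferentiableAt 𝓘(ℝ, ℝ) 𝓘(ℝ, E) h t) :
    vel E (fun s => g s * h s) t =
      md E E (fun y => y * h t) (g t) (vel E g t) + md E E (fun y => g t * y) (h t) (vel E h t) :=
  (HasMD.comp₂ (H := fun q : G × G => q.1 * q.2)
    ((contMDiffAt_mul_pair (E := E) (g t, h t)).mdifferentiableAt (by simp)) hg.hasMD hh.hasMD).vel_eq

/-- Uniqueness for the equation `g' = dR_g (a(t))` on a Lie group. -/
theorem eqOn_of_ae_vel_eq_rightTrans [FiniteDimensional ℝ E] {g h : ℝ → G} {a : ℝ → E}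
    (hg : IsAbsContCurve E g) (hh : IsAbsContCurve E h) (h0 : g 0 = h 0)
    (hga : ∀ᵐ t ∂(volume.restrict (Icc (0 : ℝ) 1)), vel E g t = rightTrans E (g t) (a t))
    (hha : ∀ᵐ t ∂(volume.restrict (Icc (0 : ℝ) 1)), vel E h t = rightTrans E (h t) (a t)) :
    EqOn g h (Icc 0 1) := by
  have hk : IsAbsContCurve E (fun t => (g t)⁻¹ * h t) :=
    hg.comp₂ hh (H := fun q : G × G => q.1⁻¹ * q.2) fun t _ =>
      (contMDiffAt_fst.inv).mul contMDiffAt_snd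
  have hk0 : ∀ᵐ t ∂(volume.restrict (Icc (0 : ℝ) 1)), vel E (fun t => (g t)⁻¹ * h t) t = 0 := by
    filter_upwards [hg.ae_mdifferentiableAt, hk.ae_mdifferentiableAt, hga, hha] with t h1 h2 h3 h4
    -- The Leibniz rule for h = g · (g⁻¹h): since g and h satisfy the same equation, the term from g
    -- already equals h', so g⁻¹h has velocity 0.
    have h5 := vel_mul h1 h2
    simp only [mul_inv_cancel_left] at h5
    have h6 : (fun s => h s) = h := rfl
    rw [h6, h4, h3, md_mul_right_rightTrans, mul_inv_cancel_left] at h5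
    exact md_mul_left_injective _ _ (by simpa using h5)
  intro t ht
  have := hk.eq_of_ae_vel_eq_zero hk0 ht (left_mem_Icc.2 zero_le_one)
  simp only [h0, inv_mul_cancel] at this
  exact (inv_mul_eq_one.1 this)

/-! #### Right translations in the chart at the identity -/

variable (E G) in
/-- The derivatives of the right translations in the chart `φ` at the identity: for `g` with
coordinate `z`, the derivative at `1` of `b ↦ φ(b g)`. -/
def rightTransChart (z : E) : E →L[ℝ] E :=
  fderiv ℝ (fun ζ => extChartAt 𝓘(ℝ, E) (1 : G) ((extChartAt 𝓘(ℝ, E) (1 : G)).symm ζ *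
    (extChartAt 𝓘(ℝ, E) (1 : G)).symm z)) (extChartAt 𝓘(ℝ, E) (1 : G) 1)

theorem contDiffAt_rightTransChart {z : E} (hz : z ∈ (extChartAt 𝓘(ℝ, E) (1 : G)).target) :
    ContDiffAt ℝ ∞ (rightTransChart E G) z := by
  set φ := extChartAt 𝓘(ℝ, E) (1 : G) with hφ
  have h1 : φ 1 ∈ φ.target := mem_extChartAt_target _
  have e1 : φ.symm (φ 1) = 1 := extChartAt_to_inv _
  refine ContDiffAt.fderiv (n := ∞) (f := fun z ζ => φ (φ.symm ζ * φ.symm z)) (g := fun _ => φ 1) ?_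
    contDiffAt_const (by simp)
  have ha : ContMDiffAt 𝓘(ℝ, E × E) 𝓘(ℝ, E) ∞ (fun q : E × E => φ.symm q.2) (z, φ 1) :=
    ContMDiffAt.comp (z, φ 1) (f := fun q : E × E => q.2) (contMDiffAt_extChartAt_symm h1)
      contDiff_snd.contMDiff.contMDiffAt
  have hb : ContMDiffAt 𝓘(ℝ, E × E) 𝓘(ℝ, E) ∞ (fun q : E × E => φ.symm q.1) (z, φ 1) :=
    ContMDiffAt.comp (z, φ 1) (f := fun q : E × E => q.1) (contMDiffAt_extChartAt_symm hz)
      contDiff_fst.contMDiff.contMDiffAt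
  have hc : ContMDiffAt 𝓘(ℝ, E × E) 𝓘(ℝ, E) ∞ (fun q : E × E => φ (φ.symm q.2 * φ.symm q.1))
      (z, φ 1) := by
    refine ContMDiffAt.comp (z, φ 1) (g := φ) (f := fun q : E × E => φ.symm q.2 * φ.symm q.1) ?_
      (ha.mul hb)
    refine contMDiffAt_extChartAt_of_mem ?_
    simp only [e1, one_mul]
    exact φ.map_target hz
  exact contMDiffAt_iff_contDiffAt.1 hc

theorem rightTransChart_eq {z : E} (hz : z ∈ (extChartAt 𝓘(ℝ, E) (1 : G)).target) :
    rightTransChart E G z = (md E E (extChartAt 𝓘(ℝ, E) (1 : G))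
      ((extChartAt 𝓘(ℝ, E) (1 : G)).symm z)).comp
        (rightTrans E ((extChartAt 𝓘(ℝ, E) (1 : G)).symm z)) := by
  set φ := extChartAt 𝓘(ℝ, E) (1 : G) with hφ
  have h1 : φ 1 ∈ φ.target := mem_extChartAt_target _
  have e1 : φ.symm (φ 1) = 1 := extChartAt_to_inv _
  have hid : md E E φ.symm (φ 1) = ContinuousLinearMap.id ℝ E := by
    ext v
    have := md_extChartAt_symm_comp (E := E) (mem_extChartAt_source (I := 𝓘(ℝ, E)) (1 : G)) v
    rwa [md_extChartAt_self] at this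
  have ha := (hasMD_mul_right (E := E) (φ.symm z) (1 : G)).comp_of_eq
    (contMDiffAt_extChartAt_symm h1).hasMD e1
  have hb := (contMDiffAt_extChartAt_of_mem (E := E) (φ.map_target hz)).hasMD.comp_of_eq ha
    (by simp only [← hφ, e1, one_mul])
  rw [rightTransChart, ← md_eq_fderiv, hb.md_eq, hid]
  rfl

theorem rightTransChart_apply_one :
    rightTransChart E G (extChartAt 𝓘(ℝ, E) (1 : G) 1) = ContinuousLinearMap.id ℝ E := by
  rw [rightTransChart_eq (mem_extChartAt_target _), extChartAt_to_inv, md_extChartAt_self, rightTrans]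
  simp only [mul_one]
  rw [hasMD_id.md_eq]
  rfl

/-- Carries solutions of the equation in the chart at the identity to solutions of g' = dR_g(A) on
the group. -/
theorem vel_extChartAt_symm_comp {z : ℝ → E} {t : ℝ} {A : E}
    (hz : z t ∈ (extChartAt 𝓘(ℝ, E) (1 : G)).target)
    (h : HasDerivAt z (rightTransChart E G (z t) A) t) :
    vel E (fun s => (extChartAt 𝓘(ℝ, E) (1 : G)).symm (z s)) t =
      rightTrans E ((extChartAt 𝓘(ℝ, E) (1 : G)).symm (z t)) A := by
  have h1 := (contMDiffAt_extChartAt_symm hz).hasMD.comp (hasMD_iff_hasFDerivAt.2 h.hasFDerivAt)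
  rw [h1.vel_eq, rightTransChart_eq hz]
  have h2 := md_extChartAt_symm_comp (E := E)
    ((extChartAt 𝓘(ℝ, E) (1 : G)).map_target hz)
    (rightTrans E ((extChartAt 𝓘(ℝ, E) (1 : G)).symm (z t)) A)
  rw [(extChartAt 𝓘(ℝ, E) (1 : G)).right_inv hz] at h2
  simpa using h2

end LieGroupCalculus

/-! ### One-parameter subgroups and the exponential map -/

section OneParameter

/-- Bootstrap: if f is Cⁿ, so is f' = V(f), hence f is Cⁿ⁺¹. -/
theorem contDiffOn_of_hasDerivAt_autonomous {E : Type*} [NormedAddCommGroup E] [NormedSpace ℝ E]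
    {f : ℝ → E} {V : E → E} {O : Set ℝ} {U : Set E} (hO : IsOpen O) (hV : ContDiffOn ℝ ∞ V U)
    (hf : ∀ t ∈ O, f t ∈ U ∧ HasDerivAt f (V (f t)) t) : ContDiffOn ℝ ∞ f O := by
  rw [contDiffOn_infty]
  intro n
  induction n with
  | zero =>
    exact contDiffOn_zero.2 fun t ht => (hf t ht).2.continuousAt.continuousWithinAt
  | succ n ih =>
    push_cast
    rw [contDiffOn_succ_iff_deriv_of_isOpen hO]
    refine ⟨fun t ht => (hf t ht).2.differentiableAt.differentiableWithinAt, by simp, ?_⟩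
    have h1 : ContDiffOn ℝ n (fun t => V (f t)) O :=
      (hV.of_le (by exact_mod_cast le_top)).comp ih fun t ht => (hf t ht).1
    exact h1.congr fun t ht => (hf t ht).2.deriv

variable {E : Type*} [NormedAddCommGroup E] [NormedSpace ℝ E]
  {G : Type*} [TopologicalSpace G] [ChartedSpace E G] [Group G] [LieGroup 𝓘(ℝ, E) ∞ G]

theorem IsOneParameterSubgroup.map_zero {A : E} {c : ℝ → G} (hc : IsOneParameterSubgroup E A c) :
    c 0 = 1 := by
  have := hc.2.1 0 0
  simpa using this

theorem hasMD_smulRight_of_vel {c : ℝ → G} {t : ℝ} {B : ℝ →L[ℝ] E} (h : HasMD ℝ E c t B) {v : E}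
    (hv : B 1 = v) : HasMD ℝ E c t ((1 : ℝ →L[ℝ] ℝ).smulRight v) := by
  convert h using 1
  ext; simp [hv]

theorem IsOneParameterSubgroup.hasMD {A : E} {c : ℝ → G} (hc : IsOneParameterSubgroup E A c)
    (t : ℝ) : HasMD ℝ E c t (md ℝ E c t) :=
  ContMDiffAt.hasMD hc.1.contMDiffAt

theorem IsOneParameterSubgroup.vel_zero {A : E} {c : ℝ → G} (hc : IsOneParameterSubgroup E A c) :
    md ℝ E c 0 1 = A := hc.2.2

theorem hasMD_sub_const (t s : ℝ) :
    HasMD ℝ ℝ (fun r : ℝ => r - t) s (ContinuousLinearMap.id ℝ ℝ) :=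
  hasMD_iff_hasFDerivAt.2 ((hasFDerivAt_id s).sub_const t)

/-- Differentiate c(r) = c(t) c(r - t) at r = t. Writing c(r) = c(r - t) c(t) instead gives the
right-translated version below. -/
theorem IsOneParameterSubgroup.hasMD_left {A : E} {c : ℝ → G} (hc : IsOneParameterSubgroup E A c)
    (t : ℝ) : HasMD ℝ E c t ((1 : ℝ →L[ℝ] ℝ).smulRight (leftTrans E (c t) A)) := by
  have h1 := ((hasMD_mul_left (E := E) (c t) 1).comp_of_eq (hc.hasMD 0) hc.map_zero).comp_of_eq
    (hasMD_sub_const t t) (sub_self t)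
  refine hasMD_smulRight_of_vel (h1.congr (Eventually.of_forall fun r => ?_)) ?_
  · show c r = c t * c (r - t)
    rw [← hc.2.1]; congr 1; ring
  · simp [hc.vel_zero, leftTrans]

theorem IsOneParameterSubgroup.vel_eq_rightTrans {A : E} {c : ℝ → G}
    (hc : IsOneParameterSubgroup E A c) (t : ℝ) : vel E c t = rightTrans E (c t) A := by
  have h1 := ((hasMD_mul_right (E := E) (c t) 1).comp_of_eq (hc.hasMD 0) hc.map_zero).comp_of_eq
    (hasMD_sub_const t t) (sub_self t)
  have h2 := h1.congr (f₁ := c) (Eventually.of_forall fun r => by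
    show c r = c (r - t) * c t
    rw [← hc.2.1]; congr 1; ring)
  rw [h2.vel_eq]
  simp [hc.vel_zero, rightTrans]

theorem contMDiff_mulInvariantVectorField_one (A : E) :
    ContMDiff 𝓘(ℝ, E) 𝓘(ℝ, E).tangent 1
      (fun g : G => (⟨g, mulInvariantVectorField (I := 𝓘(ℝ, E)) (G := G) A g⟩ :
        TangentBundle 𝓘(ℝ, E) G)) := by
  have : LieGroup 𝓘(ℝ, E) (minSmoothness ℝ 3) G := by
    rw [minSmoothness_of_isRCLikeNormedField]
    exact LieGroup.of_le (n := ∞) ENat.LEInfty.out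
  have h := contMDiff_mulInvariantVectorField (I := 𝓘(ℝ, E)) (G := G) A
  exact h.of_le (by rw [minSmoothness_of_isRCLikeNormedField]; norm_num)

theorem isMIntegralCurve_mulInvariantVectorField_iff {A : E} {c : ℝ → G} :
    IsMIntegralCurve (I := 𝓘(ℝ, E)) c (mulInvariantVectorField (I := 𝓘(ℝ, E)) (G := G) A) ↔
      ∀ t, HasMD ℝ E c t ((1 : ℝ →L[ℝ] ℝ).smulRight (leftTrans E (c t) A)) := Iff.rfl

/-- One-parameter subgroups are determined by their generator. -/
theorem IsOneParameterSubgroup.unique [CompleteSpace E] [T2Space G] {A : E} {c c' : ℝ → G}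
    (hc : IsOneParameterSubgroup E A c) (hc' : IsOneParameterSubgroup E A c') : c = c' := by
  have : IsManifold 𝓘(ℝ, E) 1 G := .of_le (n := ∞) (by simp)
  exact isMIntegralCurve_Ioo_eq_of_contMDiff_boundaryless (t₀ := 0)
    (contMDiff_mulInvariantVectorField_one A)
    (isMIntegralCurve_mulInvariantVectorField_iff.2 hc.hasMD_left)
    (isMIntegralCurve_mulInvariantVectorField_iff.2 hc'.hasMD_left)
    (hc.map_zero.trans hc'.map_zero.symm)

theorem HasMD.mul_left_smulRight {A : E} {c : ℝ → G} {t : ℝ} (g : G)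
    (h : HasMD ℝ E c t ((1 : ℝ →L[ℝ] ℝ).smulRight (leftTrans E (c t) A))) :
    HasMD ℝ E (fun s => g * c s) t ((1 : ℝ →L[ℝ] ℝ).smulRight (leftTrans E (g * c t) A)) := by
  refine hasMD_smulRight_of_vel ((hasMD_mul_left (E := E) g (c t)).comp h) ?_
  simp [md_mul_left_leftTrans]

/-- Left translates of the local integral curve through 1 are integral curves through every point
with the same time of existence, so the flow is complete. -/
theorem exists_integralCurve_leftTrans [CompleteSpace E] [T2Space G] (A : E) :
    ∃ c : ℝ → G, c 0 = 1 ∧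
      ∀ t, HasMD ℝ E c t ((1 : ℝ →L[ℝ] ℝ).smulRight (leftTrans E (c t) A)) := by
  have : IsManifold 𝓘(ℝ, E) 1 G := .of_le (n := ∞) (by simp)
  have hv := contMDiff_mulInvariantVectorField_one (G := G) A
  obtain ⟨c, hc0, hc⟩ := exists_isMIntegralCurveAt_of_contMDiffAt_boundaryless (t₀ := 0)
    (hv.contMDiffAt (x := 1))
  obtain ⟨ε, hε, hc⟩ := isMIntegralCurveAt_iff'.1 hc
  obtain ⟨c', hc'0, hc'⟩ := exists_isMIntegralCurve_of_isMIntegralCurveOn hv hε (fun g => by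
    refine ⟨fun t => g * c t, by simp [hc0], fun t ht => ?_⟩
    have hb : Ioo (-ε) ε = Metric.ball (0 : ℝ) ε := by simp [Real.ball_eq_Ioo]
    rw [hb] at ht
    have h1 : HasMD ℝ E c t ((1 : ℝ →L[ℝ] ℝ).smulRight (leftTrans E (c t) A)) :=
      (hc t ht).hasMFDerivAt (Metric.isOpen_ball.mem_nhds ht)
    exact HasMFDerivAt.hasMFDerivWithinAt (h1.mul_left_smulRight g)) 1
  exact ⟨c', hc'0, hc'⟩

/-- As functions of t, both sides are integral curves of the same left-invariant field with the same
value at 0. -/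
theorem hom_of_integralCurve_leftTrans [CompleteSpace E] [T2Space G] {A : E} {c : ℝ → G}
    (h0 : c 0 = 1) (hc : ∀ t, HasMD ℝ E c t ((1 : ℝ →L[ℝ] ℝ).smulRight (leftTrans E (c t) A)))
    (s t : ℝ) : c (s + t) = c s * c t := by
  have : IsManifold 𝓘(ℝ, E) 1 G := .of_le (n := ∞) (by simp)
  have h1 := isMIntegralCurve_Ioo_eq_of_contMDiff_boundaryless (t₀ := 0)
    (contMDiff_mulInvariantVectorField_one A) (γ := c ∘ (· + s)) (γ' := fun t => c s * c t)
    ((isMIntegralCurve_mulInvariantVectorField_iff.2 hc).comp_add s)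
    (isMIntegralCurve_mulInvariantVectorField_iff.2 fun t => (hc t).mul_left_smulRight (c s))
    (by simp [h0])
  have := congrFun h1 t
  rwa [Function.comp, add_comm] at this

/-- Every element of the Lie algebra generates a one-parameter subgroup. -/
theorem exists_isOneParameterSubgroup [CompleteSpace E] [T2Space G] (A : E) :
    ∃ c : ℝ → G, IsOneParameterSubgroup E A c := by
  obtain ⟨c, h0, hc⟩ := exists_integralCurve_leftTrans (G := G) A
  have hom := hom_of_integralCurve_leftTrans h0 hc
  have hA : vel E c 0 = A := by
    rw [(hc 0).vel_eq, h0]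
    simp only [leftTrans, one_mul]
    rw [hasMD_id.md_eq]
    simp
  have hcr : ∀ t, HasMD ℝ E c t ((1 : ℝ →L[ℝ] ℝ).smulRight (rightTrans E (c t) A)) := by
    intro t
    have h1 := ((hasMD_mul_right (E := E) (c t) 1).comp_of_eq
      (hc 0).mdifferentiableAt.hasMD h0).comp_of_eq (hasMD_sub_const t t) (sub_self t)
    refine hasMD_smulRight_of_vel (h1.congr (Eventually.of_forall fun r => ?_)) ?_
    · show c r = c (r - t) * c t
      rw [← hom]; congr 1; ring
    · rw [vel] at hA
      simp [hA, rightTrans]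
  refine ⟨c, ?_, hom, hA⟩
  set φ := extChartAt 𝓘(ℝ, E) (1 : G) with hφ
  have hcont : Continuous c := continuous_iff_continuousAt.2 fun t => (hc t).continuousAt
  have hO : IsOpen (c ⁻¹' φ.source) := (isOpen_extChartAt_source _).preimage hcont
  -- In the chart c solves an autonomous equation with smooth right-hand side, so the bootstrap
  -- applies near time 0.
  have hsm : ContDiffOn ℝ ∞ (fun t => φ (c t)) (c ⁻¹' φ.source) := by
    refine contDiffOn_of_hasDerivAt_autonomous (U := φ.target)
      (V := fun z => rightTransChart E G z A) hO ?_ fun t ht => ⟨φ.map_source ht, ?_⟩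
    · intro z hz
      exact ((contDiffAt_rightTransChart hz).clm_apply contDiffAt_const).contDiffWithinAt
    · have h1 := (contMDiffAt_extChartAt_of_mem (E := E) ht).hasMD.comp (hcr t)
      have h2 := (hasMD_iff_hasFDerivAt.1 h1).hasDerivAt
      rw [rightTransChart_eq (φ.map_source ht), φ.left_inv ht]
      convert h2 using 1
      simp
  have h00 : (0 : ℝ) ∈ c ⁻¹' φ.source := by
    rw [mem_preimage, h0]; exact mem_extChartAt_source _
  have hsm0 : ContMDiffAt 𝓘(ℝ, ℝ) 𝓘(ℝ, E) ∞ c 0 := by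
    have h1 : ContMDiffAt 𝓘(ℝ, ℝ) 𝓘(ℝ, E) ∞ (fun t => φ.symm (φ (c t))) 0 :=
      ContMDiffAt.comp (0 : ℝ) (g := φ.symm) (contMDiffAt_extChartAt_symm (φ.map_source h00))
        ((hsm.contDiffAt (hO.mem_nhds h00)).contMDiffAt)
    refine h1.congr_of_eventuallyEq ?_
    filter_upwards [hO.mem_nhds h00] with t ht
    exact (φ.left_inv ht).symm
  -- Smoothness at 0 is carried to every t by c(r) = c(t) c(r - t).
  intro t
  have h2 : ContMDiffAt 𝓘(ℝ, ℝ) 𝓘(ℝ, ℝ) ∞ (fun r : ℝ => r - t) t :=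
    (contDiffAt_id.sub contDiffAt_const).contMDiffAt
  have h3 : ContMDiffAt 𝓘(ℝ, ℝ) 𝓘(ℝ, E) ∞ (fun r : ℝ => c (r - t)) t :=
    ContMDiffAt.comp t (g := c) (by rw [sub_self]; exact hsm0) h2
  have h4 : ContMDiffAt 𝓘(ℝ, ℝ) 𝓘(ℝ, E) ∞ (fun r : ℝ => c t * c (r - t)) t :=
    contMDiffAt_const.mul h3
  refine h4.congr_of_eventuallyEq (Eventually.of_forall fun r => ?_)
  show c r = c t * c (r - t)
  rw [← hom]; congr 1; ring

theorem IsOneParameterSubgroup.lieExp_eq [CompleteSpace E] [T2Space G] {A : E} {c : ℝ → G}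
    (hc : IsOneParameterSubgroup E A c) : lieExp E G A = c 1 := by
  have h : ∃ c : ℝ → G, IsOneParameterSubgroup E A c := ⟨c, hc⟩
  rw [lieExp, dif_pos h, h.choose_spec.unique hc]

theorem isAbsContCurve_id : IsAbsContCurve ℝ (fun t : ℝ => t) :=
  AbsolutelyContinuousOnInterval.isAbsContCurve
    (LipschitzOnWith.absolutelyContinuousOnInterval (K := 1) (LipschitzWith.id.lipschitzOnWith))

/-- The solution of `g' = dR_g (a(t))`, `g(0) = 1`, for small integrable `a`, ends at `exp X` for a
vector `X` that equals `∫ a` up to second order. -/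
theorem exists_rightTrans_solution [FiniteDimensional ℝ E] [T2Space G] :
    ∃ ε > 0, ∃ C > 0, ∀ a : ℝ → E, Integrable a → ∫ τ, ‖a τ‖ ≤ ε →
      ∃ g : ℝ → G, IsAbsContCurve E g ∧ g 0 = 1 ∧
        (∀ᵐ t ∂(volume.restrict (Icc (0 : ℝ) 1)), vel E g t = rightTrans E (g t) (a t)) ∧
        ∃ X : E, g 1 = lieExp E G X ∧
          ‖X - ∫ τ in (0 : ℝ)..1, a τ‖ ≤ C * (∫ τ, ‖a τ‖) ^ 2 := by
  have : CompleteSpace E := FiniteDimensional.complete ℝ E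
  set φ := extChartAt 𝓘(ℝ, E) (1 : G) with hφ
  have h1 : φ 1 ∈ φ.target := mem_extChartAt_target _
  obtain ⟨ε, hε, C, hC, h⟩ := exists_caratheodory_expansion (z₀ := φ 1)
    ((contDiffAt_rightTransChart (G := G) h1).of_le (by simp)) rightTransChart_apply_one
    ((isOpen_extChartAt_target (I := 𝓘(ℝ, E)) (1 : G)).mem_nhds h1)
  have key : ∀ (a z : ℝ → E), (∀ t, z t ∈ φ.target) →
      Integrable (fun τ => rightTransChart E G (z τ) (a τ)) →
      (∀ t, z t = φ 1 + ∫ τ in (0 : ℝ)..t, rightTransChart E G (z τ) (a τ)) →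
      IsAbsContCurve E (fun t => φ.symm (z t)) ∧ φ.symm (z 0) = 1 ∧
        (∀ᵐ t ∂(volume.restrict (Icc (0 : ℝ) 1)),
          vel E (fun t => φ.symm (z t)) t = rightTrans E (φ.symm (z t)) (a t)) := by
    intro a z hzU hi hz
    have hp := isAbsContCurve_primitive (hi.intervalIntegrable (a := 0) (b := 1)) (φ 1)
    have hd := ae_hasDerivAt_primitive (hi.intervalIntegrable (a := 0) (b := 1)) (φ 1)
    have hzz : (fun t => φ 1 + ∫ τ in (0 : ℝ)..t, rightTransChart E G (z τ) (a τ)) = z :=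
      funext fun t => (hz t).symm
    rw [hzz] at hp hd
    refine ⟨hp.comp fun t _ => contMDiffAt_extChartAt_symm (hzU t), ?_, ?_⟩
    · rw [hz 0]; simp [hφ]
    · filter_upwards [hd] with t ht
      exact vel_extChartAt_symm_comp (hzU t) ht
  refine ⟨ε, hε, C, hC, fun a ha hae => ?_⟩
  obtain ⟨z, hz, hzU, hzi, hz', X, w, hw, hwU, hwi, hw', hwz, hX⟩ := h a ha hae
  obtain ⟨k1, k2, k3⟩ := key a z hzU hzi hz'
  obtain ⟨l1, l2, l3⟩ := key _ w hwU hwi hw'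
  refine ⟨fun t => φ.symm (z t), k1, k2, k3, X, ?_, hX⟩
  obtain ⟨c, hc⟩ := exists_isOneParameterSubgroup (G := G) X
  have hcA : IsAbsContCurve E c := isAbsContCurve_id.comp fun t _ => hc.1.contMDiffAt
  -- The solution with constant coefficient X is the one-parameter subgroup of X, so its endpoint is
  -- exp X.
  have := eqOn_of_ae_vel_eq_rightTrans l1 hcA (l2.trans hc.map_zero.symm) l3 (by
    filter_upwards [ae_mem_Ioo_zero_one] with t ht
    rw [hc.vel_eq_rightTrans, indicator_of_mem (Ioo_subset_Ioc_self ht)])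
    (right_mem_Icc.2 zero_le_one)
  rw [hc.lieExp_eq, ← this]
  simp only [hwz]

end OneParameter

/-! ### Lifts in principal bundles -/

section BundleLifts

variable {EG G EP P EM M : Type*}
  [NormedAddCommGroup EG] [NormedSpace ℝ EG]
  [TopologicalSpace G] [ChartedSpace EG G] [Group G] [LieGroup 𝓘(ℝ, EG) ∞ G]
  [NormedAddCommGroup EP] [NormedSpace ℝ EP] [TopologicalSpace P] [ChartedSpace EP P]
  [NormedAddCommGroup EM] [NormedSpace ℝ EM] [TopologicalSpace M] [ChartedSpace EM M]

namespace PrincipalBundle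

variable (B : PrincipalBundle EG G EP P EM M)

/-- Not an axiom of the structure: it follows from the equivariance of local trivialisations, as
does freeness of the action below. -/
theorem proj_act (p : P) (a : G) : B.proj (B.act p a) = B.proj p := by
  obtain ⟨U, -, hU, ψ, φ, -, -, h1, h2, h3⟩ := B.locallyTrivial (B.proj p)
  obtain ⟨h4, h5⟩ := h2 p hU
  have h6 : ψ (B.proj p, (φ p).2) = p := by rw [← h4]; exact h5
  conv_lhs => rw [← h6]
  rw [← h3 _ hU, (h1 _ hU _).1]

theorem act_injective (p : P) {a b : G} (h : B.act p a = B.act p b) : a = b := by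
  obtain ⟨U, -, hU, ψ, φ, -, -, h1, h2, h3⟩ := B.locallyTrivial (B.proj p)
  obtain ⟨h4, h5⟩ := h2 p hU
  have h6 : ψ (B.proj p, (φ p).2) = p := by rw [← h4]; exact h5
  rw [← h6, ← h3 _ hU, ← h3 _ hU] at h
  have := congrArg φ h
  rw [(h1 _ hU _).2, (h1 _ hU _).2] at this
  simpa using congrArg Prod.snd this

/-- A smooth section trivialises the bundle: `p = σ(π(p)) τ(p)` for a smooth `τ : P → G`. -/
theorem exists_division {σ : M → P} (hσ : ContMDiff 𝓘(ℝ, EM) 𝓘(ℝ, EP) ∞ σ)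
    (hσp : ∀ y, B.proj (σ y) = y) :
    ∃ τ : P → G, ContMDiff 𝓘(ℝ, EP) 𝓘(ℝ, EG) ∞ τ ∧ ∀ p, B.act (σ (B.proj p)) (τ p) = p := by
  have hloc : ∀ q : P, ∃ V ∈ 𝓝 q, ∃ f : P → G, ContMDiffAt 𝓘(ℝ, EP) 𝓘(ℝ, EG) ∞ f q ∧
      ∀ p ∈ V, B.act (σ (B.proj p)) (f p) = p := by
    intro q
    obtain ⟨U, hUo, hU, ψ, φ, hψ, hφ, h1, h2, h3⟩ := B.locallyTrivial (B.proj q)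
    have hV : IsOpen (B.proj ⁻¹' U) := hUo.preimage B.contMDiff_proj.continuous
    have hs : ∀ p, B.proj p ∈ U → σ (B.proj p) ∈ B.proj ⁻¹' U := fun p hp => by
      rw [mem_preimage, hσp]; exact hp
    -- In a trivialisation τ is the quotient of the fibre coordinates of σ(π(p)) and p.
    refine ⟨_, hV.mem_nhds hU, fun p => ((φ (σ (B.proj p))).2)⁻¹ * (φ p).2, ?_, ?_⟩
    · have e1 : ContMDiffAt 𝓘(ℝ, EP) (𝓘(ℝ, EM).prod 𝓘(ℝ, EG)) ∞ φ q :=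
        hφ.contMDiffAt (hV.mem_nhds hU)
      have e2 : ContMDiffAt 𝓘(ℝ, EP) (𝓘(ℝ, EM).prod 𝓘(ℝ, EG)) ∞
          (fun p => φ (σ (B.proj p))) q :=
        ContMDiffAt.comp q (g := φ) (f := fun p => σ (B.proj p))
          (hφ.contMDiffAt (hV.mem_nhds (hs q hU)))
          (hσ.comp B.contMDiff_proj).contMDiffAt
      exact (e2.snd.inv).mul e1.snd
    · intro p hp
      obtain ⟨h4, h5⟩ := h2 p hp
      obtain ⟨h6, h7⟩ := h2 _ (hs p hp)
      have h8 : ψ (B.proj p, (φ p).2) = p := by rw [← h4]; exact h5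
      rw [hσp] at h6
      have h9 : ψ (B.proj p, (φ (σ (B.proj p))).2) = σ (B.proj p) := by
        have : (B.proj p, (φ (σ (B.proj p))).2) = φ (σ (B.proj p)) := Prod.ext h6.symm rfl
        rw [this]; exact h7
      conv_lhs => rw [← h9]
      rw [← h3 _ hp, mul_inv_cancel_left, h8]
  -- Freeness makes the local solutions agree, so the diagonal choice p ↦ `f p p` is locally equal
  -- to a smooth one.
  choose V hV f hf hfa using hloc
  refine ⟨fun p => f p p, fun q => ?_, fun p => hfa p p (mem_of_mem_nhds (hV p))⟩
  refine (hf q).congr_of_eventuallyEq ?_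
  filter_upwards [hV q] with p hp
  exact B.act_injective _ ((hfa p p (mem_of_mem_nhds (hV p))).trans (hfa q p hp).symm)

theorem contMDiffAt_act (q : P × G) : ContMDiffAt (𝓘(ℝ, EP).prod 𝓘(ℝ, EG)) 𝓘(ℝ, EP) ∞
    (fun q : P × G => B.act q.1 q.2) q := B.contMDiff_act.contMDiffAt

theorem contMDiff_act_right (p : P) : ContMDiff 𝓘(ℝ, EG) 𝓘(ℝ, EP) ∞ (fun a : G => B.act p a) :=
  B.contMDiff_act.comp (contMDiff_const.prodMk contMDiff_id)

theorem contMDiff_act_left (a : G) : ContMDiff 𝓘(ℝ, EP) 𝓘(ℝ, EP) ∞ (fun p : P => B.act p a) :=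
  B.contMDiff_act.comp (contMDiff_id.prodMk contMDiff_const)

theorem hasMD_act_right (p : P) (a : G) :
    HasMD EG EP (fun a : G => B.act p a) a (md EG EP (fun a : G => B.act p a) a) :=
  ContMDiffAt.hasMD (B.contMDiff_act_right p).contMDiffAt

theorem hasMD_act_left (p : P) (a : G) :
    HasMD EP EP (fun p : P => B.act p a) p (md EP EP (fun p : P => B.act p a) p) :=
  ContMDiffAt.hasMD (B.contMDiff_act_left a).contMDiffAt

/-- Differentiate p·b = (p·a)·(a⁻¹b) at b = a. Orbit directions at a thereby become fundamental
vectors at p·a. -/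
theorem md_act_right (p : P) (a : G) (w : EG) :
    md EG EP (fun b : G => B.act p b) a w =
      md EG EP (fun b : G => B.act (B.act p a) b) 1 (md EG EG (fun b : G => a⁻¹ * b) a w) := by
  have h1 := (B.hasMD_act_right (B.act p a) 1).comp_of_eq (hasMD_mul_left (E := EG) a⁻¹ a)
    (inv_mul_cancel a)
  have h2 := h1.congr (f₁ := fun b => B.act p b) (Eventually.of_forall fun b => by
    show B.act p b = B.act (B.act p a) (a⁻¹ * b)
    rw [← B.act_mul, mul_inv_cancel_left])
  rw [h2.md_eq]; rfl

end PrincipalBundle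

variable [IsManifold 𝓘(ℝ, EP) ∞ P] {B : PrincipalBundle EG G EP P EM M}
  (conn : PrincipalConnection B)

namespace PrincipalConnection

/-- The connection form at a point, as a linear map on the model space. -/
def formAt (p : P) : EP →L[ℝ] EG := conn.form p

theorem formAt_vertical (p : P) (A : EG) :
    conn.formAt p (md EG EP (fun a : G => B.act p a) 1 A) = A := by
  have h : conn.formAt (B.act p 1) (md EG EP (fun a : G => B.act p a) 1 A) = A :=
    conn.vertical p A
  rwa [B.act_one] at h

theorem formAt_md_act_right (p : P) (a : G) (w : EG) :
    conn.formAt (B.act p a) (md EG EP (fun b : G => B.act p b) a w) =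
      md EG EG (fun b : G => a⁻¹ * b) a w := by
  rw [B.md_act_right, conn.formAt_vertical]

theorem lieAd_eq (a : G) (A : EG) : lieAd EG a A = md EG EG (fun b : G => a * b * a⁻¹) 1 A := rfl

theorem lieAd_zero (a : G) : lieAd EG a (0 : EG) = 0 := by
  rw [lieAd_eq, map_zero]

theorem lieAd_neg (a : G) (A : EG) : lieAd EG a (-A) = -lieAd EG a A := by
  simp only [lieAd_eq, map_neg]

theorem md_mul_left_inv_rightTrans (a : G) (A : EG) :
    md EG EG (fun b : G => a⁻¹ * b) a (rightTrans EG a A) = lieAd EG a⁻¹ A := by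
  have h1 := (hasMD_mul_left (E := EG) a⁻¹ a).comp_of_eq (hasMD_mul_right a 1) (one_mul a)
  rw [lieAd_eq, inv_inv]
  simp only [← mul_assoc] at h1
  rw [h1.md_eq]; rfl

theorem formAt_md_act_left (p : P) (a : G) (v : EP) :
    conn.formAt (B.act p a) (md EP EP (fun q => B.act q a) p v) = lieAd EG a⁻¹ (conn.formAt p v) :=
  conn.equivariant p a v

/-- The gauge transformation formula ω((c·g)') = Ad(g⁻¹) ω(c') + g⁻¹g': equivariance handles the
first partial derivative of the action, reproduction of fundamental fields the second. -/
theorem formAt_vel_act {c : ℝ → P} {g : ℝ → G} {t : ℝ}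
    (hc : MDifferentiableAt 𝓘(ℝ, ℝ) 𝓘(ℝ, EP) c t) (hg : MDifferentiableAt 𝓘(ℝ, ℝ) 𝓘(ℝ, EG) g t) :
    conn.formAt (B.act (c t) (g t)) (vel EP (fun s => B.act (c s) (g s)) t) =
      lieAd EG (g t)⁻¹ (conn.formAt (c t) (vel EP c t)) +
        md EG EG (fun b : G => (g t)⁻¹ * b) (g t) (vel EG g t) := by
  have h := HasMD.comp₂ (H := fun q : P × G => B.act q.1 q.2)
    ((B.contMDiffAt_act (c t, g t)).mdifferentiableAt (by simp)) hc.hasMD hg.hasMD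
  rw [h.vel_eq, ← conn.formAt_md_act_left, ← conn.formAt_md_act_right, ← map_add]
  rfl

theorem isHorizontalLift_iff {p : P} {c : ℝ → M} {c' : ℝ → P} :
    conn.IsHorizontalLift p c c' ↔ IsAbsContCurve EP c' ∧ c' 0 = p ∧
      (∀ t ∈ Icc (0 : ℝ) 1, B.proj (c' t) = c t) ∧
      ∀ᵐ t ∂(volume.restrict (Icc (0 : ℝ) 1)), conn.formAt (c' t) (vel EP c' t) = 0 := Iff.rfl

variable [FiniteDimensional ℝ EG] [FiniteDimensional ℝ EP]

/-- Horizontal lifts with the same starting point have the same end point. -/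
theorem IsHorizontalLift.unique {σ : M → P} (hσ : ContMDiff 𝓘(ℝ, EM) 𝓘(ℝ, EP) ∞ σ)
    (hσp : ∀ y, B.proj (σ y) = y) {p : P} {c : ℝ → M} {c₁ c₂ : ℝ → P}
    (h₁ : conn.IsHorizontalLift p c c₁) (h₂ : conn.IsHorizontalLift p c c₂) : c₁ 1 = c₂ 1 := by
  obtain ⟨τ, hτ, hτa⟩ := B.exists_division hσ hσp
  obtain ⟨a1, b1, d1, e1⟩ := conn.isHorizontalLift_iff.1 h₁
  obtain ⟨a2, b2, d2, e2⟩ := conn.isHorizontalLift_iff.1 h₂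
  -- The curve k satisfies c₂ = c₁·k. As both lifts are horizontal, the gauge formula gives k⁻¹k' =
  -- 0, so k is constant.
  set k : ℝ → G := fun t => (τ (c₁ t))⁻¹ * τ (c₂ t) with hk
  have hkA : IsAbsContCurve EG k :=
    a1.comp₂ a2 (H := fun q : P × P => (τ q.1)⁻¹ * τ q.2) fun t _ =>
      (((hτ.contMDiffAt).comp (c₁ t, c₂ t) (f := Prod.fst) contMDiffAt_fst).inv).mul
        ((hτ.contMDiffAt).comp (c₁ t, c₂ t) (f := Prod.snd) contMDiffAt_snd)
  have hck : ∀ t ∈ Icc (0 : ℝ) 1, B.act (c₁ t) (k t) = c₂ t := by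
    intro t ht
    conv_lhs => rw [← hτa (c₁ t)]
    rw [← B.act_mul]
    simp only [hk, mul_inv_cancel_left]
    rw [d1 t ht, ← d2 t ht, hτa]
  have hk0 : ∀ᵐ t ∂(volume.restrict (Icc (0 : ℝ) 1)), vel EG k t = 0 := by
    filter_upwards [a1.ae_mdifferentiableAt, hkA.ae_mdifferentiableAt, e1, e2,
      ae_mem_Ioo_zero_one] with t h3 h4 h5 h6 h7
    have h8 := conn.formAt_vel_act h3 h4
    have h9 : (fun s => B.act (c₁ s) (k s)) =ᶠ[𝓝 t] c₂ := by
      filter_upwards [Icc_mem_nhds h7.1 h7.2] with s hs using hck s hs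
    rw [vel_congr h9, hck t (Ioo_subset_Icc_self h7), h6, h5, lieAd_zero, zero_add] at h8
    exact md_mul_left_injective _ _ h8.symm
  have h := hkA.eq_of_ae_vel_eq_zero hk0 (right_mem_Icc.2 zero_le_one) (left_mem_Icc.2 zero_le_one)
  have hk1 : k 1 = 1 := by rw [h]; simp [hk, b1, b2]
  rw [← hck 1 (right_mem_Icc.2 zero_le_one), hk1, B.act_one]

/-- With g' = dR_g(-A(γ')) one has g⁻¹g' = -Ad(g⁻¹)A(γ'), which cancels the other term of the gauge
formula. -/
theorem isHorizontalLift_act [FiniteDimensional ℝ EM] [IsManifold 𝓘(ℝ, EM) ∞ M] {σ : M → P}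
    (hσ : ContMDiff 𝓘(ℝ, EM) 𝓘(ℝ, EP) ∞ σ)
    (hσp : ∀ y, B.proj (σ y) = y) {γ : ℝ → M} {g : ℝ → G} (hγ : IsAbsContCurve EM γ)
    (hg : IsAbsContCurve EG g) (hg0 : g 0 = 1)
    (hgv : ∀ᵐ t ∂(volume.restrict (Icc (0 : ℝ) 1)), vel EG g t =
      rightTrans EG (g t) (-conn.formAt (σ (γ t)) (vel EP (fun s => σ (γ s)) t))) :
    conn.IsHorizontalLift (σ (γ 0)) γ (fun t => B.act (σ (γ t)) (g t)) := by
  have hσγ : IsAbsContCurve EP (fun t => σ (γ t)) := hγ.comp fun t _ => hσ.contMDiffAt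
  rw [isHorizontalLift_iff]
  refine ⟨hσγ.comp₂ hg (H := fun q : P × G => B.act q.1 q.2) fun t _ => B.contMDiffAt_act _,
    by simp [hg0, B.act_one], fun t _ => by rw [B.proj_act, hσp], ?_⟩
  filter_upwards [hσγ.ae_mdifferentiableAt, hg.ae_mdifferentiableAt, hgv] with t h1 h2 h3
  rw [conn.formAt_vel_act h1 h2, h3, md_mul_left_inv_rightTrans, lieAd_neg, add_neg_cancel]

end PrincipalConnection

variable (EG G) in
/-- The holonomy of a loop is `exp X` with `X = -∫ σ^* ω` up to second order, if the integral of
the norm of `σ^* ω` along the loop is small. -/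
theorem exists_holonomy_expansion [FiniteDimensional ℝ EG] [T2Space G] :
    ∃ ε > 0, ∃ C > 0, ∀ {EP P EM M : Type*} [NormedAddCommGroup EP] [NormedSpace ℝ EP]
      [TopologicalSpace P] [ChartedSpace EP P] [NormedAddCommGroup EM] [NormedSpace ℝ EM]
      [TopologicalSpace M] [ChartedSpace EM M] [IsManifold 𝓘(ℝ, EP) ∞ P]
      [FiniteDimensional ℝ EP] [FiniteDimensional ℝ EM] [IsManifold 𝓘(ℝ, EM) ∞ M]
      {B : PrincipalBundle EG G EP P EM M} (conn : PrincipalConnection B) {σ : M → P}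
      (_ : ContMDiff 𝓘(ℝ, EM) 𝓘(ℝ, EP) ∞ σ) (_ : ∀ y, B.proj (σ y) = y) {x : M} {γ : ℝ → M}
      (_ : IsLoopAt EM x γ)
      (_ : IntegrableOn (fun t => conn.formAt (σ (γ t)) (vel EP (fun s => σ (γ s)) t)) (Ioc 0 1)),
      (∫ t in (0 : ℝ)..1, ‖conn.formAt (σ (γ t)) (vel EP (fun s => σ (γ s)) t)‖) ≤ ε →
      ∃ X : EG, (∀ a : G, conn.IsHolonomy (σ x) γ a ↔ a = lieExp EG G X) ∧
        ‖X + ∫ t in (0 : ℝ)..1, conn.formAt (σ (γ t)) (vel EP (fun s => σ (γ s)) t)‖ ≤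
          C * (∫ t in (0 : ℝ)..1, ‖conn.formAt (σ (γ t)) (vel EP (fun s => σ (γ s)) t)‖) ^ 2 := by
  have : CompleteSpace EG := FiniteDimensional.complete ℝ EG
  obtain ⟨ε, hε, C, hC, h⟩ := exists_rightTrans_solution (E := EG) (G := G)
  refine ⟨ε, hε, C, hC, ?_⟩
  intro EP P EM M _ _ _ _ _ _ _ _ _ _ _ _ B conn σ hσ hσp x γ hγ hi hle
  set α : ℝ → EG := fun t => conn.formAt (σ (γ t)) (vel EP (fun s => σ (γ s)) t) with hα
  -- Extended by 0, since the equation on the group is solved for coefficients integrable on the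
  -- line.
  let a : ℝ → EG := (Ioc (0 : ℝ) 1).indicator fun t => -α t
  have ha : Integrable a := hi.neg.integrable_indicator measurableSet_Ioc
  have han : ∫ τ, ‖a τ‖ = ∫ t in (0 : ℝ)..1, ‖α t‖ := by
    simp_rw [a, norm_indicator_eq_indicator_norm, norm_neg]
    rw [integral_indicator measurableSet_Ioc, intervalIntegral.integral_of_le zero_le_one]
  have hai : ∫ τ in (0 : ℝ)..1, a τ = -∫ t in (0 : ℝ)..1, α t := by
    rw [intervalIntegral.integral_of_le zero_le_one, setIntegral_indicator measurableSet_Ioc,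
      inter_self, integral_neg, intervalIntegral.integral_of_le zero_le_one]
  obtain ⟨g, hg, hg0, hgv, X, hX, hXn⟩ := h a ha (by rw [han]; exact hle)
  rw [han, hai, sub_neg_eq_add] at hXn
  have hlift := conn.isHorizontalLift_act hσ hσp hγ.1 hg hg0 (by
    filter_upwards [hgv, ae_mem_Ioo_zero_one] with t h1 h2
    rw [h1]
    simp only [a, indicator_of_mem (Ioo_subset_Ioc_self h2)]
    rfl)
  rw [hγ.2.1] at hlift
  refine ⟨X, fun b => ⟨?_, ?_⟩, hXn⟩
  · rintro ⟨c', hc', hc'1⟩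
    have h1 := PrincipalConnection.IsHorizontalLift.unique conn hσ hσp hc' hlift
    rw [hc'1] at h1
    simp only [hγ.2.2] at h1
    rw [B.act_injective _ h1, hX]
  · rintro rfl
    refine ⟨_, hlift, ?_⟩
    simp only [hγ.2.2, hX]

end BundleLifts

/-! ### Naturality of the curvature -/

section CurvatureNaturality

variable {EG G EP P EM M : Type*}
  [NormedAddCommGroup EG] [NormedSpace ℝ EG]
  [TopologicalSpace G] [ChartedSpace EG G] [Group G]
  [NormedAddCommGroup EP] [NormedSpace ℝ EP] [TopologicalSpace P] [ChartedSpace EP P]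
  [NormedAddCommGroup EM] [NormedSpace ℝ EM] [TopologicalSpace M] [ChartedSpace EM M]

theorem zero_lieBracketModel [LieGroup 𝓘(ℝ, EG) ∞ G] [CompleteSpace EG] (A : EG) :
    lieBracketModel EG G 0 A = 0 := by
  have : LieGroup 𝓘(ℝ, EG) (minSmoothness ℝ 3) G := by
    rw [minSmoothness_of_isRCLikeNormedField]
    exact LieGroup.of_le (n := ∞) ENat.LEInfty.out
  exact zero_lie (L := GroupLieAlgebra 𝓘(ℝ, EG) G) (M := GroupLieAlgebra 𝓘(ℝ, EG) G) A

variable [IsManifold 𝓘(ℝ, EP) ∞ P] {B : PrincipalBundle EG G EP P EM M}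
  (conn : PrincipalConnection B) {W : Type*} [NormedAddCommGroup W] [NormedSpace ℝ W]

namespace PrincipalConnection

/-- The pull-back of the connection form along a map from a vector space. -/
def pullForm (Q : W → P) (w : W) : W →L[ℝ] EG := (conn.formAt (Q w)).comp (md W EP Q w)

theorem pullForm_apply (Q : W → P) (w v : W) :
    conn.pullForm Q w v = conn.formAt (Q w) (md W EP Q w v) := rfl

variable [FiniteDimensional ℝ W]

theorem contDiffOn_pullForm {Q : W → P} {O : Set W} (hO : IsOpen O)
    (hQ : ContMDiffOn 𝓘(ℝ, W) 𝓘(ℝ, EP) ∞ Q O) : ContDiffOn ℝ ∞ (conn.pullForm Q) O :=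
  contDiffOn_pullback_oneForm conn.smooth hO hQ

theorem differentiableAt_pullForm {Q : W → P} {O : Set W} (hO : IsOpen O)
    (hQ : ContMDiffOn 𝓘(ℝ, W) 𝓘(ℝ, EP) ∞ Q O) {w : W} (hw : w ∈ O) :
    DifferentiableAt ℝ (conn.pullForm Q) w :=
  ((conn.contDiffOn_pullForm hO hQ).contDiffAt (hO.mem_nhds hw)).differentiableAt (by simp)

/-- The curvature pulls back to the curvature of the pulled back form. -/
theorem curvature_md [FiniteDimensional ℝ EP] {Q : W → P} {O : Set W} (hO : IsOpen O)
    (hQ : ContMDiffOn 𝓘(ℝ, W) 𝓘(ℝ, EP) ∞ Q O) {w : W} (hw : w ∈ O) (u v : W) :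
    conn.curvature (Q w) (md W EP Q w u) (md W EP Q w v) =
      fderiv ℝ (conn.pullForm Q) w u v - fderiv ℝ (conn.pullForm Q) w v u +
        lieBracketModel EG G (conn.pullForm Q w u) (conn.pullForm Q w v) := by
  set φ := extChartAt 𝓘(ℝ, EP) (Q w) with hφ
  have hQa : ∀ w ∈ O, ContMDiffAt 𝓘(ℝ, W) 𝓘(ℝ, EP) ∞ Q w := fun w hw =>
    hQ.contMDiffAt (hO.mem_nhds hw)
  let f : W → EP := fun w => φ (Q w)
  set β := conn.pullForm φ.symm with hβ
  have hsrc : ∀ᶠ w' in 𝓝 w, w' ∈ O ∧ Q w' ∈ φ.source :=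
    (hO.eventually_mem hw).and ((hQa w hw).continuousAt.eventually
      ((isOpen_extChartAt_source (I := 𝓘(ℝ, EP)) _).mem_nhds (mem_extChartAt_source _)))
  have hf : ContDiffAt ℝ ∞ f w := by
    refine contMDiffAt_iff_contDiffAt.1 (ContMDiffAt.comp w (g := φ) ?_ (hQa w hw))
    exact contMDiffAt_extChartAt
  have hβd : DifferentiableAt ℝ β (f w) :=
    conn.differentiableAt_pullForm (isOpen_extChartAt_target _) (contMDiffOn_extChartAt_symm _)
      (mem_extChartAt_target _)
  have hmd : ∀ w' ∈ O, Q w' ∈ φ.source → fderiv ℝ f w' = (md EP EP φ (Q w')).comp (md W EP Q w') := by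
    intro w' h1 h2
    have := (contMDiffAt_extChartAt_of_mem (E := EP) h2).hasMD.comp (hQa w' h1).hasMD
    rw [← md_eq_fderiv, this.md_eq]
  -- Near w, Q factors through the chart in which the exterior derivative is defined: Q^*ω = f^*β,
  -- with β the form in that chart.
  have hpull : conn.pullForm Q =ᶠ[𝓝 w] fun w' => (β (f w')).comp (fderiv ℝ f w') := by
    filter_upwards [hsrc] with w' hw'
    ext v
    rw [hmd w' hw'.1 hw'.2]
    show _ = conn.formAt (φ.symm (φ (Q w'))) (md EP EP φ.symm (φ (Q w')) (md EP EP φ (Q w') _))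
    rw [md_extChartAt_symm_comp hw'.2, φ.left_inv hw'.2]
    rfl
  have hf1 : HasFDerivAt f (fderiv ℝ f w) w := (hf.differentiableAt (by simp)).hasFDerivAt
  have hf2 : HasFDerivAt (fderiv ℝ f) (fderiv ℝ (fderiv ℝ f) w) w :=
    ((hf.fderiv_right (m := ∞) (by simp)).differentiableAt (by simp)).hasFDerivAt
  -- The second derivative of f is symmetric, so it cancels on antisymmetrising: d(f^*β) = f^*dβ.
  have hsymm := hf.isSymmSndFDerivAt (by
    rw [minSmoothness_of_isRCLikeNormedField]; exact ENat.LEInfty.out)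
  have hd : ∀ u v, fderiv ℝ (conn.pullForm Q) w u v =
      fderiv ℝ β (f w) (fderiv ℝ f w u) (fderiv ℝ f w v) +
        β (f w) (fderiv ℝ (fderiv ℝ f) w u v) := by
    intro u v
    have h1 : HasFDerivAt (fun w' => β (f w')) ((fderiv ℝ β (f w)).comp (fderiv ℝ f w)) w :=
      hβd.hasFDerivAt.comp w hf1
    have h := h1.clm_comp hf2
    rw [hpull.fderiv_eq, HasFDerivAt.fderiv h]
    simp [add_comm]
  have hu : ∀ u, md EP EP φ (Q w) (md W EP Q w u) = fderiv ℝ f w u := fun u => by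
    rw [hmd w hw (mem_extChartAt_source _)]; rfl
  have hext : extDerivOneForm conn.form (Q w) (md W EP Q w u) (md W EP Q w v) =
      fderiv ℝ β (f w) (fderiv ℝ f w u) (fderiv ℝ f w v) -
        fderiv ℝ β (f w) (fderiv ℝ f w v) (fderiv ℝ f w u) := by
    have h1 : ∀ a b : EP, fderiv ℝ (fun z => β z a) (f w) b = fderiv ℝ β (f w) b a := by
      intro a b
      rw [fderiv_clm_apply hβd (differentiableAt_const a)]
      simp
    rw [← h1, ← h1, ← hu, ← hu]
    rfl
  show extDerivOneForm conn.form (Q w) (md W EP Q w u) (md W EP Q w v) +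
    lieBracketModel EG G (conn.pullForm Q w u) (conn.pullForm Q w v) = _
  rw [hd, hd, hsymm u v, hext]
  abel

end PrincipalConnection

end CurvatureNaturality

/-! ### Vanishing order and partitions -/

section Taylor

variable {F V : Type*} [NormedAddCommGroup F] [NormedSpace ℝ F]
  [NormedAddCommGroup V] [NormedSpace ℝ V]

/-- The limit s ↓ 0 kills the constant term; divide by s and repeat. -/
theorem eq_zero_of_sum_pow_smul_isLittleO {n : ℕ} {c : ℕ → F}
    (h : (fun s : ℝ => ∑ k ∈ Finset.range (n + 1), s ^ k • c k) =o[𝓝[>] 0] fun s : ℝ => s ^ n) :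
    ∀ k ≤ n, c k = 0 := by
  induction n generalizing c with
  | zero =>
    intro k hk
    obtain rfl : k = 0 := by omega
    simp only [zero_add, Finset.sum_range_one, pow_zero, one_smul,
      Asymptotics.isLittleO_one_iff] at h
    exact tendsto_nhds_unique tendsto_const_nhds h
  | succ n ih =>
    have h0 : c 0 = 0 := by
      have h1 : Tendsto (fun s : ℝ => ∑ k ∈ Finset.range (n + 1 + 1), s ^ k • c k) (𝓝[>] 0)
          (𝓝 0) := by
        have h2 : Tendsto (fun s : ℝ => s ^ (n + 1)) (𝓝[>] 0) (𝓝 0) := by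
          have : Continuous fun s : ℝ => s ^ (n + 1) := by fun_prop
          simpa using (this.tendsto 0).mono_left nhdsWithin_le_nhds
        exact h.isBigO.trans_tendsto h2
      have h3 : Tendsto (fun s : ℝ => ∑ k ∈ Finset.range (n + 1 + 1), s ^ k • c k) (𝓝[>] 0)
          (𝓝 (c 0)) := by
        have : Continuous fun s : ℝ => ∑ k ∈ Finset.range (n + 1 + 1), s ^ k • c k := by fun_prop
        have h4 := (this.tendsto 0).mono_left (nhdsWithin_le_nhds (s := Ioi 0))
        rwa [Finset.sum_range_succ', Finset.sum_eq_zero (by intros; simp), zero_add, pow_zero,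
          one_smul] at h4
      exact tendsto_nhds_unique h3 h1
    have h1 : ∀ k ≤ n, c (k + 1) = 0 := by
      refine ih ?_
      rw [Asymptotics.isLittleO_iff] at h ⊢
      intro ε hε
      filter_upwards [h hε, self_mem_nhdsWithin] with s hs hs0
      rw [Finset.sum_range_succ', h0, smul_zero, add_zero] at hs
      simp only [pow_succ', mul_smul, ← Finset.smul_sum, norm_smul, norm_mul] at hs
      have hs0' : 0 < ‖s‖ := norm_pos_iff.2 (ne_of_gt hs0)
      rw [← mul_assoc, mul_comm ε, mul_assoc] at hs
      exact le_of_mul_le_mul_left hs hs0'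
    intro k hk
    cases k with
    | zero => exact h0
    | succ k => exact h1 k (by omega)

theorem contDiff_iteratedDeriv_left {f : ℝ × V → F} (hf : ContDiff ℝ ∞ f) (n : ℕ) :
    ContDiff ℝ ∞ fun q : ℝ × V => iteratedDeriv n (fun s => f (s, q.2)) q.1 := by
  induction n with
  | zero => simpa using hf
  | succ n ih =>
    set g := fun q : ℝ × V => iteratedDeriv n (fun s => f (s, q.2)) q.1 with hg
    have h1 : (fun q : ℝ × V => iteratedDeriv (n + 1) (fun s => f (s, q.2)) q.1) =
        fun q => fderiv ℝ g q (1, 0) := by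
      ext q
      rw [iteratedDeriv_succ]
      have h2 : HasFDerivAt g (fderiv ℝ g q) (q.1, q.2) :=
        (ih.differentiable (by simp) _).hasFDerivAt
      have h3 : HasDerivAt (fun s : ℝ => (s, q.2)) ((1 : ℝ), (0 : V)) q.1 :=
        (hasDerivAt_id _).prodMk (hasDerivAt_const _ _)
      exact (h2.comp_hasDerivAt q.1 h3).deriv
    rw [h1]
    exact (ih.fderiv_right (m := ∞) (by simp)).clm_apply contDiff_const

/-- A smooth function that vanishes to order greater than `n` in `s` at `s = 0` is bounded by
`C s ^ (n + 1)`, locally uniformly in the parameter. -/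
theorem exists_norm_le_pow_of_isLittleO {f : ℝ × V → F} (hf : ContDiff ℝ ∞ f) {K : Set V}
    (hK : IsCompact K) (n : ℕ)
    (h : ∀ v ∈ K, (fun s => f (s, v)) =o[𝓝[>] 0] fun s : ℝ => s ^ n) :
    ∃ C, 0 ≤ C ∧ ∀ v ∈ K, ∀ s ∈ Icc (0 : ℝ) 1, ‖f (s, v)‖ ≤ C * s ^ (n + 1) := by
  have hc := (contDiff_iteratedDeriv_left hf (n + 1)).continuous
  obtain ⟨C, hC⟩ := ((isCompact_Icc (a := (0 : ℝ)) (b := 1)).prod hK).exists_bound_of_continuousOn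
    hc.continuousOn
  have hs : ∀ v, ContDiff ℝ ∞ fun s : ℝ => f (s, v) := fun v =>
    hf.comp (contDiff_id.prodMk contDiff_const)
  have hid : ∀ v, ∀ k, ∀ s ∈ Icc (0 : ℝ) 1, iteratedDerivWithin k (fun s => f (s, v)) (Icc 0 1) s =
      iteratedDeriv k (fun s => f (s, v)) s := fun v k s hs' =>
    iteratedDerivWithin_eq_iteratedDeriv (uniqueDiffOn_Icc zero_lt_one)
      ((hs v).contDiffAt.of_le (by exact_mod_cast le_top)) hs'
  -- The Taylor remainder is bounded uniformly, because the (n+1)-st derivative is bounded on the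
  -- compact set `[0, 1] × K`.
  have hrem : ∀ v ∈ K, ∀ s ∈ Icc (0 : ℝ) 1,
      ‖f (s, v) - taylorWithinEval (fun s => f (s, v)) n (Icc 0 1) 0 s‖ ≤
        |C| * s ^ (n + 1) := by
    intro v hv s hs'
    have h1 := taylor_mean_remainder_bound (C := |C|) zero_le_one
      ((hs v).contDiffOn.of_le (by exact_mod_cast le_top)) hs' (n := n) fun y hy => by
        rw [hid v _ y hy]
        exact (hC (y, v) ⟨hy, hv⟩).trans (le_abs_self C)
    rw [sub_zero] at h1
    refine h1.trans (div_le_self (by have := hs'.1; positivity) ?_)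
    exact_mod_cast Nat.one_le_iff_ne_zero.2 (Nat.factorial_ne_zero n)
  refine ⟨|C|, abs_nonneg C, fun v hv s hs' => ?_⟩
  have htay : ∀ s, taylorWithinEval (fun s => f (s, v)) n (Icc 0 1) 0 s =
      ∑ k ∈ Finset.range (n + 1), s ^ k • ((k.factorial : ℝ)⁻¹ •
        iteratedDerivWithin k (fun s => f (s, v)) (Icc 0 1) 0) := by
    intro s
    rw [taylor_within_apply]
    refine Finset.sum_congr rfl fun k _ => ?_
    rw [sub_zero, smul_smul, mul_comm]
  have h0 : (fun s => taylorWithinEval (fun s => f (s, v)) n (Icc 0 1) 0 s) =o[𝓝[>] 0]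
      fun s : ℝ => s ^ n := by
    have h1 : (fun s => f (s, v) - taylorWithinEval (fun s => f (s, v)) n (Icc 0 1) 0 s)
        =O[𝓝[>] 0] fun s : ℝ => s ^ (n + 1) := by
      refine Asymptotics.IsBigO.of_bound |C| ?_
      filter_upwards [Ioo_mem_nhdsGT (zero_lt_one (α := ℝ))] with s hs
      rw [norm_pow, Real.norm_of_nonneg hs.1.le]
      exact hrem v hv s ⟨hs.1.le, hs.2.le⟩
    have h2 : (fun s : ℝ => s ^ (n + 1)) =o[𝓝[>] 0] fun s : ℝ => s ^ n :=
      (Asymptotics.isLittleO_pow_pow (by omega)).mono nhdsWithin_le_nhds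
    refine ((h v hv).sub (h1.trans_isLittleO h2)).congr_left fun s => ?_
    abel
  -- A polynomial of degree ≤ n that is o(s^n) vanishes, so the remainder is all of f. Thus
  -- pointwise o(s^n) becomes uniform O(s^(n+1)).
  have hz : taylorWithinEval (fun s => f (s, v)) n (Icc 0 1) 0 s = 0 := by
    simp only [htay] at h0 ⊢
    have := eq_zero_of_sum_pow_smul_isLittleO h0
    exact Finset.sum_eq_zero fun k hk => by
      rw [this k (by have := Finset.mem_range.1 hk; omega), smul_zero]
  have := hrem v hv s hs'
  rwa [hz, sub_zero] at this

/-- Integration of an order of vanishing. -/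
theorem isLittleO_pow_succ_of_hasDerivAt {f f' : ℝ → F} {n : ℕ} (hc : ContinuousAt f 0)
    (h0 : f 0 = 0) (hf : ∀ s > 0, HasDerivAt f (f' s) s)
    (h : f' =o[𝓝[>] 0] fun s : ℝ => s ^ n) : f =o[𝓝[>] 0] fun s : ℝ => s ^ (n + 1) := by
  rw [Asymptotics.isLittleO_iff] at h ⊢
  intro ε hε
  obtain ⟨r, hr, h⟩ := mem_nhdsGT_iff_exists_Ioo_subset.1 (h hε)
  rw [mem_Ioi] at hr
  filter_upwards [Ioo_mem_nhdsGT hr] with s hs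
  have hcont : ContinuousOn f (Icc 0 s) := by
    intro u hu
    rcases hu.1.eq_or_lt with rfl | h1
    · exact hc.continuousWithinAt
    · exact (hf u h1).continuousAt.continuousWithinAt
  rw [norm_pow, Real.norm_of_nonneg hs.1.le]
  -- The derivative is known for positive s only: apply the mean value inequality on [u, s] and let
  -- u ↓ 0.
  have key : ∀ u ∈ Ioc 0 s, ‖f s - f u‖ ≤ ε * s ^ n * (s - u) := by
    intro u hu
    refine norm_image_sub_le_of_norm_deriv_right_le_segment (f := f) (f' := f') (a := u) (b := s)
      (C := ε * s ^ n) (hcont.mono (Icc_subset_Icc_left hu.1.le))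
      (fun y hy => (hf y (hu.1.trans_le hy.1)).hasDerivWithinAt) (fun y hy => ?_) s
      (right_mem_Icc.2 hu.2)
    have hy0 : 0 < y := hu.1.trans_le hy.1
    have h1 : ‖f' y‖ ≤ ε * ‖y ^ n‖ := h ⟨hy0, hy.2.trans hs.2⟩
    rw [norm_pow, Real.norm_of_nonneg hy0.le] at h1
    refine h1.trans ?_
    have := hy.2.le
    gcongr
  have hl : Tendsto (fun u => ‖f s - f u‖) (𝓝[>] 0) (𝓝 ‖f s - f 0‖) :=
    ((continuousAt_const.sub hc).norm).tendsto.mono_left nhdsWithin_le_nhds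
  rw [h0, sub_zero] at hl
  have hr' : Tendsto (fun u => ε * s ^ n * (s - u)) (𝓝[>] 0) (𝓝 (ε * s ^ n * (s - 0))) := by
    have : Continuous fun u => ε * s ^ n * (s - u) := by fun_prop
    exact (this.tendsto 0).mono_left nhdsWithin_le_nhds
  rw [sub_zero, mul_assoc, ← pow_succ] at hr'
  refine le_of_tendsto_of_tendsto hl hr' ?_
  filter_upwards [Ioc_mem_nhdsGT hs.1] with u hu
  exact key u hu

end Taylor

/-! ### Length of a curve and variation of its coordinates -/

section Partitions

/-- Repetitions in a monotone sequence contribute f(a, a) = 0 and can be deleted. Variation uses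
monotone sequences, `metricLength` strictly increasing ones. -/
theorem exists_strictMono_sum_eq {β : Type*} [AddCommMonoid β] {f : ℝ → ℝ → β}
    (hf : ∀ a, f a a = 0) (n : ℕ) (u : ℕ → ℝ) (hu : Monotone u) :
    ∃ (k : ℕ) (t : Fin (k + 1) → ℝ), StrictMono t ∧ t 0 = u 0 ∧ t (Fin.last k) = u n ∧
      (∀ j, ∃ i, t j = u i) ∧
      ∑ i ∈ Finset.range n, f (u i) (u (i + 1)) = ∑ j : Fin k, f (t j.castSucc) (t j.succ) := by
  induction n with
  | zero =>
    refine ⟨0, fun _ => u 0, ?_, rfl, rfl, fun _ => ⟨0, rfl⟩, by simp⟩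
    intro i j hij
    have : i.1 < j.1 := hij
    omega
  | succ n ih =>
    obtain ⟨k, t, ht, h0, h1, h2, h3⟩ := ih
    rcases (hu n.le_succ).eq_or_lt with h | h
    · refine ⟨k, t, ht, h0, h1.trans h, h2, ?_⟩
      rw [Finset.sum_range_succ, h3, h, hf, add_zero]
    · refine ⟨k + 1, Fin.snoc t (u (n + 1)), ?_, ?_, by simp, ?_, ?_⟩
      · rw [Fin.strictMono_iff_lt_succ]
        intro i
        induction i using Fin.lastCases with
        | last => simpa [h1] using h
        | cast i =>
          rw [Fin.snoc_castSucc, ← Fin.castSucc_succ, Fin.snoc_castSucc]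
          exact ht i.castSucc_lt_succ
      · rw [← Fin.castSucc_zero, Fin.snoc_castSucc, h0]
      · intro j
        induction j using Fin.lastCases with
        | last => exact ⟨n + 1, by simp⟩
        | cast j => simpa using h2 j
      · rw [Finset.sum_range_succ, h3, Fin.sum_univ_castSucc]
        congr 1
        · refine Finset.sum_congr rfl fun j _ => ?_
          rw [Fin.snoc_castSucc, ← Fin.castSucc_succ, Fin.snoc_castSucc]
        · rw [Fin.snoc_castSucc, h1, Fin.succ_last, Fin.snoc_last]

theorem eVariationOn_le_mul_metricLength {X M : Type*} [PseudoEMetricSpace X]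
    {d : M → M → ℝ≥0∞} {c : ℝ → X} {γ : ℝ → M} {C : ℝ≥0∞}
    (h : ∀ a ∈ Icc (0 : ℝ) 1, ∀ b ∈ Icc (0 : ℝ) 1, edist (c a) (c b) ≤ C * d (γ a) (γ b)) :
    eVariationOn c (Icc 0 1) ≤ C * metricLength d γ := by
  refine iSup_le fun ⟨n, u, hu, hmem⟩ => ?_
  dsimp only
  -- Lengths are taken over partitions from 0 to 1, so both endpoints are added; the old points
  -- shift by one index.
  set w : ℕ → ℝ := fun i => if i = 0 then 0 else if i ≤ n + 1 then u (i - 1) else 1 with hw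
  have hwm : Monotone w := by
    refine monotone_nat_of_le_succ fun i => ?_
    simp only [hw]
    rcases i with _ | i
    · simpa using (hmem 0).1
    · simp only [Nat.add_eq_zero_iff, one_ne_zero, and_false, if_false, Nat.add_sub_cancel]
      split_ifs
      · exact hu (by omega)
      · exact (hmem _).2
      · omega
      · exact le_rfl
  have hmem' : ∀ i, w i ∈ Icc (0 : ℝ) 1 := by
    intro i
    simp only [hw]
    split_ifs
    · simp
    · exact hmem _
    · simp
  obtain ⟨k, t, ht, h0, h1, h2, h3⟩ := exists_strictMono_sum_eq
    (f := fun a b => edist (c a) (c b)) (fun a => edist_self _) (n + 2) w hwm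
  have ht1 : t (Fin.last k) = 1 := by rw [h1]; simp [hw]
  have htm : ∀ j, t j ∈ Icc (0 : ℝ) 1 := fun j => by
    obtain ⟨i, hi⟩ := h2 j
    rw [hi]; exact hmem' i
  calc ∑ i ∈ Finset.range n, edist (c (u (i + 1))) (c (u i))
      = ∑ i ∈ Finset.range n, edist (c (w (i + 1))) (c (w (i + 1 + 1))) := by
        refine Finset.sum_congr rfl fun i hi => ?_
        have := Finset.mem_range.1 hi
        rw [edist_comm]
        simp only [hw, Nat.add_eq_zero_iff, one_ne_zero, and_false, if_false,
          Nat.add_sub_cancel]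
        rw [if_pos (by omega), if_pos (by omega)]
    _ ≤ ∑ i ∈ Finset.range (n + 2), edist (c (w i)) (c (w (i + 1))) := by
        rw [Finset.sum_range_succ, Finset.sum_range_succ']
        exact le_self_add.trans le_self_add
    _ = ∑ j : Fin k, edist (c (t j.castSucc)) (c (t j.succ)) := h3
    _ ≤ ∑ j : Fin k, C * d (γ (t j.castSucc)) (γ (t j.succ)) :=
        Finset.sum_le_sum fun j _ => h _ (htm _) _ (htm _)
    _ = C * ∑ j : Fin k, d (γ (t j.castSucc)) (γ (t j.succ)) := (Finset.mul_sum _ _ _).symm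
    _ ≤ C * metricLength d γ := by
        gcongr
        exact le_iSup_of_le k (le_iSup_of_le t (le_iSup_of_le ⟨ht, by simp [h0, hw], ht1⟩ le_rfl))

theorem le_metricLength {M : Type*} {d : M → M → ℝ≥0∞} {γ : ℝ → M} (h0 : d (γ 0) (γ 0) = 0)
    (h1 : γ 1 = γ 0) {t : ℝ} (ht : t ∈ Icc (0 : ℝ) 1) : d (γ 0) (γ t) ≤ metricLength d γ := by
  rcases ht.1.eq_or_lt with rfl | ht0
  · simp [h0]
  rcases ht.2.eq_or_lt with rfl | ht1
  · simp [h1, h0]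
  refine le_iSup_of_le 2 (le_iSup_of_le ![0, t, 1] (le_iSup_of_le ⟨?_, rfl, rfl⟩ ?_))
  · rw [Fin.strictMono_iff_lt_succ]
    intro i
    fin_cases i
    · exact ht0
    · exact ht1
  · rw [Fin.sum_univ_two]
    exact le_self_add

end Partitions

/-! ### Dilations in coordinates -/

section DilationChart

variable (EM : Type*) {M : Type*} [NormedAddCommGroup EM] [NormedSpace ℝ EM]
  [TopologicalSpace M] [ChartedSpace EM M]
  (W : Type*) [NormedAddCommGroup W] [NormedSpace ℝ W]

/-- A parametrization `κ : W → M` in which the dilations `δ` of `M` centred at `x` are linear,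
together with local coordinates inverse to `κ` that are Lipschitz for the metric `d`. -/
structure DilationChart (x : M) (δ : ℝ → M → M) (d : M → M → ℝ≥0∞) where
  D : ℝ → W →L[ℝ] W
  contDiff_D : ContDiff ℝ ∞ D
  D_zero : D 0 = 0
  D_one : D 1 = ContinuousLinearMap.id ℝ W
  D_mul : ∀ s t, D (s * t) = (D s).comp (D t)
  κ : W → M
  contMDiff_κ : ContMDiff 𝓘(ℝ, W) 𝓘(ℝ, EM) ∞ κ
  κ_zero : κ 0 = x
  δ_κ : ∀ s > 0, ∀ τ, δ s (κ τ) = κ (D s τ)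
  contMDiff_δ : ∀ s > 0, ContMDiff 𝓘(ℝ, EM) 𝓘(ℝ, EM) ∞ (δ s)
  coord : M → W
  radius : ℝ
  radius_pos : 0 < radius
  lip : ℝ
  lip_pos : 0 < lip
  κ_coord : ∀ y, d x y < ENNReal.ofReal radius → κ (coord y) = y
  contMDiffAt_coord : ∀ y, d x y < ENNReal.ofReal radius →
    ContMDiffAt 𝓘(ℝ, EM) 𝓘(ℝ, W) ∞ coord y
  coord_self : coord x = 0
  coord_lipschitz : ∀ y z, d x y < ENNReal.ofReal radius → d x z < ENNReal.ofReal radius →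
    edist (coord y) (coord z) ≤ ENNReal.ofReal lip * d y z
  d_self : d x x = 0
  d_δ : ∀ s > 0, ∀ y z, d (δ s y) (δ s z) ≤ ENNReal.ofReal s * d y z

variable {EM W} {x : M} {δ : ℝ → M → M} {d : M → M → ℝ≥0∞}
  {EG G EP P : Type*} [NormedAddCommGroup EG] [NormedSpace ℝ EG]
  [TopologicalSpace G] [ChartedSpace EG G] [Group G]
  [NormedAddCommGroup EP] [NormedSpace ℝ EP] [TopologicalSpace P] [ChartedSpace EP P]
  [IsManifold 𝓘(ℝ, EP) ∞ P]
  {B : PrincipalBundle EG G EP P EM M} (conn : PrincipalConnection B) {σ : M → P}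

/-- `σ^* Ω` as a form on the model spaces. -/
def PrincipalConnection.pullCurv (σ : M → P) (y : M) (u v : EM) : EG :=
  conn.pullbackCurvature σ y u v

theorem PrincipalConnection.pullCurv_md {κ : W → M} {w : W} {A : W →L[ℝ] EM}
    (hσ : ContMDiff 𝓘(ℝ, EM) 𝓘(ℝ, EP) ∞ σ) (hκ : HasMD W EM κ w A) (u v : W) :
    conn.pullCurv σ (κ w) (A u) (A v) =
      conn.curvature (σ (κ w)) (md W EP (fun w => σ (κ w)) w u)
        (md W EP (fun w => σ (κ w)) w v) := by
  rw [((hσ (κ w)).hasMD.comp hκ).md_eq]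
  rfl

namespace DilationChart

variable (Q : DilationChart EM W x δ d)

/-- The generator of the dilations. -/
def gen : W →L[ℝ] W := deriv Q.D 1

theorem D_comm (s t : ℝ) : (Q.D s).comp (Q.D t) = (Q.D t).comp (Q.D s) := by
  rw [← Q.D_mul, mul_comm, Q.D_mul]

theorem hasDerivAt_D_one : HasDerivAt Q.D Q.gen 1 :=
  (Q.contDiff_D.differentiable (by simp) 1).hasDerivAt

/-- Differentiate D(t) = D(t/s) ∘ D(s) at t = s. -/
theorem hasDerivAt_D {s : ℝ} (hs : 0 < s) :
    HasDerivAt Q.D (s⁻¹ • Q.gen.comp (Q.D s)) s := by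
  have h1 : HasDerivAt (fun t : ℝ => t * s⁻¹) s⁻¹ s := by
    simpa using (hasDerivAt_id s).mul_const s⁻¹
  have h2 : HasDerivAt Q.D Q.gen (s * s⁻¹) := by
    rw [mul_inv_cancel₀ hs.ne']; exact Q.hasDerivAt_D_one
  have h3 : HasDerivAt (fun t : ℝ => Q.D (t * s⁻¹)) (s⁻¹ • Q.gen) s :=
    HasDerivAt.scomp (g₁ := Q.D) (h := fun t : ℝ => t * s⁻¹) s h2 h1
  have h4 := ((ContinuousLinearMap.compL ℝ W W W).flip (Q.D s)).hasFDerivAt.comp_hasDerivAt s h3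
  have h5 : ((ContinuousLinearMap.compL ℝ W W W).flip (Q.D s)) ∘ (fun t : ℝ => Q.D (t * s⁻¹)) =
      Q.D := by
    funext t
    show (Q.D (t * s⁻¹)).comp (Q.D s) = _
    rw [← Q.D_mul, mul_assoc, inv_mul_cancel₀ hs.ne', mul_one]
  rw [h5] at h4
  exact h4

theorem gen_comm (s : ℝ) : (Q.D s).comp Q.gen = Q.gen.comp (Q.D s) := by
  have h1 := (hasDerivAt_const (1 : ℝ) (Q.D s)).clm_comp Q.hasDerivAt_D_one
  have h2 := Q.hasDerivAt_D_one.clm_comp (hasDerivAt_const (1 : ℝ) (Q.D s))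
  simp only [Q.D_comm s] at h1
  simpa using h1.unique h2

theorem hasDerivAt_D_apply {s : ℝ} (hs : 0 < s) (τ : W) :
    HasDerivAt (fun s => Q.D s τ) (s⁻¹ • Q.gen (Q.D s τ)) s := by
  simpa using (Q.hasDerivAt_D hs).clm_apply (hasDerivAt_const s τ)

theorem hasMD_κ (w : W) : HasMD W EM Q.κ w (md W EM Q.κ w) := (Q.contMDiff_κ w).hasMD

theorem δ_x (Q : DilationChart EM W x δ d) {s : ℝ} (hs : 0 < s) : δ s x = x := by
  conv_lhs => rw [← Q.κ_zero, Q.δ_κ s hs, map_zero, Q.κ_zero]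

theorem vel_δ_κ {s : ℝ} (hs : 0 < s) (τ : W) :
    vel EM (fun r => δ r (Q.κ τ)) s =
      md W EM Q.κ (Q.D s τ) (s⁻¹ • Q.gen (Q.D s τ)) := by
  have h1 : (fun r => δ r (Q.κ τ)) =ᶠ[𝓝 s] fun r => Q.κ (Q.D r τ) := by
    filter_upwards [lt_mem_nhds hs] with r hr
    exact Q.δ_κ r hr τ
  rw [vel_congr h1]
  have h2 := Q.hasDerivAt_D_apply hs τ
  rw [MDifferentiableAt.vel_comp (Q.hasMD_κ _) (c := fun r => Q.D r τ)
    (mdifferentiableAt_iff_differentiableAt.2 h2.differentiableAt), vel_eq_deriv, h2.deriv]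

theorem md_δ_κ {s : ℝ} (hs : 0 < s) (τ h : W) :
    md EM EM (δ s) (Q.κ τ) (md W EM Q.κ τ h) = md W EM Q.κ (Q.D s τ) (Q.D s h) := by
  have h1 := ((Q.contMDiff_δ s hs) (Q.κ τ)).hasMD.comp (Q.hasMD_κ τ)
  have h2 := (Q.hasMD_κ (Q.D s τ)).comp (hasMD_iff_hasFDerivAt.2 (Q.D s).hasFDerivAt)
  simp only [Q.δ_κ s hs] at h1
  exact DFunLike.congr_fun (h1.unique h2) h

/-- The connection form in the gauge `σ` and the coordinates `κ`. -/
def form (σ : M → P) : W → W →L[ℝ] EG := conn.pullForm fun τ => σ (Q.κ τ)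

variable {conn}

theorem contMDiff_comp_κ (hσ : conn.IsRadialGauge δ σ) :
    ContMDiff 𝓘(ℝ, W) 𝓘(ℝ, EP) ∞ fun τ => σ (Q.κ τ) := hσ.1.comp Q.contMDiff_κ

/-- In the coordinates κ the radial field S is the linear field τ ↦ gen τ, so this is the gauge
condition A(S) = 0. -/
theorem form_gen (hσ : conn.IsRadialGauge δ σ) (τ : W) : Q.form conn σ τ (Q.gen τ) = 0 := by
  have h1 : δ 1 (Q.κ τ) = Q.κ τ := by rw [Q.δ_κ 1 one_pos, Q.D_one]; rfl
  have h2 : conn.formAt (σ (δ 1 (Q.κ τ)))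
    (md EM EP σ (δ 1 (Q.κ τ)) (vel EM (fun s => δ s (Q.κ τ)) 1)) = 0 := hσ.2.2 (Q.κ τ)
  rw [h1, Q.vel_δ_κ one_pos, Q.D_one] at h2
  have h3 := ((hσ.1 (Q.κ τ)).hasMD.comp (Q.hasMD_κ τ)).md_eq
  rw [form, conn.pullForm_apply, h3]
  simpa using h2

theorem vel_δ_comp (c : ℝ → M) (y : ℝ → W) {t : ℝ} (h : c =ᶠ[𝓝 t] fun r => Q.κ (y r))
    (hy : DifferentiableAt ℝ y t) {s : ℝ} (hs : 0 < s) :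
    vel EM (fun r => δ s (c r)) t = md W EM Q.κ (Q.D s (y t)) (Q.D s (deriv y t)) := by
  have h1 : (fun r => δ s (c r)) =ᶠ[𝓝 t] fun r => Q.κ (Q.D s (y r)) := by
    filter_upwards [h] with r hr
    rw [hr, Q.δ_κ s hs]
  have h2 : HasDerivAt (fun r => Q.D s (y r)) (Q.D s (deriv y t)) t :=
    (Q.D s).hasFDerivAt.comp_hasDerivAt t hy.hasDerivAt
  rw [vel_congr h1, MDifferentiableAt.vel_comp (Q.hasMD_κ _) (c := fun r => Q.D s (y r))
    (mdifferentiableAt_iff_differentiableAt.2 h2.differentiableAt), vel_eq_deriv, h2.deriv]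

variable [FiniteDimensional ℝ W]

theorem contDiff_form (hσ : conn.IsRadialGauge δ σ) : ContDiff ℝ ∞ (Q.form conn σ) :=
  contDiffOn_univ.1 (conn.contDiffOn_pullForm isOpen_univ (Q.contMDiff_comp_κ hσ).contMDiffOn)

theorem contDiff_form_comp (hσ : conn.IsRadialGauge δ σ) :
    ContDiff ℝ ∞ fun q : ℝ × W × W => Q.form conn σ (Q.D q.1 q.2.1) (Q.D q.1 q.2.2) := by
  have hD : ContDiff ℝ ∞ fun q : ℝ × W × W => Q.D q.1 := Q.contDiff_D.comp contDiff_fst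
  exact ((Q.contDiff_form hσ).comp (hD.clm_apply contDiff_snd.fst)).clm_apply
    (hD.clm_apply contDiff_snd.snd)

theorem contDiff_form_ray (hσ : conn.IsRadialGauge δ σ) (τ h : W) :
    ContDiff ℝ ∞ fun s : ℝ => Q.form conn σ (Q.D s τ) (Q.D s h) :=
  (Q.contDiff_form_comp hσ).comp (contDiff_id.prodMk (contDiff_const (c := (τ, h))))

/-- A pointwise order of vanishing of the connection form is locally uniform. -/
theorem exists_form_le (hσ : conn.IsRadialGauge δ σ) (R : ℝ) {m : ℕ}
    (h : m = 0 ∨ ∀ τ h, (fun s => Q.form conn σ (Q.D s τ) (Q.D s h)) =o[𝓝[>] 0]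
      fun s : ℝ => s ^ (m - 1)) :
    ∃ C, 0 ≤ C ∧ ∀ τ, ‖τ‖ ≤ R → ∀ h, ∀ s ∈ Icc (0 : ℝ) 1,
      ‖Q.form conn σ (Q.D s τ) (Q.D s h)‖ ≤ C * s ^ m * ‖h‖ := by
  have hK : IsCompact (Metric.closedBall (0 : W) R ×ˢ Metric.closedBall (0 : W) 1) :=
    (isCompact_closedBall _ _).prod (isCompact_closedBall _ _)
  obtain ⟨C, hC0, hC⟩ : ∃ C, 0 ≤ C ∧
      ∀ v ∈ Metric.closedBall (0 : W) R ×ˢ Metric.closedBall (0 : W) 1,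
        ∀ s ∈ Icc (0 : ℝ) 1, ‖Q.form conn σ (Q.D s v.1) (Q.D s v.2)‖ ≤ C * s ^ m := by
    -- For m = 0 compactness alone gives the bound. For larger m the hypothesis o(s^(m-1)) improves
    -- to O(s^m) by smoothness.
    rcases m with _ | m
    · obtain ⟨C, hC⟩ := ((isCompact_Icc (a := (0 : ℝ)) (b := 1)).prod hK).exists_bound_of_continuousOn
        (Q.contDiff_form_comp hσ).continuous.continuousOn
      refine ⟨|C|, abs_nonneg C, fun v hv s hs => ?_⟩
      rw [pow_zero, mul_one]
      exact (hC (s, v) ⟨hs, hv⟩).trans (le_abs_self C)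
    · exact exists_norm_le_pow_of_isLittleO (Q.contDiff_form_comp hσ) hK m fun v _ =>
        (h.resolve_left (by omega)) v.1 v.2
  refine ⟨C, hC0, fun τ hτ h s hs => ?_⟩
  have h0 : 0 ≤ C * s ^ m := mul_nonneg hC0 (pow_nonneg hs.1 m)
  refine ContinuousLinearMap.le_of_opNorm_le ((Q.form conn σ (Q.D s τ)).comp (Q.D s))
    (ContinuousLinearMap.opNorm_le_of_unit_norm h0 fun v hv => ?_) h
  exact hC (τ, v) ⟨by simpa using hτ, by simpa using hv.le⟩ s hs

variable [FiniteDimensional ℝ EP] [LieGroup 𝓘(ℝ, EG) ∞ G] [CompleteSpace EG]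

/-- Along the dilations, the derivative of the connection form is the curvature. -/
theorem hasDerivAt_form (hσ : conn.IsRadialGauge δ σ) {s : ℝ} (hs : 0 < s) (τ h : W) :
    HasDerivAt (fun s => Q.form conn σ (Q.D s τ) (Q.D s h))
      (conn.pullCurv σ (Q.κ (Q.D s τ)) (md W EM Q.κ (Q.D s τ) (s⁻¹ • Q.gen (Q.D s τ)))
        (md W EM Q.κ (Q.D s τ) (Q.D s h))) s := by
  set w := Q.D s τ with hw
  set A := Q.form conn σ with hA
  have hAd : ∀ w, HasFDerivAt A (fderiv ℝ A w) w := fun w =>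
    ((Q.contDiff_form hσ).differentiable (by simp) w).hasFDerivAt
  -- Differentiating A_w(gen w) = 0 in the direction v. This identity trades the derivative of D_s h
  -- for the missing half of dA; the bracket term vanishes because A(S) = 0.
  have hrad : ∀ v, fderiv ℝ A w v (Q.gen w) + A w (Q.gen v) = 0 := by
    intro v
    have h1 := (hAd w).clm_apply Q.gen.hasFDerivAt
    have h2 : HasFDerivAt (fun w => A w (Q.gen w)) (0 : W →L[ℝ] EG) w := by
      simp only [hA, Q.form_gen hσ]
      exact hasFDerivAt_const _ _
    have := DFunLike.congr_fun (h1.unique h2) v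
    simpa [add_comm] using this
  rw [conn.pullCurv_md hσ.1 (Q.hasMD_κ w),
    conn.curvature_md isOpen_univ (Q.contMDiff_comp_κ hσ).contMDiffOn (mem_univ w)]
  have h1 : HasDerivAt (fun s => A (Q.D s τ)) (fderiv ℝ A w (s⁻¹ • Q.gen (Q.D s τ))) s :=
    (hAd w).comp_hasDerivAt s (Q.hasDerivAt_D_apply hs τ)
  refine (h1.clm_apply (Q.hasDerivAt_D_apply hs h)).congr_deriv ?_
  have h2 : conn.pullForm (fun τ => σ (Q.κ τ)) w (s⁻¹ • Q.gen w) = 0 := by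
    rw [map_smul]
    have := Q.form_gen hσ w
    rw [form] at this
    rw [this, smul_zero]
  rw [h2, zero_lieBracketModel, add_zero]
  have h4 : ∀ v, fderiv ℝ A w v (s⁻¹ • Q.gen w) = - (s⁻¹ • A w (Q.gen v)) := by
    intro v
    have h5 := hrad v
    rw [add_eq_zero_iff_eq_neg] at h5
    rw [map_smul, h5, smul_neg]
  show _ = fderiv ℝ A w (s⁻¹ • Q.gen w) (Q.D s h) - fderiv ℝ A w (Q.D s h) (s⁻¹ • Q.gen w)
  rw [h4, sub_neg_eq_add, ← map_smul (A w)]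

/-- The integral of the curvature over the rays is the connection form. -/
theorem integral_pullCurv (hσ : conn.IsRadialGauge δ σ) (τ h : W) :
    ∫ s in (0 : ℝ)..1, conn.pullCurv σ (Q.κ (Q.D s τ))
      (md W EM Q.κ (Q.D s τ) (s⁻¹ • Q.gen (Q.D s τ))) (md W EM Q.κ (Q.D s τ) (Q.D s h)) =
      Q.form conn σ τ h := by
  set f := fun s => Q.form conn σ (Q.D s τ) (Q.D s h) with hf
  have hfc : ContDiff ℝ ∞ f := Q.contDiff_form_ray hσ τ h
  have h1 : ∀ s ∈ Ioo (0 : ℝ) 1, HasDerivAt f (deriv f s) s := fun s _ =>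
    (hfc.differentiable (by simp) s).hasDerivAt
  have h2 := intervalIntegral.integral_eq_sub_of_hasDerivAt_of_le zero_le_one
    hfc.continuous.continuousOn h1 ((hfc.continuous_deriv (by simp)).intervalIntegrable _ _)
  -- No boundary term at s = 0, since D 0 = 0.
  have h3 : f 1 - f 0 = Q.form conn σ τ h := by simp [hf, Q.D_one, Q.D_zero]
  rw [← h3, ← h2]
  refine intervalIntegral.integral_congr_ae (.of_forall fun s hs => ?_)
  rw [uIoc_of_le zero_le_one] at hs
  exact (Q.hasDerivAt_form hσ hs.1 τ h).deriv.symm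

/-- The connection form vanishes to order `m` if the curvature is of weight `≥ m + 1`. -/
theorem form_isLittleO_of_weight (hσ : conn.IsRadialGauge δ σ) {m : ℕ}
    (hm : IsOfWeightGE δ (conn.pullbackCurvature σ) (m + 1)) (τ h : W) :
    (fun s => Q.form conn σ (Q.D s τ) (Q.D s h)) =o[𝓝[>] 0] fun s : ℝ => s ^ m := by
  have hc := (Q.contDiff_form_ray hσ τ h).continuous
  have h0 : Q.form conn σ (Q.D 0 τ) (Q.D 0 h) = 0 := by simp [Q.D_zero]
  rcases m with _ | m
  · simp only [pow_zero, Asymptotics.isLittleO_one_iff]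
    have := (hc.tendsto 0).mono_left (nhdsWithin_le_nhds (s := Ioi 0))
    rwa [h0] at this
  · refine isLittleO_pow_succ_of_hasDerivAt hc.continuousAt h0
      (fun s hs => Q.hasDerivAt_form hσ hs τ h) ?_
    -- After the case split the curvature has weight ≥ m + 2, so k = m + 1 is admissible: δ_s^*Ω =
    -- o(s^(m+1)). The factor s⁻¹ in the derivative of the form costs one power, and integration
    -- restores it.
    have h1 := hm (m + 1) (by push_cast; omega) (Q.κ τ) (md W EM Q.κ τ (Q.gen τ))
      (md W EM Q.κ τ h)
    have h2 : ∀ s > 0, conn.pullCurv σ (δ s (Q.κ τ))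
        (md EM EM (δ s) (Q.κ τ) (md W EM Q.κ τ (Q.gen τ)))
        (md EM EM (δ s) (Q.κ τ) (md W EM Q.κ τ h)) =
        conn.pullCurv σ (Q.κ (Q.D s τ)) (md W EM Q.κ (Q.D s τ) (Q.gen (Q.D s τ)))
          (md W EM Q.κ (Q.D s τ) (Q.D s h)) := by
      intro s hs
      rw [Q.δ_κ s hs, Q.md_δ_κ hs, Q.md_δ_κ hs]
      have := DFunLike.congr_fun (Q.gen_comm s) τ
      simp only [ContinuousLinearMap.comp_apply] at this
      rw [this]
    -- The curvature is homogeneous in its radial argument: dA is bilinear and the bracket vanishes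
    -- there.
    have h3 : ∀ s, conn.pullCurv σ (Q.κ (Q.D s τ))
        (md W EM Q.κ (Q.D s τ) (s⁻¹ • Q.gen (Q.D s τ))) (md W EM Q.κ (Q.D s τ) (Q.D s h)) =
        s⁻¹ • conn.pullCurv σ (Q.κ (Q.D s τ)) (md W EM Q.κ (Q.D s τ) (Q.gen (Q.D s τ)))
          (md W EM Q.κ (Q.D s τ) (Q.D s h)) := by
      intro s
      rw [conn.pullCurv_md hσ.1 (Q.hasMD_κ _), conn.pullCurv_md hσ.1 (Q.hasMD_κ _),
        conn.curvature_md isOpen_univ (Q.contMDiff_comp_κ hσ).contMDiffOn (mem_univ _),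
        conn.curvature_md isOpen_univ (Q.contMDiff_comp_κ hσ).contMDiffOn (mem_univ _)]
      have h4 : conn.pullForm (fun τ => σ (Q.κ τ)) (Q.D s τ) (Q.gen (Q.D s τ)) = 0 :=
        Q.form_gen hσ _
      simp only [map_smul, h4, smul_zero, zero_lieBracketModel, smul_add, smul_sub,
        smul_apply]
    rw [Asymptotics.isLittleO_iff]
    intro ε hε
    have h4 := (Metric.tendsto_nhds.1 h1) ε hε
    filter_upwards [h4, self_mem_nhdsWithin] with s hs hs0
    rw [mem_Ioi] at hs0
    have hs' : ‖s ^ (-((m : ℤ) + 1)) • conn.pullCurv σ (δ s (Q.κ τ))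
        (md EM EM (δ s) (Q.κ τ) (md W EM Q.κ τ (Q.gen τ)))
        (md EM EM (δ s) (Q.κ τ) (md W EM Q.κ τ h))‖ < ε := by
      rw [dist_zero_right] at hs
      exact hs
    rw [h2 s hs0, norm_smul, norm_zpow, Real.norm_of_nonneg hs0.le, zpow_neg,
      inv_mul_lt_iff₀ (by positivity)] at hs'
    rw [h3, norm_smul, norm_inv, norm_pow, Real.norm_of_nonneg hs0.le,
      inv_mul_le_iff₀ hs0]
    have h5 : s ^ ((m : ℤ) + 1) = s ^ m * s := by
      rw [← pow_succ]; exact_mod_cast zpow_natCast s (m + 1)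
    rw [h5] at hs'
    linarith

end DilationChart

end DilationChart

/-! ### Rescaling of short loops and the general holonomy expansion -/

section DilationChartHolonomy

variable {EM : Type*} {M : Type*} [NormedAddCommGroup EM] [NormedSpace ℝ EM]
  [TopologicalSpace M] [ChartedSpace EM M]
  {W : Type*} [NormedAddCommGroup W] [NormedSpace ℝ W] [FiniteDimensional ℝ W]
  {x : M} {δ : ℝ → M → M} {d : M → M → ℝ≥0∞}
  {EG G EP P : Type*} [NormedAddCommGroup EG] [NormedSpace ℝ EG] [FiniteDimensional ℝ EG]
  [TopologicalSpace G] [ChartedSpace EG G] [Group G] [LieGroup 𝓘(ℝ, EG) ∞ G]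
  [NormedAddCommGroup EP] [NormedSpace ℝ EP] [TopologicalSpace P] [ChartedSpace EP P]
  [IsManifold 𝓘(ℝ, EP) ∞ P] [FiniteDimensional ℝ EP] [IsManifold 𝓘(ℝ, EM) ∞ M]
  {B : PrincipalBundle EG G EP P EM M} {conn : PrincipalConnection B} {σ : M → P}

namespace DilationChart

variable (Q : DilationChart EM W x δ d)

/-- A short loop is the dilation of a loop of bounded size in the coordinates. -/
theorem exists_rescaled {γ : ℝ → M} (hγ : IsLoopAt EM x γ) {s : ℝ} (hs : s ∈ Ioc (0 : ℝ) 1)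
    (hl : metricLength d γ < ENNReal.ofReal (s * Q.radius)) :
    ∃ y : ℝ → W, IsAbsContCurve W y ∧ (∀ t ∈ Icc (0 : ℝ) 1, γ t = Q.κ (Q.D s (y t))) ∧
      (∀ t ∈ Icc (0 : ℝ) 1, ‖y t‖ ≤ Q.lip * Q.radius) ∧
      ∫ t in (0 : ℝ)..1, ‖deriv y t‖ ≤ Q.lip / s * (metricLength d γ).toReal := by
  have : CompleteSpace W := FiniteDimensional.complete ℝ W
  have hs' : 0 < s⁻¹ := inv_pos.2 hs.1
  have hd : ∀ t ∈ Icc (0 : ℝ) 1, d x (γ t) < ENNReal.ofReal (s * Q.radius) := by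
    intro t ht
    have := le_metricLength (d := d) (γ := γ) (by rw [hγ.2.1, Q.d_self])
      (by rw [hγ.2.1, hγ.2.2]) ht
    rw [hγ.2.1] at this
    exact this.trans_lt hl
  have hd1 : ∀ t ∈ Icc (0 : ℝ) 1, d x (γ t) < ENNReal.ofReal Q.radius := fun t ht =>
    (hd t ht).trans_le (ENNReal.ofReal_le_ofReal (mul_le_of_le_one_left Q.radius_pos.le hs.2))
  have hd2 : ∀ t ∈ Icc (0 : ℝ) 1, d x (δ s⁻¹ (γ t)) < ENNReal.ofReal Q.radius := by
    intro t ht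
    have h1 := Q.d_δ s⁻¹ hs' x (γ t)
    rw [Q.δ_x hs'] at h1
    refine h1.trans_lt ?_
    have h2 : ENNReal.ofReal Q.radius = ENNReal.ofReal s⁻¹ * ENNReal.ofReal (s * Q.radius) := by
      rw [← ENNReal.ofReal_mul hs'.le, ← mul_assoc, inv_mul_cancel₀ hs.1.ne', one_mul]
    rw [h2]
    exact (ENNReal.mul_lt_mul_iff_right (ENNReal.ofReal_pos.2 hs').ne' ENNReal.ofReal_ne_top).2
      (hd t ht)
  -- Dilating γ by 1/s keeps it in the coordinate ball, since d(x, γ(t)) < s · radius, and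
  -- multiplies distances by at most 1/s.
  set y : ℝ → W := fun t => Q.coord (δ s⁻¹ (γ t)) with hy
  have hx : d x x < ENNReal.ofReal Q.radius := by
    rw [Q.d_self]; exact ENNReal.ofReal_pos.2 Q.radius_pos
  have hlip : ∀ a ∈ Icc (0 : ℝ) 1, ∀ b ∈ Icc (0 : ℝ) 1,
      edist (y a) (y b) ≤ ENNReal.ofReal (Q.lip / s) * d (γ a) (γ b) := by
    intro a ha b hb
    refine (Q.coord_lipschitz _ _ (hd2 a ha) (hd2 b hb)).trans ?_
    rw [div_eq_mul_inv, ENNReal.ofReal_mul Q.lip_pos.le, mul_assoc]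
    gcongr
    exact Q.d_δ _ hs' _ _
  have hvar := eVariationOn_le_mul_metricLength hlip
  have htop : ENNReal.ofReal (Q.lip / s) * metricLength d γ ≠ ⊤ :=
    ENNReal.mul_ne_top ENNReal.ofReal_ne_top (ne_top_of_lt hl)
  refine ⟨y, ?_, ?_, ?_, ?_⟩
  · exact hγ.1.comp (H := fun z => Q.coord (δ s⁻¹ z)) fun t ht =>
      (Q.contMDiffAt_coord _ (hd2 t ht)).comp (γ t) (Q.contMDiff_δ _ hs' _)
  · intro t ht
    have h1 := Q.κ_coord _ (hd2 t ht)
    have h2 := Q.κ_coord _ (hd1 t ht)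
    rw [← Q.δ_κ s hs.1, hy]
    dsimp only
    rw [h1]
    -- The relation δ_s ∘ δ_{1/s} = id is available on the image of κ only, so γ(t) is first written
    -- as a value of κ.
    conv_rhs => rw [← h2, Q.δ_κ _ hs', Q.δ_κ _ hs.1]
    rw [← ContinuousLinearMap.comp_apply, ← Q.D_mul, mul_inv_cancel₀ hs.1.ne', Q.D_one,
      ContinuousLinearMap.id_apply, h2]
  · intro t ht
    have h1 := Q.coord_lipschitz _ _ hx (hd2 t ht)
    rw [Q.coord_self, edist_comm, edist_zero_right] at h1
    have h2 : ‖y t‖ₑ ≤ ENNReal.ofReal (Q.lip * Q.radius) := by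
      refine h1.trans ?_
      rw [ENNReal.ofReal_mul Q.lip_pos.le]
      gcongr
      exact (hd2 t ht).le
    rw [← ofReal_norm] at h2
    exact (ENNReal.ofReal_le_ofReal_iff (mul_pos Q.lip_pos Q.radius_pos).le).1 h2
  · have h1 : BoundedVariationOn y (Icc 0 1) := ne_top_of_le_ne_top htop hvar
    refine (h1.intervalIntegrable_deriv_and_integral_le zero_le_one).2.trans ?_
    refine (ENNReal.toReal_mono htop hvar).trans_eq ?_
    rw [ENNReal.toReal_mul, ENNReal.toReal_ofReal (div_pos Q.lip_pos hs.1).le]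

theorem formAt_vel_eq (hσ : conn.IsRadialGauge δ σ) {γ : ℝ → M} {y : ℝ → W} {t : ℝ}
    (h : γ =ᶠ[𝓝 t] fun r => Q.κ (y r)) (hy : DifferentiableAt ℝ y t) :
    conn.formAt (σ (γ t)) (vel EP (fun r => σ (γ r)) t) =
      Q.form conn σ (y t) (deriv y t) := by
  have h1 : (fun r => σ (γ r)) =ᶠ[𝓝 t] fun r => σ (Q.κ (y r)) := h.fun_comp σ
  rw [vel_congr h1, h.eq_of_nhds, MDifferentiableAt.vel_comp (B := md W EP (fun τ => σ (Q.κ τ)) (y t))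
    (g := fun τ => σ (Q.κ τ)) ((Q.contMDiff_comp_κ hσ) (y t)).hasMD
    (mdifferentiableAt_iff_differentiableAt.2 hy), vel_eq_deriv]
  rfl

/-- With γ = κ(D_s y), the integrand is A(D_s y)(D_s y'), bounded by K s^m ‖y'‖, and ∫‖y'‖ is at
most lip · ℓ / s. For s proportional to ℓ the total is O(ℓ^m). The disk integral equals ∫A(γ')
because its inner integral over each ray is the form itself. -/
theorem form_estimate (hσ : conn.IsRadialGauge δ σ) {m : ℕ} {K : ℝ} (hK0 : 0 ≤ K)
    (hK : ∀ τ, ‖τ‖ ≤ Q.lip * Q.radius → ∀ h, ∀ s ∈ Icc (0 : ℝ) 1,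
      ‖Q.form conn σ (Q.D s τ) (Q.D s h)‖ ≤ K * s ^ m * ‖h‖)
    {γ : ℝ → M} (hγ : IsLoopAt EM x γ) {s : ℝ} (hs : s ∈ Ioc (0 : ℝ) 1)
    (hl : metricLength d γ < ENNReal.ofReal (s * Q.radius)) :
    IntegrableOn (fun t => conn.formAt (σ (γ t)) (vel EP (fun r => σ (γ r)) t)) (Ioc 0 1) ∧
      ∫ t in (0 : ℝ)..1, ‖conn.formAt (σ (γ t)) (vel EP (fun r => σ (γ r)) t)‖ ≤
        K * s ^ m * (Q.lip / s * (metricLength d γ).toReal) ∧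
      diskIntegral δ (conn.pullbackCurvature σ) γ =
        ∫ t in (0 : ℝ)..1, conn.formAt (σ (γ t)) (vel EP (fun r => σ (γ r)) t) := by
  have : CompleteSpace EG := FiniteDimensional.complete ℝ EG
  obtain ⟨y, hyac, hyγ, hyb, hyi⟩ := Q.exists_rescaled hγ hs hl
  set a := fun t => conn.formAt (σ (γ t)) (vel EP (fun r => σ (γ r)) t) with ha
  have hev : ∀ t ∈ Ioo (0 : ℝ) 1, γ =ᶠ[𝓝 t] fun r => Q.κ (Q.D s (y r)) := fun t ht => by
    filter_upwards [Icc_mem_nhds ht.1 ht.2] with r hr using hyγ r hr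
  have hder : ∀ {t}, DifferentiableAt ℝ y t →
      HasDerivAt (fun r => Q.D s (y r)) (Q.D s (deriv y t)) t := fun h =>
    (Q.D s).hasFDerivAt.comp_hasDerivAt _ h.hasDerivAt
  have hae : ∀ᵐ t ∂(volume.restrict (Ioc (0 : ℝ) 1)), t ∈ Ioo (0 : ℝ) 1 ∧
      DifferentiableAt ℝ y t := by
    rw [restrict_Ioc_eq_restrict_Icc]
    filter_upwards [ae_mem_Ioo_zero_one, hyac.ae_mdifferentiableAt] with t h1 h2
    exact ⟨h1, mdifferentiableAt_iff_differentiableAt.1 h2⟩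
  have haf : a =ᵐ[volume.restrict (Ioc (0 : ℝ) 1)]
      fun t => Q.form conn σ (Q.D s (y t)) (Q.D s (deriv y t)) := by
    filter_upwards [hae] with t ht
    rw [ha]
    dsimp only
    rw [Q.formAt_vel_eq hσ (hev t ht.1) (hder ht.2).differentiableAt, (hder ht.2).deriv]
  have hdi : IntegrableOn (deriv y) (Ioc 0 1) :=
    (intervalIntegrable_iff_integrableOn_Ioc_of_le zero_le_one).1 hyac.integral_deriv.1
  have hle : ∀ᵐ t ∂(volume.restrict (Ioc (0 : ℝ) 1)), ‖a t‖ ≤ K * s ^ m * ‖deriv y t‖ := by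
    filter_upwards [haf, hae] with t h1 h2
    rw [h1]
    exact hK _ (hyb t (Ioo_subset_Icc_self h2.1)) _ s ⟨hs.1.le, hs.2⟩
  have hmeas : AEStronglyMeasurable a (volume.restrict (Ioc (0 : ℝ) 1)) := by
    refine AEStronglyMeasurable.congr ?_ haf.symm
    have h1 : ContinuousOn (fun t => Q.form conn σ (Q.D s (y t))) (Ioc 0 1) :=
      ((Q.contDiff_form hσ).continuous.comp (Q.D s).continuous).comp_continuousOn
        (hyac.1.mono Ioc_subset_Icc_self)
    exact ContinuousLinearMap.aestronglyMeasurable_comp₂ (ContinuousLinearMap.id ℝ (W →L[ℝ] EG))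
      (h1.aestronglyMeasurable measurableSet_Ioc)
      ((Q.D s).continuous.comp_aestronglyMeasurable hdi.aestronglyMeasurable)
  have hbi : IntegrableOn (fun t => K * s ^ m * ‖deriv y t‖) (Ioc 0 1) := hdi.norm.const_mul _
  have hai : IntegrableOn a (Ioc 0 1) := Integrable.mono' hbi hmeas hle
  refine ⟨hai, ?_, ?_⟩
  · rw [intervalIntegral.integral_of_le zero_le_one] at hyi ⊢
    refine (integral_mono_ae hai.norm hbi hle).trans ?_
    rw [integral_const_mul]
    have := hs.1
    gcongr
  · rw [diskIntegral, intervalIntegral.integral_of_le zero_le_one,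
      intervalIntegral.integral_of_le zero_le_one]
    refine integral_congr_ae ?_
    filter_upwards [hae, haf] with t ht h1
    refine Eq.trans ?_ h1.symm
    rw [← Q.integral_pullCurv hσ]
    refine intervalIntegral.integral_congr_ae (.of_forall fun r hr => ?_)
    rw [uIoc_of_le zero_le_one] at hr
    have h2 := Q.vel_δ_comp γ (fun r => Q.D s (y r)) (hev t ht.1) (hder ht.2).differentiableAt hr.1
    have h3 := Q.vel_δ_κ hr.1 (Q.D s (y t))
    have h4 := hyγ t (Ioo_subset_Icc_self ht.1)
    rw [(hder ht.2).deriv] at h2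
    show conn.pullCurv σ (δ r (γ t)) (vel EM (fun u => δ u (γ t)) r)
      (vel EM (fun u => δ r (γ u)) t) = _
    rw [h2, h4, h3, Q.δ_κ r hr.1]

/-- The holonomy expansion on a space with dilations. -/
theorem holonomyExpansion [T2Space G] [FiniteDimensional ℝ EM] (hσ : conn.IsRadialGauge δ σ) {m : ℕ}
    (h : m = 0 ∨ ∀ τ h, (fun s => Q.form conn σ (Q.D s τ) (Q.D s h)) =o[𝓝[>] 0]
      fun s : ℝ => s ^ (m - 1)) :
    HolonomyExpansion conn x (σ x) (metricLength d)
      (diskIntegral δ (conn.pullbackCurvature σ)) (2 * m) := by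
  obtain ⟨K, hK0, hK⟩ := Q.exists_form_le hσ (Q.lip * Q.radius) h
  obtain ⟨ε₀, hε₀, C, hC, hol⟩ := exists_holonomy_expansion EG G
  have hr := Q.radius_pos
  have hlip := Q.lip_pos
  -- `A` bounds the integral of the form by `A ℓ ^ m` (and by `A ℓ` if `m = 0`)
  set A := K * Q.lip * (2 / Q.radius) ^ (m - 1) with hA
  have hA0 : 0 ≤ A := by positivity
  -- The bounds serve, in order, for a dilation factor at most 1, for L^m ≤ L when m ≥ 1, and for
  -- the smallness required on the group.
  set ε := min (min (Q.radius / 2) 1) (ε₀ / (A + 1)) with hε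
  have hε0 : 0 < ε := by positivity
  refine ⟨ε, hε0, C * (A + 1) ^ 2, by positivity, fun γ hγ hlen => ?_⟩
  set L := (metricLength d γ).toReal with hL
  have hL0 : 0 ≤ L := ENNReal.toReal_nonneg
  have hLtop : metricLength d γ ≠ ⊤ := ne_top_of_lt hlen
  have hLε : L < ε := (ENNReal.lt_ofReal_iff_toReal_lt hLtop).1 hlen
  have hL1 : L < Q.radius / 2 := hLε.trans_le ((min_le_left _ _).trans (min_le_left _ _))
  have hL2 : L < 1 := hLε.trans_le ((min_le_left _ _).trans (min_le_right _ _))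
  have hL3 : L ≤ ε₀ / (A + 1) := hLε.le.trans (min_le_right _ _)
  obtain ⟨hI, hle1, hle2, hF⟩ : IntegrableOn
      (fun t => conn.formAt (σ (γ t)) (vel EP (fun r => σ (γ r)) t)) (Ioc 0 1) ∧
      ∫ t in (0 : ℝ)..1, ‖conn.formAt (σ (γ t)) (vel EP (fun r => σ (γ r)) t)‖ ≤ A * L ^ m ∧
      ∫ t in (0 : ℝ)..1, ‖conn.formAt (σ (γ t)) (vel EP (fun r => σ (γ r)) t)‖ ≤ A * L ∧
      diskIntegral δ (conn.pullbackCurvature σ) γ =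
        ∫ t in (0 : ℝ)..1, conn.formAt (σ (γ t)) (vel EP (fun r => σ (γ r)) t) := by
    -- Without positive length or without decay there is nothing to rescale, and s = 1 suffices.
    by_cases hcase : m = 0 ∨ L = 0
    · obtain ⟨h1, h2, h3⟩ := Q.form_estimate hσ hK0 hK hγ (s := 1) ⟨one_pos, le_rfl⟩
        ((ENNReal.lt_ofReal_iff_toReal_lt hLtop).2 (by rw [one_mul]; linarith))
      rw [one_pow, mul_one, div_one, ← hL] at h2
      have h4 : K * (Q.lip * L) ≤ A * L := by
        rcases hcase with rfl | h0
        · rw [hA]; simp [mul_assoc]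
        · simp [h0]
      refine ⟨h1, ?_, h2.trans h4, h3⟩
      rcases hcase with rfl | h0
      · refine (h2.trans h4).trans ?_
        rw [pow_zero]
        gcongr
      · refine h2.trans ?_
        rw [h0, mul_zero, mul_zero]
        positivity
    · rw [not_or] at hcase
      have hLpos : 0 < L := lt_of_le_of_ne hL0 (Ne.symm hcase.2)
      obtain ⟨n, rfl⟩ := Nat.exists_eq_succ_of_ne_zero hcase.1
      -- The factor 2 makes the inequality L < s · radius = 2L strict.
      have hs : 2 * L / Q.radius ∈ Ioc (0 : ℝ) 1 :=
        ⟨by positivity, by rw [div_le_one hr]; linarith⟩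
      obtain ⟨h1, h2, h3⟩ := Q.form_estimate hσ hK0 hK hγ hs
        ((ENNReal.lt_ofReal_iff_toReal_lt hLtop).2 (by
          rw [div_mul_cancel₀ _ hr.ne']; linarith))
      have h4 : K * (2 * L / Q.radius) ^ (n + 1) * (Q.lip / (2 * L / Q.radius) * L) =
          A * L ^ (n + 1) := by
        rw [hA, Nat.succ_eq_add_one, Nat.add_sub_cancel]
        have : 2 * L / Q.radius = 2 / Q.radius * L := by ring
        rw [this, mul_pow, pow_succ (2 / Q.radius), pow_succ L]
        field_simp
      rw [← hL, Nat.succ_eq_add_one, h4] at h2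
      refine ⟨h1, h2, h2.trans ?_, h3⟩
      refine mul_le_mul_of_nonneg_left ?_ hA0
      exact pow_le_of_le_one hL0 hL2.le (by omega)
  obtain ⟨X, hX1, hX2⟩ := hol conn hσ.1 hσ.2.1 hγ hI (hle2.trans (by
    rw [le_div_iff₀ (by positivity)] at hL3
    nlinarith))
  refine ⟨X, hX1, ?_⟩
  rw [hF]
  refine hX2.trans ?_
  rw [mul_assoc, mul_comm 2 m, pow_mul, ← mul_pow]
  have h0 : 0 ≤ ∫ t in (0 : ℝ)..1, ‖conn.formAt (σ (γ t)) (vel EP (fun r => σ (γ r)) t)‖ :=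
    intervalIntegral.integral_nonneg zero_le_one fun _ _ => norm_nonneg _
  have h1 : A * L ^ m ≤ (A + 1) * L ^ m := by gcongr; linarith
  gcongr
  exact hle1.trans h1

end DilationChart

end DilationChartHolonomy

/-! ### Horizontal lifts of vectors and covariant derivatives -/

section HorizontalVectors

variable {EG G EP P EM M : Type*}
  [NormedAddCommGroup EG] [NormedSpace ℝ EG]
  [TopologicalSpace G] [ChartedSpace EG G] [Group G] [LieGroup 𝓘(ℝ, EG) ∞ G]
  [NormedAddCommGroup EP] [NormedSpace ℝ EP] [TopologicalSpace P] [ChartedSpace EP P]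
  [NormedAddCommGroup EM] [NormedSpace ℝ EM] [TopologicalSpace M] [ChartedSpace EM M]
  [IsManifold 𝓘(ℝ, EP) ∞ P] {B : PrincipalBundle EG G EP P EM M}
  (conn : PrincipalConnection B) {σ : M → P}

theorem fderiv_clm_eq_zero_of_eventually_eq {W F : Type*} [NormedAddCommGroup W] [NormedSpace ℝ W]
    [NormedAddCommGroup F] [NormedSpace ℝ F] {A : W → W →L[ℝ] F} {w u v : W}
    (hA : DifferentiableAt ℝ A w) (h : ∀ᶠ r in 𝓝 (0 : ℝ), A (w + r • u) v = A w v) :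
    fderiv ℝ A w u v = 0 := by
  have h1 : HasDerivAt (fun r : ℝ => w + r • u) u 0 := by
    simpa using ((hasDerivAt_id (0 : ℝ)).smul_const u).const_add w
  have h2 : HasFDerivAt A (fderiv ℝ A w) (w + (0 : ℝ) • u) := by simpa using hA.hasFDerivAt
  have h3 : HasDerivAt (fun r : ℝ => A (w + r • u)) (fderiv ℝ A w u) 0 :=
    h2.comp_hasDerivAt (0 : ℝ) h1
  have h4 := (h3.clm_apply (hasDerivAt_const (0 : ℝ) v)).congr_of_eventuallyEq
    (f₁ := fun _ => A w v) (by filter_upwards [h] with r hr using hr.symm)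
  simpa using h4.unique (hasDerivAt_const (0 : ℝ) (A w v))

namespace PrincipalConnection

/-- Differentiate p = σ(π(p))·τ(p) along w: only the group factor moves, so w is a fundamental
vector, and ω recovers its generator. -/
theorem eq_vertical_of_md_proj_eq_zero (hσ : ContMDiff 𝓘(ℝ, EM) 𝓘(ℝ, EP) ∞ σ)
    (hσp : ∀ y, B.proj (σ y) = y) {p : P} {w : EP} (hw : md EP EM B.proj p w = 0) :
    w = md EG EP (fun a : G => B.act p a) 1 (conn.formAt p w) := by
  obtain ⟨τ, hτ, hτa⟩ := B.exists_division hσ hσp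
  have h1 : HasMD EP EM B.proj p (md EP EM B.proj p) := (B.contMDiff_proj p).hasMD
  have h2 := (hσ (B.proj p)).hasMD.comp h1
  have h3 := HasMD.comp₂ (H := fun q : P × G => B.act q.1 q.2)
    ((B.contMDiffAt_act (σ (B.proj p), τ p)).mdifferentiableAt (by simp)) h2 (hτ p).hasMD
  have h4 := DFunLike.congr_fun ((h3.congr (f₁ := fun y => y)
    (.of_forall fun q => (hτa q).symm)).unique hasMD_id) w
  simp only [add_apply, ContinuousLinearMap.comp_apply, hw, map_zero, zero_add,
    ContinuousLinearMap.id_apply] at h4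
  rw [B.md_act_right, hτa] at h4
  have h5 : w = md EG EP (fun a : G => B.act p a) 1 (md EG EG (fun b : G => (τ p)⁻¹ * b) (τ p)
    (md EP EG τ p w)) := h4.symm
  have h6 := conn.formAt_vertical p (md EG EG (fun b : G => (τ p)⁻¹ * b) (τ p)
    (md EP EG τ p w))
  rw [← h5] at h6
  rw [h6, ← h5]

/-- The difference of two candidates is vertical and annihilated by ω, hence 0. This pins down the
vector selected by choice. -/
theorem horizontalLift_eq {V : Type*} [NormedAddCommGroup V] [NormedSpace ℝ V]
    {B : PrincipalBundle EG G EP P V V} (conn : PrincipalConnection B) {σ : V → P}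
    (hσ : ContMDiff 𝓘(ℝ, V) 𝓘(ℝ, EP) ∞ σ)
    (hσp : ∀ y, B.proj (σ y) = y) {p : P} {u : EP} {v : V} (hu : md EP V B.proj p u = v)
    (h0 : conn.formAt p u = 0) : conn.horizontalLift p v = u := by
  have h : ∃ u : TangentSpace 𝓘(ℝ, EP) p,
      mfderiv 𝓘(ℝ, EP) 𝓘(ℝ, V) B.proj p u = v ∧ conn.form p u = 0 := ⟨u, hu, h0⟩
  refine (dif_pos h : conn.horizontalLift p v = h.choose).trans ?_
  obtain ⟨h1, h2⟩ := h.choose_spec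
  set u' : EP := h.choose with hu'
  have h1' : md EP V B.proj p u' = v := h1
  have h2' : conn.formAt p u' = 0 := h2
  have h3 := conn.eq_vertical_of_md_proj_eq_zero hσ hσp (p := p) (w := u' - u)
    (by rw [map_sub, h1', hu, sub_self])
  rw [map_sub, h2', h0, sub_self, map_zero] at h3
  exact sub_eq_zero.1 h3

variable [FiniteDimensional ℝ EP] [FiniteDimensional ℝ EG]

theorem md_extChartAt_symm_self (p : P) :
    md EP EP (extChartAt 𝓘(ℝ, EP) p).symm (extChartAt 𝓘(ℝ, EP) p p) =
      ContinuousLinearMap.id ℝ EP := by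
  ext v
  have := md_extChartAt_symm_comp (E := EP) (mem_extChartAt_source (I := 𝓘(ℝ, EP)) p) v
  rwa [md_extChartAt_self] at this

/-- A horizontal argument removes the bracket, which leaves an expression linear in v. -/
theorem curvature_eq_of_horizontal {p : P} {u : EP} (hu : conn.formAt p u = 0) (v : EP) :
    conn.curvature p u v =
      fderiv ℝ (conn.pullForm (extChartAt 𝓘(ℝ, EP) p).symm) (extChartAt 𝓘(ℝ, EP) p p) u v -
      fderiv ℝ (conn.pullForm (extChartAt 𝓘(ℝ, EP) p).symm) (extChartAt 𝓘(ℝ, EP) p p) v u := by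
  have : CompleteSpace EG := FiniteDimensional.complete ℝ EG
  have h := conn.curvature_md (isOpen_extChartAt_target p) (contMDiffOn_extChartAt_symm p)
    (mem_extChartAt_target (I := 𝓘(ℝ, EP)) p) u v
  have h1 : conn.pullForm (extChartAt 𝓘(ℝ, EP) p).symm (extChartAt 𝓘(ℝ, EP) p p) u = 0 := by
    rw [conn.pullForm_apply, md_extChartAt_symm_self, extChartAt_to_inv]; exact hu
  rw [h1, zero_lieBracketModel, add_zero, md_extChartAt_symm_self, extChartAt_to_inv] at h
  exact h

/-- The curvature is horizontal. -/
theorem curvature_horizontal_vertical {p : P} {u : EP} (hu : conn.formAt p u = 0) (A : EG) :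
    conn.curvature p u (md EG EP (fun a : G => B.act p a) 1 A) = 0 := by
  have : CompleteSpace EG := FiniteDimensional.complete ℝ EG
  set φ := extChartAt 𝓘(ℝ, EP) p with hφ
  set c := extChartAt 𝓘(ℝ, EG) (1 : G) with hc
  set Q : EP × EG → P := fun q => B.act (φ.symm q.1) (c.symm q.2) with hQ
  have hO : IsOpen (φ.target ×ˢ c.target) :=
    (isOpen_extChartAt_target p).prod (isOpen_extChartAt_target (1 : G))
  have hQs : ContMDiffOn 𝓘(ℝ, EP × EG) 𝓘(ℝ, EP) ∞ Q (φ.target ×ˢ c.target) := by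
    intro q hq
    refine ContMDiffAt.contMDiffWithinAt ?_
    have e1 : ContMDiffAt 𝓘(ℝ, EP × EG) 𝓘(ℝ, EP) ∞ (fun q : EP × EG => φ.symm q.1) q :=
      ContMDiffAt.comp q (f := fun q : EP × EG => q.1) (contMDiffAt_extChartAt_symm hq.1)
        contDiff_fst.contMDiff.contMDiffAt
    have e2 : ContMDiffAt 𝓘(ℝ, EP × EG) 𝓘(ℝ, EG) ∞ (fun q : EP × EG => c.symm q.2) q :=
      ContMDiffAt.comp q (f := fun q : EP × EG => q.2) (contMDiffAt_extChartAt_symm hq.2)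
        contDiff_snd.contMDiff.contMDiffAt
    exact ContMDiffAt.comp q (g := fun q : P × G => B.act q.1 q.2)
      (B.contMDiffAt_act (φ.symm q.1, c.symm q.2)) (e1.prodMk e2)
  have hmem : (φ p, c 1) ∈ φ.target ×ˢ c.target :=
    ⟨mem_extChartAt_target p, mem_extChartAt_target (1 : G)⟩
  have hmd : ∀ q ∈ φ.target ×ˢ c.target, HasMD (EP × EG) EP Q q (md (EP × EG) EP Q q) :=
    fun q hq => (hQs.contMDiffAt (hO.mem_nhds hq)).hasMD
  have hl : ∀ q ∈ φ.target ×ˢ c.target, ∀ u : EP, md (EP × EG) EP Q q (u, 0) =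
      md EP EP (fun q' => B.act q' (c.symm q.2)) (φ.symm q.1) (md EP EP φ.symm q.1 u) := by
    intro q hq u
    have h1 := HasMD.comp_of_eq (hmd q hq) (hasMD_iff_hasFDerivAt.2 (hasFDerivAt_prodMk_left q.1 q.2))
      rfl
    have h2 := (B.hasMD_act_left (φ.symm q.1) (c.symm q.2)).comp
      (contMDiffAt_extChartAt_symm hq.1).hasMD
    exact DFunLike.congr_fun (h1.unique h2) u
  have hr : ∀ q ∈ φ.target ×ˢ c.target, ∀ A : EG, md (EP × EG) EP Q q (0, A) =
      md EG EP (fun a => B.act (φ.symm q.1) a) (c.symm q.2) (md EG EG c.symm q.2 A) := by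
    intro q hq A
    have h1 := HasMD.comp_of_eq (hmd q hq)
      (hasMD_iff_hasFDerivAt.2 (hasFDerivAt_prodMk_right q.1 q.2)) rfl
    have h2 := (B.hasMD_act_right (φ.symm q.1) (c.symm q.2)).comp
      (contMDiffAt_extChartAt_symm hq.2).hasMD
    exact DFunLike.congr_fun (h1.unique h2) A
  have e1 : φ.symm (φ p) = p := extChartAt_to_inv p
  have e2 : c.symm (c 1) = 1 := extChartAt_to_inv (1 : G)
  have hQp : Q (φ p, c 1) = p := by
    simp only [hQ, e1, e2, B.act_one]
  have hid : md EG EG c.symm (c 1) = ContinuousLinearMap.id ℝ EG := by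
    ext v
    have := md_extChartAt_symm_comp (E := EG) (mem_extChartAt_source (I := 𝓘(ℝ, EG)) (1 : G)) v
    rwa [md_extChartAt_self] at this
  have hact1 : md EP EP (fun q => B.act q (1 : G)) p = ContinuousLinearMap.id ℝ EP := by
    simp only [B.act_one]
    exact hasMD_id.md_eq
  have k1 : md (EP × EG) EP Q (φ p, c 1) (u, 0) = u := by
    rw [hl _ hmem]
    simp only [e1, e2]
    rw [hact1, hφ, md_extChartAt_symm_self]; rfl
  have k2 : md (EP × EG) EP Q (φ p, c 1) (0, A) = md EG EP (fun a : G => B.act p a) 1 A := by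
    rw [hr _ hmem]
    simp only [e1, e2]
    rw [hid]; rfl
  -- In the group direction the pulled back form is the Maurer–Cartan form, independent of the point
  -- of P.
  have f1 : ∀ q ∈ φ.target ×ˢ c.target, conn.pullForm Q q (0, A) =
      md EG EG (fun b : G => (c.symm q.2)⁻¹ * b) (c.symm q.2) (md EG EG c.symm q.2 A) := by
    intro q hq
    rw [conn.pullForm_apply, hr q hq]
    exact conn.formAt_md_act_right _ _ _
  -- Right translates of the horizontal vector u stay horizontal. With `f1`, both terms of the
  -- exterior derivative therefore vanish.
  have f2 : ∀ ζ ∈ c.target, conn.pullForm Q (φ p, ζ) (u, 0) = 0 := by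
    intro ζ hζ
    rw [conn.pullForm_apply, hl (φ p, ζ) ⟨hmem.1, hζ⟩, hφ, md_extChartAt_symm_self, ← hφ]
    refine (conn.formAt_md_act_left _ _ _).trans ?_
    rw [e1]
    exact (congrArg _ hu).trans (lieAd_zero _)
  have hd := conn.differentiableAt_pullForm hO hQs hmem
  have h := conn.curvature_md hO hQs hmem (u, 0) (0, A)
  rw [k1, k2, hQp, f2 _ hmem.2, zero_lieBracketModel, add_zero] at h
  rw [h]
  have hev : ∀ v : EP × EG, ∀ᶠ r in 𝓝 (0 : ℝ), (φ p, c 1) + r • v ∈ φ.target ×ˢ c.target := by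
    intro v
    have : Continuous fun r : ℝ => (φ p, c 1) + r • v := by fun_prop
    refine this.continuousAt.eventually (hO.mem_nhds ?_)
    simpa using hmem
  rw [fderiv_clm_eq_zero_of_eventually_eq hd, fderiv_clm_eq_zero_of_eventually_eq hd, sub_self]
  · filter_upwards [hev (0, A)] with r hr
    have e3 : (φ p, c 1) + r • ((0 : EP), A) = (φ p, c 1 + r • A) := by simp
    rw [e3] at hr ⊢
    rw [f2 _ hr.2, f2 _ hmem.2]
  · filter_upwards [hev (u, 0)] with r hr
    rw [f1 _ hr, f1 _ hmem]
    simp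

end PrincipalConnection

end HorizontalVectors

/-! ### Vector spaces: smooth horizontal lifts and covariant derivatives along rays -/

section EuclideanHolonomy

variable {EG G EP P V : Type*}
  [NormedAddCommGroup EG] [NormedSpace ℝ EG] [FiniteDimensional ℝ EG]
  [TopologicalSpace G] [ChartedSpace EG G] [Group G] [LieGroup 𝓘(ℝ, EG) ∞ G]
  [NormedAddCommGroup EP] [NormedSpace ℝ EP] [FiniteDimensional ℝ EP]
  [TopologicalSpace P] [ChartedSpace EP P] [IsManifold 𝓘(ℝ, EP) ∞ P]
  [NormedAddCommGroup V] [NormedSpace ℝ V] [FiniteDimensional ℝ V]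
  {B : PrincipalBundle EG G EP P V V} (conn : PrincipalConnection B) {σ : V → P}

namespace PrincipalConnection

/-- A local parametrization of curves in `P` with horizontal velocity at `0`. -/
theorem exists_horizontal_map (hσ : ContMDiff 𝓘(ℝ, V) 𝓘(ℝ, EP) ∞ σ)
    (hσp : ∀ y, B.proj (σ y) = y) (p : P) :
    ∃ (O : Set (EP × V)) (Q : EP × V → P), IsOpen O ∧
      ContMDiffOn 𝓘(ℝ, EP × V) 𝓘(ℝ, EP) ∞ Q O ∧
      ∀ z ∈ (extChartAt 𝓘(ℝ, EP) p).target, (z, (0 : V)) ∈ O ∧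
        Q (z, 0) = (extChartAt 𝓘(ℝ, EP) p).symm z ∧
        conn.formAt (Q (z, 0)) ∘ (fun v => md (EP × V) EP Q (z, 0) (0, v)) = 0 ∧
        ∀ v : V, md (EP × V) EP Q (z, 0) (0, v) =
          conn.horizontalLift ((extChartAt 𝓘(ℝ, EP) p).symm z) v := by
  obtain ⟨τ, hτ, hτa⟩ := B.exists_division hσ hσp
  set φ := extChartAt 𝓘(ℝ, EP) p with hφ
  set c := extChartAt 𝓘(ℝ, EG) (1 : G) with hc
  set A : V → V →L[ℝ] EG := conn.pullForm σ with hA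
  have hAs : ContDiff ℝ ∞ A :=
    contDiffOn_univ.1 (conn.contDiffOn_pullForm isOpen_univ hσ.contMDiffOn)
  set π : EP → V := fun z => B.proj (φ.symm z) with hπ
  have hπs : ContDiffOn ℝ ∞ π φ.target := by
    rw [← contMDiffOn_iff_contDiffOn]
    exact B.contMDiff_proj.comp_contMDiffOn (contMDiffOn_extChartAt_symm p)
  -- A group factor with velocity -A(v) at v = 0 cancels the connection form of σ(π z + v) to first
  -- order. So Q has horizontal velocity at v = 0 and exhibits the horizontal lift as the derivative
  -- of a smooth map.
  set ζ : EP × V → EG := fun q => c 1 - A (π q.1) q.2 with hζ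
  have hT : IsOpen (φ.target ×ˢ (univ : Set V)) := (isOpen_extChartAt_target p).prod isOpen_univ
  have hζs : ContDiffOn ℝ ∞ ζ (φ.target ×ˢ (univ : Set V)) :=
    contDiffOn_const.sub ((hAs.comp_contDiffOn (hπs.comp contDiffOn_fst fun q hq => hq.1)).clm_apply
      contDiffOn_snd)
  set O : Set (EP × V) := (φ.target ×ˢ (univ : Set V)) ∩ ζ ⁻¹' c.target with hO
  have hOo : IsOpen O := hζs.continuousOn.isOpen_inter_preimage hT (isOpen_extChartAt_target (1 : G))
  set Q : EP × V → P := fun q => B.act (σ (π q.1 + q.2)) (c.symm (ζ q) * τ (φ.symm q.1)) with hQ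
  have hQs : ContMDiffOn 𝓘(ℝ, EP × V) 𝓘(ℝ, EP) ∞ Q O := by
    intro q hq
    refine ContMDiffAt.contMDiffWithinAt ?_
    have e1 : ContMDiffAt 𝓘(ℝ, EP × V) 𝓘(ℝ, EP) ∞ (fun q : EP × V => φ.symm q.1) q :=
      ContMDiffAt.comp q (f := fun q : EP × V => q.1) (contMDiffAt_extChartAt_symm hq.1.1)
        contDiff_fst.contMDiff.contMDiffAt
    have e2 : ContMDiffAt 𝓘(ℝ, EP × V) 𝓘(ℝ, EG) ∞ (fun q => c.symm (ζ q)) q :=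
      ContMDiffAt.comp q (f := ζ) (contMDiffAt_extChartAt_symm hq.2)
        (hζs.contDiffAt (hT.mem_nhds hq.1)).contMDiffAt
    have e3 : ContMDiffAt 𝓘(ℝ, EP × V) 𝓘(ℝ, EG) ∞ (fun q : EP × V => τ (φ.symm q.1)) q :=
      ContMDiffAt.comp q (f := fun q : EP × V => φ.symm q.1) hτ.contMDiffAt e1
    have e4 : ContMDiffAt 𝓘(ℝ, EP × V) 𝓘(ℝ, V) ∞ (fun q : EP × V => π q.1 + q.2) q :=
      (ContDiffAt.add ((hπs.contDiffAt ((isOpen_extChartAt_target p).mem_nhds hq.1.1)).comp q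
        contDiffAt_fst) contDiffAt_snd).contMDiffAt
    have e5 : ContMDiffAt 𝓘(ℝ, EP × V) 𝓘(ℝ, EP) ∞ (fun q : EP × V => σ (π q.1 + q.2)) q :=
      ContMDiffAt.comp q (f := fun q : EP × V => π q.1 + q.2) hσ.contMDiffAt e4
    exact ContMDiffAt.comp q (g := fun q : P × G => B.act q.1 q.2)
      (B.contMDiffAt_act (σ (π q.1 + q.2), c.symm (ζ q) * τ (φ.symm q.1))) (e5.prodMk (e2.mul e3))
  refine ⟨O, Q, hOo, hQs, fun z hz => ?_⟩
  have ec : c.symm (c 1) = 1 := extChartAt_to_inv (1 : G)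
  have hζ0 : ζ (z, 0) = c 1 := by simp [hζ]
  have hmem : (z, (0 : V)) ∈ O :=
    ⟨⟨hz, mem_univ _⟩, by rw [mem_preimage, hζ0]; exact mem_extChartAt_target (1 : G)⟩
  have hQ0 : Q (z, 0) = φ.symm z := by
    simp only [hQ, hζ0, ec, one_mul, add_zero, hπ, hτa]
  have key : ∀ v : V, md EP V B.proj (φ.symm z) (md (EP × V) EP Q (z, 0) (0, v)) = v ∧
      conn.formAt (φ.symm z) (md (EP × V) EP Q (z, 0) (0, v)) = 0 := by
    intro v
    have hline : HasDerivAt (fun r : ℝ => (z, r • v)) ((0 : EP), v) 0 := by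
      have := (hasDerivAt_const (0 : ℝ) z).prodMk ((hasDerivAt_id (0 : ℝ)).smul_const v)
      simpa using this
    have hQd : HasMD (EP × V) EP Q (z, (0 : ℝ) • v) (md (EP × V) EP Q (z, 0)) := by
      rw [zero_smul]
      exact (hQs.contMDiffAt (hOo.mem_nhds hmem)).hasMD
    have hQv : HasMD ℝ EP (fun r : ℝ => Q (z, r • v)) 0 _ :=
      hQd.comp (f := fun r : ℝ => (z, r • v)) (hasMD_iff_hasFDerivAt.2 hline.hasFDerivAt)
    have hv1 : vel EP (fun r : ℝ => Q (z, r • v)) 0 = md (EP × V) EP Q (z, 0) (0, v) := by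
      rw [hQv.vel_eq]; simp
    rw [← hv1]
    have hl2 : HasDerivAt (fun r : ℝ => π z + r • v) v 0 := by
      simpa using ((hasDerivAt_id (0 : ℝ)).smul_const v).const_add (π z)
    have hl2m : MDifferentiableAt 𝓘(ℝ, ℝ) 𝓘(ℝ, V) (fun r : ℝ => π z + r • v) 0 :=
      mdifferentiableAt_iff_differentiableAt.2 hl2.differentiableAt
    constructor
    · have h1 : HasMD EP V B.proj (Q (z, (0 : ℝ) • v)) (md EP V B.proj (φ.symm z)) := by
        rw [zero_smul, hQ0]; exact (B.contMDiff_proj _).hasMD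
      rw [← MDifferentiableAt.vel_comp (c := fun r : ℝ => Q (z, r • v)) h1 hQv.mdifferentiableAt]
      have h2 : (fun r : ℝ => B.proj (Q (z, r • v))) = fun r => π z + r • v := by
        funext r
        simp only [hQ, B.proj_act, hσp]
      rw [h2, vel_eq_deriv, hl2.deriv]
    · have hcσ : MDifferentiableAt 𝓘(ℝ, ℝ) 𝓘(ℝ, EP) (fun r : ℝ => σ (π z + r • v)) 0 :=
        (hσ.contMDiffAt.hasMD.comp hl2m.hasMD).mdifferentiableAt
      have hvσ : vel EP (fun r : ℝ => σ (π z + r • v)) 0 = md V EP σ (π z) v := by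
        rw [MDifferentiableAt.vel_comp (c := fun r : ℝ => π z + r • v) hσ.contMDiffAt.hasMD hl2m,
          vel_eq_deriv, hl2.deriv]
        simp
      have hζd : HasDerivAt (fun r : ℝ => ζ (z, r • v)) (-A (π z) v) 0 := by
        have h1 : HasDerivAt (fun r : ℝ => c 1 - r • A (π z) v) (-A (π z) v) 0 := by
          simpa using ((hasDerivAt_id (0 : ℝ)).smul_const (A (π z) v)).const_sub (c 1)
        simpa [hζ] using h1
      have hζ0' : ζ (z, (0 : ℝ) • v) = c 1 := by rw [zero_smul, hζ0]
      have hg1 : vel EG (fun r : ℝ => c.symm (ζ (z, r • v))) 0 = -A (π z) v := by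
        have h2 := vel_extChartAt_symm_comp (G := G) (z := fun r : ℝ => ζ (z, r • v)) (t := 0)
          (A := -A (π z) v) (by rw [hζ0']; exact mem_extChartAt_target (1 : G)) (by
            rw [hζ0', hc, rightTransChart_apply_one]; exact hζd)
        rw [hζ0', ← hc, ec] at h2
        refine h2.trans ?_
        rw [rightTrans]
        simp only [mul_one]
        rw [hasMD_id.md_eq]; rfl
      have hgd : MDifferentiableAt 𝓘(ℝ, ℝ) 𝓘(ℝ, EG) (fun r : ℝ => c.symm (ζ (z, r • v))) 0 := by
        have h2 : HasMD EG EG c.symm (ζ (z, (0 : ℝ) • v)) (md EG EG c.symm (c 1)) := by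
          rw [hζ0']
          exact (contMDiffAt_extChartAt_symm (mem_extChartAt_target (1 : G))).hasMD
        exact (h2.comp (f := fun r : ℝ => ζ (z, r • v))
          (hasMD_iff_hasFDerivAt.2 hζd.hasFDerivAt)).mdifferentiableAt
      set a := τ (φ.symm z) with ha
      have hm := hasMD_mul_right (E := EG) a (c.symm (ζ (z, (0 : ℝ) • v)))
      have hg2 : vel EG (fun r : ℝ => c.symm (ζ (z, r • v)) * a) 0 =
          rightTrans EG a (-A (π z) v) := by
        rw [MDifferentiableAt.vel_comp (c := fun r : ℝ => c.symm (ζ (z, r • v))) hm hgd, hg1,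
          hζ0', ec]
        rfl
      have hgd2 := (hm.comp (f := fun r : ℝ => c.symm (ζ (z, r • v))) hgd.hasMD).mdifferentiableAt
      have h3 := conn.formAt_vel_act hcσ hgd2
      have h4 : c.symm (ζ (z, (0 : ℝ) • v)) * a = a := by rw [hζ0', ec, one_mul]
      -- Both terms of the gauge formula become Ad(a⁻¹)A(v), with opposite signs.
      rw [hvσ, hg2, h4, md_mul_left_inv_rightTrans, lieAd_neg, zero_smul, add_zero] at h3
      have h5 : B.act (σ (π z)) a = φ.symm z := hτa _
      rw [h5] at h3
      refine h3.trans ?_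
      show lieAd EG a⁻¹ (A (π z) v) + _ = 0
      rw [add_neg_cancel]
  refine ⟨hmem, hQ0, ?_, fun v => (conn.horizontalLift_eq hσ hσp (key v).1 (key v).2).symm⟩
  rw [hQ0]
  funext v
  exact (key v).2

theorem contMDiffAt_of_comp_extChartAt_symm {f : P → EG} {p : P} {g : EP → EG}
    (hg : ContDiffAt ℝ ∞ g (extChartAt 𝓘(ℝ, EP) p p))
    (h : ∀ z ∈ (extChartAt 𝓘(ℝ, EP) p).target, f ((extChartAt 𝓘(ℝ, EP) p).symm z) = g z) :
    ContMDiffAt 𝓘(ℝ, EP) 𝓘(ℝ, EG) ∞ f p := by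
  have h1 : ContMDiffAt 𝓘(ℝ, EP) 𝓘(ℝ, EG) ∞ (fun q => g (extChartAt 𝓘(ℝ, EP) p q)) p :=
    ContMDiffAt.comp p (f := extChartAt 𝓘(ℝ, EP) p) hg.contMDiffAt contMDiffAt_extChartAt
  refine h1.congr_of_eventuallyEq ?_
  filter_upwards [(isOpen_extChartAt_source (I := 𝓘(ℝ, EP)) p).mem_nhds (mem_extChartAt_source p)]
    with q hq
  rw [← h _ ((extChartAt 𝓘(ℝ, EP) p).map_source hq), (extChartAt 𝓘(ℝ, EP) p).left_inv hq]

/-- Along v = 0 the map of `exists_horizontal_map` turns the component into the exterior derivative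
of a smooth form on a vector space, evaluated on constant vectors. -/
theorem contMDiff_curvatureComponent (hσ : ContMDiff 𝓘(ℝ, V) 𝓘(ℝ, EP) ∞ σ)
    (hσp : ∀ y, B.proj (σ y) = y) (u w : V) :
    ContMDiff 𝓘(ℝ, EP) 𝓘(ℝ, EG) ∞ (conn.curvatureComponent u w) := by
  have : CompleteSpace EG := FiniteDimensional.complete ℝ EG
  intro p
  obtain ⟨O, Q, hO, hQ, h⟩ := conn.exists_horizontal_map hσ hσp p
  have h1 := h _ (mem_extChartAt_target (I := 𝓘(ℝ, EP)) p)
  have hA := (conn.contDiffOn_pullForm hO hQ).contDiffAt (hO.mem_nhds h1.1)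
  have hD : ContDiffAt ℝ ∞ (fun z : EP => fderiv ℝ (conn.pullForm Q) (z, (0 : V)))
      (extChartAt 𝓘(ℝ, EP) p p) :=
    ContDiffAt.comp (extChartAt 𝓘(ℝ, EP) p p) (f := fun z : EP => (z, (0 : V)))
      (hA.fderiv_right (m := ∞) (by simp)) (contDiffAt_id.prodMk contDiffAt_const)
  refine contMDiffAt_of_comp_extChartAt_symm
    (((hD.clm_apply contDiffAt_const).clm_apply contDiffAt_const).sub
      ((hD.clm_apply contDiffAt_const).clm_apply contDiffAt_const))
    (g := fun z => fderiv ℝ (conn.pullForm Q) (z, (0 : V)) (0, u) (0, w) -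
      fderiv ℝ (conn.pullForm Q) (z, (0 : V)) (0, w) (0, u)) fun z hz => ?_
  obtain ⟨e1, e2, e3, e4⟩ := h z hz
  have hc := conn.curvature_md hO hQ e1 (0, u) (0, w)
  have e5 : conn.pullForm Q (z, (0 : V)) (0, u) = 0 := congrFun e3 u
  rw [e5, zero_lieBracketModel, add_zero, e4, e4, e2] at hc
  exact hc

theorem contMDiff_covDeriv (hσ : ContMDiff 𝓘(ℝ, V) 𝓘(ℝ, EP) ∞ σ)
    (hσp : ∀ y, B.proj (σ y) = y) {f : P → EG} (hf : ContMDiff 𝓘(ℝ, EP) 𝓘(ℝ, EG) ∞ f) (v : V) :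
    ContMDiff 𝓘(ℝ, EP) 𝓘(ℝ, EG) ∞ fun p => md EP EG f p (conn.horizontalLift p v) := by
  intro p
  obtain ⟨O, Q, hO, hQ, h⟩ := conn.exists_horizontal_map hσ hσp p
  have h1 := h _ (mem_extChartAt_target (I := 𝓘(ℝ, EP)) p)
  have hfQ : ContDiffOn ℝ ∞ (fun q => f (Q q)) O :=
    contMDiffOn_iff_contDiffOn.1 (hf.comp_contMDiffOn hQ)
  have hD : ContDiffAt ℝ ∞ (fun z : EP => fderiv ℝ (fun q => f (Q q)) (z, (0 : V)))
      (extChartAt 𝓘(ℝ, EP) p p) :=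
    ContDiffAt.comp (extChartAt 𝓘(ℝ, EP) p p) (f := fun z : EP => (z, (0 : V)))
      ((hfQ.contDiffAt (hO.mem_nhds h1.1)).fderiv_right (m := ∞) (by simp))
      (contDiffAt_id.prodMk contDiffAt_const)
  refine contMDiffAt_of_comp_extChartAt_symm (hD.clm_apply contDiffAt_const)
    (g := fun z => fderiv ℝ (fun q => f (Q q)) (z, (0 : V)) (0, v)) fun z hz => ?_
  obtain ⟨e1, e2, -, e4⟩ := h z hz
  have h2 := (hf (Q (z, 0))).hasMD.comp (hQ.contMDiffAt (hO.mem_nhds e1)).hasMD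
  rw [← md_eq_fderiv, h2.md_eq, ContinuousLinearMap.comp_apply, e4, e2]

theorem contMDiff_iterCovDeriv (hσ : ContMDiff 𝓘(ℝ, V) 𝓘(ℝ, EP) ∞ σ)
    (hσp : ∀ y, B.proj (σ y) = y) {f : P → EG} (hf : ContMDiff 𝓘(ℝ, EP) 𝓘(ℝ, EG) ∞ f) :
    ∀ vs : List V, ContMDiff 𝓘(ℝ, EP) 𝓘(ℝ, EG) ∞ (conn.iterCovDeriv f vs)
  | [] => hf
  | v :: vs => conn.contMDiff_covDeriv hσ hσp (contMDiff_iterCovDeriv hσ hσp hf vs) v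

/-- Iterated covariant derivatives along a horizontal curve over a line. -/
theorem iterCovDeriv_replicate (hσ : ContMDiff 𝓘(ℝ, V) 𝓘(ℝ, EP) ∞ σ)
    (hσp : ∀ y, B.proj (σ y) = y) {f : P → EG} (hf : ContMDiff 𝓘(ℝ, EP) 𝓘(ℝ, EG) ∞ f) {x τ : V}
    (hτ : ∀ s : ℝ, md V EP σ (x + s • τ) τ = conn.horizontalLift (σ (x + s • τ)) τ) (l : ℕ) (s : ℝ) :
    conn.iterCovDeriv f (List.replicate l τ) (σ (x + s • τ)) =
      iteratedDeriv l (fun s : ℝ => f (σ (x + s • τ))) s := by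
  induction l generalizing s with
  | zero => simp [iterCovDeriv]
  | succ l ih =>
    rw [iteratedDeriv_succ]
    have h1 : iteratedDeriv l (fun s : ℝ => f (σ (x + s • τ))) =
        fun s => conn.iterCovDeriv f (List.replicate l τ) (σ (x + s • τ)) :=
      funext fun s => (ih s).symm
    have hl : HasDerivAt (fun r : ℝ => x + r • τ) τ s := by
      simpa using ((hasDerivAt_id s).smul_const τ).const_add x
    have h2 := ((conn.contMDiff_iterCovDeriv hσ hσp hf (List.replicate l τ))
      (σ (x + s • τ))).hasMD.comp ((hσ (x + s • τ)).hasMD)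
    rw [h1, ← vel_eq_deriv, MDifferentiableAt.vel_comp (c := fun r : ℝ => x + r • τ) h2
      (mdifferentiableAt_iff_differentiableAt.2 hl.differentiableAt), vel_eq_deriv, hl.deriv,
      ContinuousLinearMap.comp_apply, hτ]
    rfl

end PrincipalConnection

/-- Induction on k: apply the case k to b' and integrate once. -/
theorem isLittleO_pow_of_iteratedDeriv_eq_zero {F : Type*} [NormedAddCommGroup F] [NormedSpace ℝ F]
    {b : ℝ → F} (hb : ContDiff ℝ ∞ b) {k : ℕ} (h : ∀ l ≤ k, iteratedDeriv l b 0 = 0) :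
    b =o[𝓝[>] 0] fun s : ℝ => s ^ k := by
  induction k generalizing b with
  | zero =>
    simp only [pow_zero, Asymptotics.isLittleO_one_iff]
    have := (hb.continuous.tendsto 0).mono_left (nhdsWithin_le_nhds (s := Ioi 0))
    have h0 := h 0 le_rfl
    rw [iteratedDeriv_zero] at h0
    rwa [h0] at this
  | succ k ih =>
    have h0 := h 0 (by omega)
    rw [iteratedDeriv_zero] at h0
    refine isLittleO_pow_succ_of_hasDerivAt hb.continuous.continuousAt h0 (f' := deriv b)
      (fun s _ => (hb.differentiable (by simp) s).hasDerivAt)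
      (ih (contDiff_infty_iff_deriv.1 hb).2 fun l hl => ?_)
    rw [← iteratedDeriv_succ']
    exact h (l + 1) (by omega)

variable (x : V)

/-- A vector space as a space with dilations. -/
def vectorDilationChart : DilationChart V V x (vectorDilationAt x) edist where
  D s := s • ContinuousLinearMap.id ℝ V
  contDiff_D := contDiff_id.smul contDiff_const
  D_zero := zero_smul _ _
  D_one := one_smul _ _
  D_mul s t := by ext; simp [mul_smul, smul_comm s t]
  κ τ := x + τ
  contMDiff_κ := (contDiff_const.add contDiff_id).contMDiff
  κ_zero := add_zero x
  δ_κ s _ τ := by simp [vectorDilationAt]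
  contMDiff_δ s _ := (contDiff_const.add (contDiff_const.smul (contDiff_id.sub contDiff_const))).contMDiff
  coord y := y - x
  radius := 1
  radius_pos := one_pos
  lip := 1
  lip_pos := one_pos
  κ_coord y _ := by simp
  contMDiffAt_coord y _ := (contDiff_id.sub contDiff_const).contMDiff.contMDiffAt
  coord_self := sub_self x
  coord_lipschitz y z _ _ := by simp
  d_self := edist_self x
  d_δ s hs y z := by
    simp only [vectorDilationAt, edist_add_left, edist_smul₀, edist_sub_right]
    rw [ENNReal.smul_def, smul_eq_mul, ← enorm_eq_nnnorm, ← Real.enorm_of_nonneg hs.le]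

variable {x conn}

theorem vectorDilationChart_gen : (vectorDilationChart x).gen = ContinuousLinearMap.id ℝ V := by
  have h : HasDerivAt (fun s : ℝ => s • ContinuousLinearMap.id ℝ V) (ContinuousLinearMap.id ℝ V) 1 := by
    simpa using (hasDerivAt_id (1 : ℝ)).smul_const (ContinuousLinearMap.id ℝ V)
  exact h.deriv

theorem md_vectorDilationChart_κ (w : V) :
    md V V (vectorDilationChart x).κ w = ContinuousLinearMap.id ℝ V := by
  rw [md_eq_fderiv]
  exact ((hasFDerivAt_id w).const_add x).fderiv

theorem vectorDilationChart_form (hσ : ContMDiff 𝓘(ℝ, V) 𝓘(ℝ, EP) ∞ σ) (w v : V) :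
    (vectorDilationChart x).form conn σ w v = conn.formAt (σ (x + w)) (md V EP σ (x + w) v) := by
  have h := (hσ (x + w)).hasMD.comp_of_eq ((vectorDilationChart x).hasMD_κ w) rfl
  rw [md_vectorDilationChart_κ] at h
  rw [DilationChart.form, conn.pullForm_apply, h.md_eq]
  rfl

/-- Divide A(sτ)(sτ) = 0 by s ≠ 0; continuity covers s = 0. Hence A vanishes at x and σ is
horizontal along rays. -/
theorem form_ray_eq_zero (hσ : conn.IsRadialGauge (vectorDilationAt x) σ) (τ : V) (s : ℝ) :
    (vectorDilationChart x).form conn σ (s • τ) τ = 0 := by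
  have h1 : ∀ s : ℝ, s ≠ 0 → (vectorDilationChart x).form conn σ (s • τ) τ = 0 := by
    intro s hs
    have := (vectorDilationChart x).form_gen hσ (s • τ)
    rw [vectorDilationChart_gen, ContinuousLinearMap.id_apply, map_smul] at this
    exact (smul_eq_zero.1 this).resolve_left hs
  have hc : Continuous fun s : ℝ => (vectorDilationChart x).form conn σ (s • τ) τ :=
    ((vectorDilationChart x).contDiff_form hσ).continuous.comp
      (continuous_id.smul continuous_const) |>.clm_apply continuous_const
  have h2 : EqOn (fun s : ℝ => (vectorDilationChart x).form conn σ (s • τ) τ) (fun _ => 0) univ := by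
    rw [← (dense_compl_singleton (0 : ℝ)).closure_eq]
    exact (show EqOn _ _ ({0}ᶜ : Set ℝ) from fun s hs => h1 s hs).closure hc continuous_const
  exact h2 (mem_univ s)

/-- A(sτ)(sh) = s A(sτ)(h), and A(sτ)(h) tends to A(0)(h) = 0. This is the input for m = 2, with no
condition on the curvature. -/
theorem form_isLittleO_vector (hσ : conn.IsRadialGauge (vectorDilationAt x) σ) (τ h : V) :
    (fun s : ℝ => (vectorDilationChart x).form conn σ ((vectorDilationChart x).D s τ)
      ((vectorDilationChart x).D s h)) =o[𝓝[>] 0] fun s : ℝ => s ^ 1 := by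
  have h0 : (vectorDilationChart x).form conn σ 0 h = 0 := by
    have := form_ray_eq_zero hσ h 0
    rwa [zero_smul] at this
  have hc : Continuous fun s : ℝ => (vectorDilationChart x).form conn σ (s • τ) h :=
    ((vectorDilationChart x).contDiff_form hσ).continuous.comp
      (continuous_id.smul continuous_const) |>.clm_apply continuous_const
  have h1 : (fun s : ℝ => (vectorDilationChart x).form conn σ (s • τ) h) =o[𝓝[>] 0]
      fun _ : ℝ => (1 : ℝ) := by
    rw [Asymptotics.isLittleO_one_iff]
    have := (hc.tendsto 0).mono_left (nhdsWithin_le_nhds (s := Ioi 0))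
    simpa [h0] using this
  have h2 := (Asymptotics.isBigO_refl (fun s : ℝ => s) (𝓝[>] 0)).smul_isLittleO h1
  simp only [smul_eq_mul, mul_one] at h2
  refine h2.congr (fun s => ?_) fun s => (pow_one s).symm
  exact (map_smul ((vectorDilationChart x).form conn σ (s • τ)) s h).symm

/-- The curve σ(x + sτ) is horizontal, so the covariant derivatives along τ are the ordinary
derivatives of b(s) = Ω(τ, h) on it, and b = o(s^k). The derivative of A(sτ)(sh) is s b(s) =
o(s^(k+1)); integrate once. -/
theorem form_isLittleO_of_curvatureVanishes (hσ : conn.IsRadialGauge (vectorDilationAt x) σ) {k : ℕ}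
    (hk : conn.CurvatureVanishesToOrder x k) (τ h : V) :
    (fun s : ℝ => (vectorDilationChart x).form conn σ ((vectorDilationChart x).D s τ)
      ((vectorDilationChart x).D s h)) =o[𝓝[>] 0] fun s : ℝ => s ^ (k + 2) := by
  have : CompleteSpace EG := FiniteDimensional.complete ℝ EG
  obtain ⟨hσs, hσp, -⟩ := id hσ
  have hproj : ∀ y v, md EP V B.proj (σ y) (md V EP σ y v) = v := by
    intro y v
    have h1 := ((B.contMDiff_proj (σ y)).hasMD.comp (hσs y).hasMD).congr (f₁ := fun y => y)
      (.of_forall fun y => (hσp y).symm)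
    exact DFunLike.congr_fun (h1.unique hasMD_id) v
  have hhor : ∀ s : ℝ, conn.formAt (σ (x + s • τ)) (md V EP σ (x + s • τ) τ) = 0 := fun s => by
    rw [← vectorDilationChart_form hσs]; exact form_ray_eq_zero hσ τ s
  have hlift : ∀ s : ℝ, md V EP σ (x + s • τ) τ = conn.horizontalLift (σ (x + s • τ)) τ := fun s =>
    (conn.horizontalLift_eq hσs hσp (hproj _ _) (hhor s)).symm
  set f := conn.curvatureComponent τ h with hf
  have hfs : ContMDiff 𝓘(ℝ, EP) 𝓘(ℝ, EG) ∞ f := conn.contMDiff_curvatureComponent hσs hσp τ h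
  set b : ℝ → EG := fun s => f (σ (x + s • τ)) with hb
  have hbs : ContDiff ℝ ∞ b := by
    rw [← contMDiff_iff_contDiff]
    exact hfs.comp (hσs.comp
      (contDiff_const.add (contDiff_id.smul contDiff_const)).contMDiff)
  have hbo : b =o[𝓝[>] 0] fun s : ℝ => s ^ k := by
    refine isLittleO_pow_of_iteratedDeriv_eq_zero hbs fun l hl => ?_
    rw [hb, ← conn.iterCovDeriv_replicate hσs hσp hfs hlift]
    refine hk τ h _ (by simpa using hl) _ ?_
    rw [hσp, zero_smul, add_zero]
  -- The vector dσ(h) differs from the horizontal lift of h by a vertical vector, which does not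
  -- contribute because dσ(τ) is horizontal.
  have hcurv : ∀ s : ℝ, conn.pullCurv σ (x + s • τ) τ h = b s := by
    intro s
    set p := σ (x + s • τ) with hp
    set A := conn.formAt p (md V EP σ (x + s • τ) h) with hA
    have hvert : md EP V B.proj p (md EG EP (fun a : G => B.act p a) 1 A) = 0 := by
      have h1 : HasMD EP V B.proj (B.act p 1) (md EP V B.proj p) := by
        rw [B.act_one]; exact (B.contMDiff_proj p).hasMD
      have h2 := h1.comp (B.hasMD_act_right p 1)
      simp only [B.proj_act] at h2
      exact DFunLike.congr_fun (h2.unique (hasMD_const (B.proj p))) A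
    have hlh : conn.horizontalLift p h =
        md V EP σ (x + s • τ) h - md EG EP (fun a : G => B.act p a) 1 A := by
      refine conn.horizontalLift_eq hσs hσp ?_ ?_
      · rw [map_sub, hvert, sub_zero, hproj]
      · rw [map_sub, conn.formAt_vertical, sub_self]
    have hver := conn.curvature_horizontal_vertical (hhor s) A
    have hadd : conn.curvature p (md V EP σ (x + s • τ) τ) (md V EP σ (x + s • τ) h) =
        conn.curvature p (md V EP σ (x + s • τ) τ) (conn.horizontalLift p h) := by
      rw [conn.curvature_eq_of_horizontal (hhor s)] at hver
      rw [hlh, conn.curvature_eq_of_horizontal (hhor s), conn.curvature_eq_of_horizontal (hhor s)]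
      rw [map_sub, map_sub, sub_apply, sub_sub_sub_comm, hver, sub_zero]
    show conn.curvature p (md V EP σ (x + s • τ) τ) (md V EP σ (x + s • τ) h) = b s
    rw [hadd, hlift]
    rfl
  set Q := vectorDilationChart x with hQ
  have hD : ∀ s : ℝ, ∀ v, Q.D s v = s • v := fun s v => rfl
  have hray := (Q.contDiff_form_ray hσ τ h).continuous
  refine isLittleO_pow_succ_of_hasDerivAt hray.continuousAt (by simp [Q.D_zero])
    (fun s hs => Q.hasDerivAt_form hσ hs τ h) ?_
  have h1 := (Asymptotics.isBigO_refl (fun s : ℝ => s) (𝓝[>] 0)).smul_isLittleO hbo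
  refine h1.congr' ?_ (.of_forall fun s => ?_)
  · filter_upwards [self_mem_nhdsWithin] with s hs
    have hs0 : s ≠ 0 := ne_of_gt hs
    simp only [md_vectorDilationChart_κ, vectorDilationChart_gen, hQ, ContinuousLinearMap.id_apply]
    rw [← hQ, hD, hD, inv_smul_smul₀ hs0, ← hcurv]
    show s • conn.curvature (σ (x + s • τ)) (md V EP σ (x + s • τ) τ) (md V EP σ (x + s • τ) h) =
      conn.curvature (σ (x + s • τ)) (md V EP σ (x + s • τ) τ) (md V EP σ (x + s • τ) (s • h))
    rw [conn.curvature_eq_of_horizontal (hhor s), conn.curvature_eq_of_horizontal (hhor s)]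
    simp only [map_smul, smul_sub, smul_apply]
  · exact (pow_succ' s k).symm

/-- The holonomy expansions on a vector space. -/
theorem holonomyExpansion_vector [T2Space G] (hσ : conn.IsRadialGauge (vectorDilationAt x) σ) :
    HolonomyExpansion conn x (σ x) (metricLength edist)
        (diskIntegral (vectorDilationAt x) (conn.pullbackCurvature σ)) (2 * 2) ∧
      ∀ k : ℕ, conn.CurvatureVanishesToOrder x k →
        HolonomyExpansion conn x (σ x) (metricLength edist)
          (diskIntegral (vectorDilationAt x) (conn.pullbackCurvature σ)) (2 * (3 + k)) := by
  refine ⟨(vectorDilationChart x).holonomyExpansion hσ (.inr fun τ h => form_isLittleO_vector hσ τ h),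
    fun k hk => (vectorDilationChart x).holonomyExpansion hσ (.inr fun τ h => ?_)⟩
  have : 3 + k - 1 = k + 2 := by omega
  rw [this]
  exact form_isLittleO_of_curvatureVanishes hσ hk τ h

end EuclideanHolonomy

/-! ### Coordinates of the second kind -/

section SecondKind

variable {E N : Type*} [NormedAddCommGroup E] [NormedSpace ℝ E]
  [TopologicalSpace N] [ChartedSpace E N] [Group N] [LieGroup 𝓘(ℝ, E) ∞ N]
  {n : ℕ} {c : Fin n → ℝ → N} {b : Fin n → E}

/-- The product of the one-parameter subgroups `c i` at the times `τ i`, `i ∈ l`. -/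
def prodSubgroups (c : Fin n → ℝ → N) (l : List (Fin n)) (τ : Fin n → ℝ) : N :=
  (l.map fun i => c i (τ i)).prod

theorem prodSubgroups_cons (i : Fin n) (l : List (Fin n)) (τ : Fin n → ℝ) :
    prodSubgroups c (i :: l) τ = c i (τ i) * prodSubgroups c l τ := by
  simp [prodSubgroups]

theorem contMDiff_prodSubgroups (hc : ∀ i, IsOneParameterSubgroup E (b i) (c i))
    (l : List (Fin n)) : ContMDiff 𝓘(ℝ, Fin n → ℝ) 𝓘(ℝ, E) ∞ (prodSubgroups c l) := by
  induction l with
  | nil => exact contMDiff_const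
  | cons i l ih =>
    have h : prodSubgroups c (i :: l) = fun τ => c i (τ i) * prodSubgroups c l τ :=
      funext fun τ => prodSubgroups_cons i l τ
    rw [h]
    have h1 : ContMDiff 𝓘(ℝ, Fin n → ℝ) 𝓘(ℝ, ℝ) ∞ (fun τ : Fin n → ℝ => τ i) :=
      (contDiff_apply ℝ ℝ i).contMDiff
    exact ((hc i).1.comp h1).mul ih

theorem prodSubgroups_zero (hc : ∀ i, IsOneParameterSubgroup E (b i) (c i)) (l : List (Fin n)) :
    prodSubgroups c l 0 = 1 := by
  induction l with
  | nil => rfl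
  | cons i l ih => rw [prodSubgroups_cons, ih, Pi.zero_apply, (hc i).map_zero, one_mul]

/-- At the identity, the derivative of a product is the sum of the derivatives. For a basis b the
full product is therefore a local parametrization at 1. -/
theorem hasMD_prodSubgroups (hc : ∀ i, IsOneParameterSubgroup E (b i) (c i)) (l : List (Fin n)) :
    HasMD (Fin n → ℝ) E (prodSubgroups c l) 0
      (l.map fun i => (ContinuousLinearMap.proj (R := ℝ) (φ := fun _ : Fin n => ℝ) i).smulRight
        (b i)).sum := by
  induction l with
  | nil => exact hasMD_const 1
  | cons i l ih =>
    have h : prodSubgroups c (i :: l) = fun τ => c i (τ i) * prodSubgroups c l τ :=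
      funext fun τ => prodSubgroups_cons i l τ
    have h1 : HasMD (Fin n → ℝ) ℝ (fun τ : Fin n → ℝ => τ i) 0
        (ContinuousLinearMap.proj (R := ℝ) (φ := fun _ : Fin n => ℝ) i) :=
      hasMD_iff_hasFDerivAt.2 (hasFDerivAt_apply i _)
    have h2 := ((hc i).hasMD 0).comp_of_eq h1 rfl
    have h3 := HasMD.comp₂ (H := fun q : N × N => q.1 * q.2)
      ((contMDiffAt_mul_pair (E := E) _).mdifferentiableAt (by simp)) h2 ih
    rw [← h] at h3
    convert h3 using 1
    simp only [prodSubgroups_zero hc, Pi.zero_apply, (hc i).map_zero, mul_one, one_mul,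
      hasMD_id.md_eq, List.map_cons, List.sum_cons, ContinuousLinearMap.id_comp]
    congr 1
    ext τ
    have h4 : md ℝ E (c i) 0 (τ i) = τ i • md ℝ E (c i) 0 1 := by
      rw [← map_smul, smul_eq_mul, mul_one]
    simp [h4, (hc i).vel_zero]

variable [FiniteDimensional ℝ E]

/-- A map into a manifold has a smooth local right inverse where its derivative is invertible. -/
theorem exists_smooth_rightInverse {W M : Type*} [NormedAddCommGroup W] [NormedSpace ℝ W]
    [FiniteDimensional ℝ W] [TopologicalSpace M] [ChartedSpace E M] [IsManifold 𝓘(ℝ, E) ∞ M]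
    {f : W → M} (hf : ContMDiff 𝓘(ℝ, W) 𝓘(ℝ, E) ∞ f) {w : W} {e : W ≃L[ℝ] E}
    (he : HasMD W E f w (e : W →L[ℝ] E)) :
    ∃ (U : Set M) (g : M → W), IsOpen U ∧ f w ∈ U ∧ g (f w) = w ∧
      ∀ y ∈ U, f (g y) = y ∧ ContMDiffAt 𝓘(ℝ, E) 𝓘(ℝ, W) ∞ g y := by
  have : CompleteSpace W := FiniteDimensional.complete ℝ W
  have : CompleteSpace E := FiniteDimensional.complete ℝ E
  set φ := extChartAt 𝓘(ℝ, E) (f w) with hφ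
  set F : W → E := fun w => φ (f w) with hF
  set O : Set W := f ⁻¹' φ.source with hO
  have hOo : IsOpen O := (isOpen_extChartAt_source _).preimage hf.continuous
  have hwO : w ∈ O := mem_extChartAt_source (f w)
  have hFs : ∀ v ∈ O, ContDiffAt ℝ ∞ F v := fun v hv =>
    contMDiffAt_iff_contDiffAt.1
      (ContMDiffAt.comp v (g := φ) (contMDiffAt_extChartAt_of_mem hv) (hf v))
  have hFe : HasFDerivAt F (e : W →L[ℝ] E) w := by
    have h := (contMDiffAt_extChartAt_of_mem (E := E) hwO).hasMD.comp he
    rw [md_extChartAt_self, ContinuousLinearMap.id_comp] at h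
    exact hasMD_iff_hasFDerivAt.1 h
  set Φ := (hFs w hwO).toOpenPartialHomeomorph F hFe (by simp) with hΦ
  have hΦw : w ∈ Φ.source := (hFs w hwO).mem_toOpenPartialHomeomorph_source hFe (by simp)
  have hcoe : ∀ v, Φ v = F v := fun v => rfl
  -- the points where the derivative is invertible
  set O' : Set W := {v | v ∈ O ∧ fderiv ℝ F v ∈ range ((↑) : (W ≃L[ℝ] E) → W →L[ℝ] E)} with hO'
  have hO'n : O' ∈ 𝓝 w := by
    have h1 : ContinuousAt (fderiv ℝ F) w :=
      ((hFs w hwO).fderiv_right (m := ∞) (by simp)).continuousAt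
    have h2 := h1.eventually (ContinuousLinearEquiv.isOpen.mem_nhds (by
      rw [hFe.fderiv]; exact ⟨e, rfl⟩))
    filter_upwards [hOo.mem_nhds hwO, h2] with v h3 h4 using ⟨h3, h4⟩
  obtain ⟨O'', hO''s, hO''o, hwO''⟩ := mem_nhds_iff.1 hO'n
  have hT : IsOpen (Φ.target ∩ Φ.symm ⁻¹' O'') := Φ.isOpen_inter_preimage_symm hO''o
  have hxT : φ (f w) ∈ Φ.target ∩ Φ.symm ⁻¹' O'' := by
    refine ⟨Φ.map_source hΦw, ?_⟩
    have : Φ.symm (φ (f w)) = w := Φ.left_inv hΦw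
    rw [mem_preimage, this]; exact hwO''
  refine ⟨φ.source ∩ φ ⁻¹' (Φ.target ∩ Φ.symm ⁻¹' O''), fun y => Φ.symm (φ y),
    (continuousOn_extChartAt (f w)).isOpen_inter_preimage (isOpen_extChartAt_source _) hT,
    ⟨hwO, hxT⟩, Φ.left_inv hΦw, fun y hy => ?_⟩
  obtain ⟨hy1, hy2, hy3⟩ := hy
  obtain ⟨h4, e', he'⟩ := hO''s hy3
  constructor
  · have h5 : φ (f (Φ.symm (φ y))) = φ y := Φ.right_inv hy2
    exact φ.injOn h4 hy1 h5
  · have h6 : HasFDerivAt Φ (e' : W →L[ℝ] E) (Φ.symm (φ y)) := by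
      rw [he']
      exact ((hFs _ h4).differentiableAt (by simp)).hasFDerivAt
    have h7 : ContDiffAt ℝ ∞ Φ.symm (φ y) := Φ.contDiffAt_symm hy2 h6 (hFs _ h4)
    exact ContMDiffAt.comp y (f := φ) h7.contMDiffAt (contMDiffAt_extChartAt_of_mem hy1)

/-- A smooth function with compact support in a given neighbourhood that is `1` near the point. -/
theorem exists_smooth_bump {M : Type*} [TopologicalSpace M] [T2Space M] [ChartedSpace E M]
    [IsManifold 𝓘(ℝ, E) ∞ M] {x : M} {U : Set M} (hU : U ∈ 𝓝 x) :
    ∃ (χ : M → ℝ) (K : Set M), ContMDiff 𝓘(ℝ, E) 𝓘(ℝ, ℝ) ∞ χ ∧ IsCompact K ∧ K ⊆ U ∧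
      (∀ y ∉ K, χ y = 0) ∧ χ =ᶠ[𝓝 x] 1 := by
  obtain ⟨f, -, hf⟩ := (SmoothBumpFunction.nhds_basis_tsupport (I := 𝓘(ℝ, E)) x).mem_iff.1 hU
  exact ⟨f, tsupport f, f.contMDiff, f.hasCompactSupport, hf,
    fun y hy => image_eq_zero_of_notMem_tsupport hy, f.eventuallyEq_one⟩

end SecondKind

/-! ### The Carnot–Carathéodory metric -/

section CarnotMetric

variable {E N : Type*} [NormedAddCommGroup E] [NormedSpace ℝ E] [FiniteDimensional ℝ E]
  [TopologicalSpace N] [ChartedSpace E N] [Group N] [LieGroup 𝓘(ℝ, E) ∞ N]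
  {F : Type*} [NormedAddCommGroup F] [NormedSpace ℝ F]

theorem leftTrans_injective (y : N) : Function.Injective (leftTrans E y) :=
  (injective_iff_map_eq_zero _).2 fun _ h => md_mul_left_injective y 1 h

/-- The tangent map of u applied to the continuous left-invariant field generated by A. -/
theorem continuous_md_leftTrans {u : N → F} (hu : ContMDiff 𝓘(ℝ, E) 𝓘(ℝ, F) ∞ u) (A : E) :
    Continuous fun y => md E F u y (leftTrans E y A) := by
  have h1 := hu.contMDiff_tangentMap (m := 0) (n := ∞) (by simp)
  have h2 := (contMDiff_mulInvariantVectorField_one (G := N) A).continuous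
  have h3 := (contMDiff_snd_tangentBundle_modelSpace (n := 0) F 𝓘(ℝ, F)).continuous
  exact h3.comp (h1.continuous.comp h2)

/-- The derivative of a function with compact support is bounded in the left trivialisation. -/
theorem exists_md_leftTrans_le {u : N → F} (hu : ContMDiff 𝓘(ℝ, E) 𝓘(ℝ, F) ∞ u) [T2Space N]
    {K : Set N} (hK : IsCompact K) (h0 : ∀ y ∉ K, u y = 0) :
    ∃ C > 0, ∀ y A, ‖md E F u y (leftTrans E y A)‖ ≤ C * ‖A‖ := by
  set b := Module.finBasis ℝ E
  obtain ⟨C₁, hC₁, h₁⟩ := b.exists_opNorm_le (F := F)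
  have h2 : ∀ i, ∃ C, ∀ y ∈ K, ‖md E F u y (leftTrans E y (b i))‖ ≤ C := fun i =>
    hK.exists_bound_of_continuousOn (continuous_md_leftTrans hu (b i)).continuousOn
  choose C₂ hC₂ using h2
  set M := ∑ i, |C₂ i| with hM
  have hM0 : 0 ≤ M := Finset.sum_nonneg fun i _ => abs_nonneg _
  have h3 : ∀ y i, ‖md E F u y (leftTrans E y (b i))‖ ≤ M := by
    intro y i
    by_cases hy : y ∈ K
    · refine (hC₂ i y hy).trans ((le_abs_self _).trans ?_)
      exact Finset.single_le_sum (f := fun i => |C₂ i|) (fun i _ => abs_nonneg _) (Finset.mem_univ i)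
    · have h4 : u =ᶠ[𝓝 y] fun _ => (0 : F) := by
        filter_upwards [hK.isClosed.isOpen_compl.mem_nhds hy] with z hz using h0 z hz
      rw [md_congr h4, (hasMD_const (0 : F)).md_eq]
      simpa using hM0
  refine ⟨C₁ * M + 1, by positivity, fun y A => ?_⟩
  have h5 := h₁ (u := (md E F u y).comp (leftTrans E y)) hM0 (h3 y)
  refine (((md E F u y).comp (leftTrans E y)).le_of_opNorm_le h5 A).trans ?_
  have := norm_nonneg A
  nlinarith

namespace CarnotStructure

variable (S : CarnotStructure E N)

/-- The first layer as a subspace of the model space. -/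
def firstLayer : Submodule ℝ E := S.layer 1

/-- The inner product on the first layer. -/
def innerModel : S.firstLayer →ₗ[ℝ] S.firstLayer →ₗ[ℝ] ℝ := S.inner

theorem innerModel_smul (s : ℝ) (A : S.firstLayer) :
    S.innerModel (s • A) (s • A) = s * s * S.innerModel A A := by
  simp [mul_assoc]

/-- The inner product attains a positive minimum on the compact unit sphere; scale by homogeneity.
-/
theorem exists_norm_le_sqrt_inner :
    ∃ C > 0, ∀ A : S.firstLayer, ‖A‖ ≤ C * √(S.innerModel A A) := by
  have hpos : ∀ A : S.firstLayer, A ≠ 0 → 0 < S.innerModel A A := S.inner_pos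
  have hc : Continuous fun A : S.firstLayer => S.innerModel A A := by
    have h1 : Continuous fun A : S.firstLayer => LinearMap.toContinuousLinearMap (S.innerModel A) :=
      (LinearMap.toContinuousLinearMap.toLinearMap.comp S.innerModel).continuous_of_finiteDimensional
    exact h1.clm_apply continuous_id
  have hK : IsCompact (Metric.sphere (0 : S.firstLayer) 1) := isCompact_sphere _ _
  -- The sphere is empty exactly when the first layer is 0.
  rcases (Metric.sphere (0 : S.firstLayer) 1).eq_empty_or_nonempty with he | hne
  · refine ⟨1, one_pos, fun A => ?_⟩
    have hA : A = 0 := by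
      by_contra hA
      have : ‖A‖⁻¹ • A ∈ Metric.sphere (0 : S.firstLayer) 1 := by
        rw [mem_sphere_zero_iff_norm, norm_smul, norm_inv, norm_norm,
          inv_mul_cancel₀ (norm_ne_zero_iff.2 hA)]
      rw [he] at this
      exact this
    rw [hA, norm_zero]
    positivity
  · obtain ⟨A₀, hA₀, hmin⟩ := hK.exists_isMinOn hne hc.continuousOn
    have hA₀' : A₀ ≠ 0 := by
      rintro rfl
      simp at hA₀
    set q := S.innerModel A₀ A₀ with hq
    have hq0 : 0 < q := hpos A₀ hA₀'
    refine ⟨(√q)⁻¹, by positivity, fun A => ?_⟩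
    by_cases hA : A = 0
    · rw [hA, norm_zero]; positivity
    have hn : 0 < ‖A‖ := norm_pos_iff.2 hA
    have h1 : ‖A‖⁻¹ • A ∈ Metric.sphere (0 : S.firstLayer) 1 := by
      rw [mem_sphere_zero_iff_norm, norm_smul, norm_inv, norm_norm, inv_mul_cancel₀ hn.ne']
    have h2 : q ≤ S.innerModel (‖A‖⁻¹ • A) (‖A‖⁻¹ • A) := hmin h1
    rw [innerModel_smul, ← mul_inv, le_inv_mul_iff₀ (by positivity)] at h2
    rw [le_inv_mul_iff₀ (by positivity)]
    refine Real.le_sqrt_of_sq_le ?_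
    rw [mul_pow, Real.sq_sqrt hq0.le]
    nlinarith

/-- Left translation is injective on tangent vectors, so the chosen representative must be A. -/
theorem horizontalNorm_eq (y : N) (A : S.firstLayer) :
    S.horizontalNorm y (leftTrans E y (A : E)) = √(S.innerModel A A) := by
  let v : TangentSpace 𝓘(ℝ, E) y := leftTrans E y (A : E)
  have h : ∃ A' : S.layer 1,
      mulInvariantVectorField (A' : GroupLieAlgebra 𝓘(ℝ, E) N) y = v := ⟨A, rfl⟩
  refine (dif_pos h : S.horizontalNorm y v =
    √(S.inner h.choose h.choose)).trans ?_
  have h1 : h.choose = A := Subtype.ext (leftTrans_injective (E := E) y h.choose_spec)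
  rw [h1]
  rfl

theorem isHorizontal_iff {c : ℝ → N} : S.IsHorizontal c ↔ IsAbsContCurve E c ∧
    ∀ᵐ t ∂(volume.restrict (Icc (0 : ℝ) 1)), ∃ A : S.firstLayer,
      vel E c t = leftTrans E (c t) (A : E) := by
  refine and_congr_right fun _ => ?_
  refine eventually_congr (.of_forall fun t => exists_congr fun A => ?_)
  exact eq_comm

/-- The speed of a horizontal curve. -/
theorem horizontalNorm_vel {c : ℝ → N} {t : ℝ} {A : S.firstLayer}
    (h : vel E c t = leftTrans E (c t) (A : E)) :
    S.horizontalNorm (c t) (velocity E c t) = √(S.innerModel A A) := by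
  rw [← S.horizontalNorm_eq (c t) A, ← h]; rfl

theorem ccDist_self (y : N) : S.ccDist y y = 0 := by
  have hv : ∀ t : ℝ, vel E (fun _ : ℝ => y) t = leftTrans E y ((0 : S.firstLayer) : E) := by
    intro t
    rw [(hasMD_const (E := ℝ) (x := t) y).vel_eq]
    simp
  have hh : S.IsHorizontal fun _ : ℝ => y := by
    rw [isHorizontal_iff]
    exact ⟨isAbsContCurve_id.comp (H := fun _ : ℝ => y) fun _ _ => contMDiffAt_const,
      .of_forall fun t => ⟨0, hv t⟩⟩
  refine le_antisymm ?_ zero_le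
  refine (iInf₂_le (fun _ : ℝ => y) ⟨hh, rfl, rfl⟩).trans ?_
  have h0 : ∀ t : ℝ, S.horizontalNorm ((fun _ : ℝ => y) t) (velocity E (fun _ : ℝ => y) t) = 0 := by
    intro t
    rw [S.horizontalNorm_vel (c := fun _ : ℝ => y) (hv t)]
    simp
  simp only [h0]
  simp

/-- A smooth function with compact support is Lipschitz for the Carnot–Carathéodory metric. -/
theorem exists_edist_le_ccDist [T2Space N] [FiniteDimensional ℝ F] {u : N → F}
    (hu : ContMDiff 𝓘(ℝ, E) 𝓘(ℝ, F) ∞ u) {K : Set N} (hK : IsCompact K) (h0 : ∀ y ∉ K, u y = 0) :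
    ∃ C > 0, ∀ y z, edist (u y) (u z) ≤ ENNReal.ofReal C * S.ccDist y z := by
  obtain ⟨C₁, hC₁, h₁⟩ := exists_md_leftTrans_le hu hK h0
  obtain ⟨C₂, hC₂, h₂⟩ := S.exists_norm_le_sqrt_inner
  refine ⟨C₁ * C₂, by positivity, fun y z => ?_⟩
  have hne : ENNReal.ofReal (C₁ * C₂) ≠ 0 := (ENNReal.ofReal_pos.2 (by positivity)).ne'
  rw [ccDist, ENNReal.mul_iInf_of_ne hne ENNReal.ofReal_ne_top]
  refine le_iInf fun c => ?_
  rw [ENNReal.mul_iInf_of_ne hne ENNReal.ofReal_ne_top]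
  refine le_iInf fun ⟨hc, hy, hz⟩ => ?_
  obtain ⟨hac, hhor⟩ := S.isHorizontal_iff.1 hc
  have hua : IsAbsContCurve F fun t => u (c t) := hac.comp fun t _ => hu.contMDiffAt
  obtain ⟨hi, hint⟩ := hua.integral_deriv
  have h3 := hint 1 (right_mem_Icc.2 zero_le_one)
  rw [hy, hz] at h3
  rw [edist_comm, edist_eq_enorm_sub, h3, add_sub_cancel_left,
    intervalIntegral.integral_of_le zero_le_one, restrict_Ioc_eq_restrict_Icc]
  refine (enorm_integral_le_lintegral_enorm _).trans ?_
  rw [← lintegral_const_mul' _ _ ENNReal.ofReal_ne_top]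
  refine lintegral_mono_ae ?_
  -- Along a horizontal curve the speed of u ∘ c is at most C₁‖A‖, hence at most C₁C₂ times the
  -- sub-Riemannian speed; then pass to the infimum over curves.
  filter_upwards [hac.ae_mdifferentiableAt, hhor] with t hd ⟨A, hA⟩
  rw [← vel_eq_deriv, MDifferentiableAt.vel_comp hu.contMDiffAt.hasMD hd, hA,
    S.horizontalNorm_vel hA, ← ENNReal.ofReal_mul (by positivity), ← ofReal_norm]
  refine ENNReal.ofReal_le_ofReal ((h₁ _ _).trans ?_)
  rw [mul_assoc]
  gcongr
  exact h₂ A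

/-- A map that multiplies horizontal left-invariant vectors by `s` scales the metric by `s`. -/
theorem ccDist_map_le {H : N → N} (hH : ContMDiff 𝓘(ℝ, E) 𝓘(ℝ, E) ∞ H) {s : ℝ} (hs : 0 < s)
    (h : ∀ y, ∀ A ∈ S.firstLayer, md E E H y (leftTrans E y A) = leftTrans E (H y) (s • A)) (y z : N) :
    S.ccDist (H y) (H z) ≤ ENNReal.ofReal s * S.ccDist y z := by
  have hne : ENNReal.ofReal s ≠ 0 := (ENNReal.ofReal_pos.2 hs).ne'
  conv_rhs => rw [ccDist, ENNReal.mul_iInf_of_ne hne ENNReal.ofReal_ne_top]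
  refine le_iInf fun c => ?_
  rw [ENNReal.mul_iInf_of_ne hne ENNReal.ofReal_ne_top]
  refine le_iInf fun ⟨hc, hy, hz⟩ => ?_
  obtain ⟨hac, hhor⟩ := S.isHorizontal_iff.1 hc
  have hv : ∀ᵐ t ∂(volume.restrict (Icc (0 : ℝ) 1)), ∃ A : S.firstLayer,
      vel E c t = leftTrans E (c t) (A : E) ∧
      vel E (fun t => H (c t)) t = leftTrans E (H (c t)) ((s • A : S.firstLayer) : E) := by
    filter_upwards [hac.ae_mdifferentiableAt, hhor] with t hd ⟨A, hA⟩
    refine ⟨A, hA, ?_⟩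
    rw [MDifferentiableAt.vel_comp hH.contMDiffAt.hasMD hd, hA, h _ _ A.2]
    rfl
  have hHc : S.IsHorizontal fun t => H (c t) :=
    S.isHorizontal_iff.2 ⟨hac.comp fun t _ => hH.contMDiffAt, hv.mono fun t ⟨A, _, hA⟩ => ⟨_, hA⟩⟩
  refine (iInf₂_le (fun t => H (c t)) ⟨hHc, congrArg H hy, congrArg H hz⟩).trans ?_
  rw [← lintegral_const_mul' _ _ ENNReal.ofReal_ne_top]
  refine lintegral_mono_ae ?_
  filter_upwards [hv] with t ⟨A, h1, h2⟩
  rw [S.horizontalNorm_vel h1, S.horizontalNorm_vel (c := fun t => H (c t)) h2,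
    ← ENNReal.ofReal_mul hs.le, innerModel_smul, Real.sqrt_mul (by positivity), Real.sqrt_mul_self hs.le]

end CarnotStructure

end CarnotMetric

/-! ### Carnot groups as spaces with dilations -/

section CarnotHolonomy

variable {E N : Type*} [NormedAddCommGroup E] [NormedSpace ℝ E] [FiniteDimensional ℝ E]
  [TopologicalSpace N] [T2Space N] [ChartedSpace E N] [Group N] [LieGroup 𝓘(ℝ, E) ∞ N]

namespace CarnotStructure

variable {S : CarnotStructure E N} {δ : ℝ → N → N}

/-- Concatenates bases of the layers. No weight is 0 because `layer 0` is trivial; this is what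
makes D 0 = 0. -/
theorem exists_graded_basis (S : CarnotStructure E N) :
    ∃ (n : ℕ) (b : Module.Basis (Fin n) ℝ E) (w : Fin n → ℕ),
      ∀ i, b i ∈ (S.layer (w i) : Submodule ℝ (GroupLieAlgebra 𝓘(ℝ, E) N)) ∧ w i ≠ 0 := by
  let v := fun j => Module.Free.chooseBasis ℝ (S.layer j)
  let b₀ : Module.Basis (Σ j, Module.Free.ChooseBasisIndex ℝ (S.layer j)) ℝ E :=
    S.isInternal.collectedBasis v
  have hmem : ∀ a, b₀ a ∈ (S.layer a.1 : Submodule ℝ (GroupLieAlgebra 𝓘(ℝ, E) N)) :=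
    S.isInternal.collectedBasis_mem v
  have : Finite (Σ j, Module.Free.ChooseBasisIndex ℝ (S.layer j)) := Module.Finite.finite_basis b₀
  set e := Finite.equivFin (Σ j, Module.Free.ChooseBasisIndex ℝ (S.layer j))
  refine ⟨_, b₀.reindex e, fun i => (e.symm i).1, fun i => ⟨?_, fun h => ?_⟩⟩
  · rw [Module.Basis.reindex_apply]; exact hmem _
  · have h1 := hmem (e.symm i)
    rw [show (e.symm i).1 = 0 from h, S.layer_zero] at h1
    exact b₀.ne_zero _ ((Submodule.mem_bot ℝ).1 h1)

namespace IsDilation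

variable (hδ : S.IsDilation δ) {s : ℝ} (hs : 0 < s)
include hδ hs

theorem map_one : δ s 1 = 1 := by
  have h := (hδ s hs).2.1 1 1
  rw [mul_one] at h
  exact left_eq_mul.1 h

theorem hasMD (y : N) : HasMD E E (δ s) y (md E E (δ s) y) :=
  ContMDiffAt.hasMD ((hδ s hs).2.2.1).contMDiffAt

/-- Both sides are one-parameter subgroups in r with generator s^j A. Consequently dilations act
diagonally in coordinates of the second kind. -/
theorem map_subgroup {A : E} {j : ℕ}
    (hA : A ∈ (S.layer j : Submodule ℝ (GroupLieAlgebra 𝓘(ℝ, E) N))) {c : ℝ → N}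
    (hc : IsOneParameterSubgroup E A c) (r : ℝ) : δ s (c r) = c (s ^ j * r) := by
  have : CompleteSpace E := FiniteDimensional.complete ℝ E
  obtain ⟨-, hmul, hsm, hd⟩ := hδ s hs
  have hd' : md E E (δ s) 1 A = s ^ j • A := hd j A hA
  have h1 : IsOneParameterSubgroup E (s ^ j • A) fun r => δ s (c r) := by
    refine ⟨hsm.comp hc.1, fun a b => ?_, ?_⟩
    · show δ s (c (a + b)) = _
      rw [hc.2.1, hmul]
    · have h2 := (hasMD hδ hs 1).comp_of_eq (hc.hasMD 0) hc.map_zero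
      show vel E (fun r => δ s (c r)) 0 = _
      rw [h2.vel_eq, ContinuousLinearMap.comp_apply, hc.vel_zero, hd']
  have h3 : IsOneParameterSubgroup E (s ^ j • A) fun r => c (s ^ j * r) := by
    have hl : HasDerivAt (fun r : ℝ => s ^ j * r) (s ^ j) 0 := by
      simpa using (hasDerivAt_id (0 : ℝ)).const_mul (s ^ j)
    refine ⟨hc.1.comp (contDiff_const.mul contDiff_id).contMDiff, fun a b => ?_, ?_⟩
    · show c (s ^ j * (a + b)) = _
      rw [mul_add, hc.2.1]
    · have h2 := (hc.hasMD 0).comp_of_eq (hasMD_iff_hasFDerivAt.2 hl.hasFDerivAt) (mul_zero _)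
      show vel E (fun r => c (s ^ j * r)) 0 = _
      rw [h2.vel_eq, ContinuousLinearMap.comp_apply]
      have h4 : md ℝ E c 0 (s ^ j) = s ^ j • md ℝ E c 0 1 := by
        rw [← map_smul, smul_eq_mul, mul_one]
      simp [h4, hc.vel_zero]
  exact congrFun (h1.unique h3) r

theorem map_prodSubgroups {n : ℕ} {b : Fin n → E} {w : Fin n → ℕ} {c : Fin n → ℝ → N}
    (hb : ∀ i, b i ∈ (S.layer (w i) : Submodule ℝ (GroupLieAlgebra 𝓘(ℝ, E) N)))
    (hc : ∀ i, IsOneParameterSubgroup E (b i) (c i)) (l : List (Fin n)) (τ : Fin n → ℝ) :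
    δ s (prodSubgroups c l τ) = prodSubgroups c l fun i => s ^ w i * τ i := by
  induction l with
  | nil => exact map_one hδ hs
  | cons i l ih =>
    rw [prodSubgroups_cons, prodSubgroups_cons, (hδ s hs).2.1, ih, map_subgroup hδ hs (hb i) (hc i)]

theorem contMDiff_dilationAt (x : N) : ContMDiff 𝓘(ℝ, E) 𝓘(ℝ, E) ∞ (dilationAt δ x s) :=
  (contMDiff_mul_left (I := 𝓘(ℝ, E)) (n := ∞)).comp
    ((hδ s hs).2.2.1.comp (contMDiff_mul_left (I := 𝓘(ℝ, E)) (n := ∞)))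

/-- Differentiating δ^x_s(yg) = δ^x_s(y) δ_s(g) at g = 1 shows that left-invariant vectors from 𝔫₁
are multiplied by s. -/
theorem ccDist_dilationAt_le (x y z : N) :
    S.ccDist (dilationAt δ x s y) (dilationAt δ x s z) ≤ ENNReal.ofReal s * S.ccDist y z := by
  refine S.ccDist_map_le (contMDiff_dilationAt hδ hs x) hs (fun y A hA => ?_) y z
  have hmul : (fun g => dilationAt δ x s (y * g)) = fun g => dilationAt δ x s y * δ s g := by
    funext g
    simp only [dilationAt]
    rw [← mul_assoc x⁻¹, (hδ s hs).2.1, mul_assoc]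
  have h1 := HasMD.comp_of_eq (ContMDiffAt.hasMD (contMDiff_dilationAt hδ hs x y))
    (hasMD_mul_left (E := E) y 1) (mul_one y)
  have h2 := HasMD.comp_of_eq (hasMD_mul_left (E := E) (dilationAt δ x s y) 1) (hasMD hδ hs 1)
    (map_one hδ hs)
  rw [hmul] at h1
  have h3 := DFunLike.congr_fun (h1.unique h2) A
  have h4 : md E E (δ s) 1 A = s ^ 1 • A := (hδ s hs).2.2.2 1 A hA
  rw [ContinuousLinearMap.comp_apply, ContinuousLinearMap.comp_apply, h4, pow_one] at h3
  exact h3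

end IsDilation

/-- A Carnot group as a space with dilations. -/
theorem exists_dilationChart (hδ : S.IsDilation δ) (x : N) :
    ∃ n : ℕ, Nonempty (DilationChart E (Fin n → ℝ) x (dilationAt δ x) S.ccDist) := by
  obtain ⟨n, b, w, hb⟩ := S.exists_graded_basis
  choose c hc using fun i => exists_isOneParameterSubgroup (G := N) (b i)
  set κ : (Fin n → ℝ) → N := fun τ => x * prodSubgroups c (List.finRange n) τ with hκ
  have hκs : ContMDiff 𝓘(ℝ, Fin n → ℝ) 𝓘(ℝ, E) ∞ κ :=
    contMDiff_const.mul (contMDiff_prodSubgroups hc _)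
  have hκ0 : κ 0 = x := by simp only [hκ, prodSubgroups_zero hc, mul_one]
  -- the derivative of `κ` at `0`
  set e : (Fin n → ℝ) ≃L[ℝ] E := (b.equivFun.symm.trans
    (LinearEquiv.ofInjectiveEndo (leftTrans E x).toLinearMap
      (leftTrans_injective x))).toContinuousLinearEquiv with he
  have heκ : HasMD (Fin n → ℝ) E κ 0 (e : (Fin n → ℝ) →L[ℝ] E) := by
    have h := (hasMD_mul_left (E := E) x 1).comp_of_eq (hasMD_prodSubgroups hc (List.finRange n))
      (prodSubgroups_zero hc _)
    convert h using 1
    refine ContinuousLinearMap.ext fun τ => ?_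
    rw [← Fin.sum_univ_def]
    have h1 : e τ = leftTrans E x (b.equivFun.symm τ) := rfl
    rw [ContinuousLinearEquiv.coe_coe, h1, b.equivFun_symm_apply, ContinuousLinearMap.comp_apply]
    congr 1
    simp
  obtain ⟨U, g, hU, hxU, hg0, hg⟩ := exists_smooth_rightInverse hκs heκ
  rw [hκ0] at hxU hg0
  -- local coordinates, cut off
  obtain ⟨χ₁, K₁, hχ₁, hK₁, hKU, hχ₁0, hχ₁1⟩ := exists_smooth_bump (E := E) (hU.mem_nhds hxU)
  obtain ⟨V, hV, hVo, hxV⟩ := eventually_nhds_iff.1 hχ₁1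
  obtain ⟨χ₂, K₂, hχ₂, hK₂, hKV, hχ₂0, hχ₂1⟩ := exists_smooth_bump (E := E) (hVo.mem_nhds hxV)
  -- Cutting off makes the local inverse globally smooth with compact support, hence Lipschitz for
  -- the metric.
  set u : N → Fin n → ℝ := fun y => χ₁ y • g y with hu
  have hus : ContMDiff 𝓘(ℝ, E) 𝓘(ℝ, Fin n → ℝ) ∞ u := by
    intro y
    by_cases hy : y ∈ U
    · exact (hχ₁ y).smul (hg y hy).2
    · have h1 : u =ᶠ[𝓝 y] fun _ => 0 := by
        filter_upwards [hK₁.isClosed.isOpen_compl.mem_nhds fun h => hy (hKU h)] with z hz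
        simp only [hu, hχ₁0 z hz, zero_smul]
      exact contMDiffAt_const.congr_of_eventuallyEq h1
  have hu0 : ∀ y ∉ K₁, u y = 0 := fun y hy => by simp only [hu, hχ₁0 y hy, zero_smul]
  obtain ⟨C₁, hC₁, hL₁⟩ := S.exists_edist_le_ccDist hus hK₁ hu0
  obtain ⟨C₂, hC₂, hL₂⟩ := S.exists_edist_le_ccDist hχ₂ hK₂ hχ₂0
  -- The second bump χ₂ is 1 at x, 0 outside V and C₂-Lipschitz, so small metric balls lie in V,
  -- where u is the true local inverse of κ.
  have hnear : ∀ y, S.ccDist x y < ENNReal.ofReal C₂⁻¹ → y ∈ V := by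
    intro y hy
    refine hKV ?_
    by_contra h
    have h1 := hL₂ x y
    rw [hχ₂0 y h, hχ₂1.eq_of_nhds, Pi.one_apply] at h1
    have h2 : ENNReal.ofReal C₂ * S.ccDist x y < ENNReal.ofReal C₂ * ENNReal.ofReal C₂⁻¹ :=
      (ENNReal.mul_lt_mul_iff_right (ENNReal.ofReal_pos.2 hC₂).ne' ENNReal.ofReal_ne_top).2 hy
    rw [← ENNReal.ofReal_mul hC₂.le, mul_inv_cancel₀ hC₂.ne'] at h2
    have h3 : edist (1 : ℝ) 0 = ENNReal.ofReal 1 := by rw [edist_dist]; simp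
    rw [h3] at h1
    exact absurd (h1.trans_lt h2) (lt_irrefl _)
  have hVU : ∀ y ∈ V, y ∈ U := by
    intro y hy
    refine hKU ?_
    by_contra h
    have h1 := hV y hy
    rw [hχ₁0 y h] at h1
    exact zero_ne_one h1
  have huV : ∀ y ∈ V, u y = g y := fun y hy => by
    have h1 : χ₁ y = 1 := hV y hy
    simp only [hu, h1, one_smul]
  let D : ℝ → (Fin n → ℝ) →L[ℝ] (Fin n → ℝ) := fun s =>
    ∑ i, s ^ w i • (ContinuousLinearMap.single ℝ (fun _ : Fin n => ℝ) i).comp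
      (ContinuousLinearMap.proj (R := ℝ) (φ := fun _ : Fin n => ℝ) i)
  have hD : ∀ s τ i, D s τ i = s ^ w i * τ i := by
    intro s τ i
    simp only [D, _root_.sum_apply, Finset.sum_apply]
    rw [Finset.sum_eq_single i]
    · simp
    · intro j _ hj
      simp [Pi.single_eq_of_ne' hj]
    · simp
  refine ⟨n, ⟨{
    D := D
    contDiff_D := ContDiff.sum fun i _ => (contDiff_id.pow _).smul contDiff_const
    D_zero := by ext1 τ; ext i; rw [hD]; simp [(hb i).2]
    D_one := by ext1 τ; ext i; rw [hD]; simp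
    D_mul := fun s t => by ext1 τ; ext i; rw [ContinuousLinearMap.comp_apply, hD, hD, hD]; ring
    κ := κ
    contMDiff_κ := hκs
    κ_zero := hκ0
    δ_κ := fun s hs τ => ?_
    contMDiff_δ := fun s hs => hδ.contMDiff_dilationAt hs x
    coord := u
    radius := C₂⁻¹
    radius_pos := inv_pos.2 hC₂
    lip := C₁
    lip_pos := hC₁
    κ_coord := fun y hy => ?_
    contMDiffAt_coord := fun y _ => hus y
    coord_self := by rw [huV x hxV, hg0]
    coord_lipschitz := fun y z _ _ => hL₁ y z
    d_self := S.ccDist_self x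
    d_δ := fun s hs y z => hδ.ccDist_dilationAt_le hs x y z }⟩⟩
  · simp only [hκ, dilationAt, inv_mul_cancel_left]
    rw [hδ.map_prodSubgroups hs (fun i => (hb i).1) hc]
    congr 2
    funext i
    rw [hD]
  · have hyV := hnear y hy
    rw [huV y hyV]
    exact (hg y (hVU y hyV)).1

end CarnotStructure

variable {EG G EP P : Type*} [NormedAddCommGroup EG] [NormedSpace ℝ EG] [FiniteDimensional ℝ EG]
  [TopologicalSpace G] [T2Space G] [ChartedSpace EG G] [Group G] [LieGroup 𝓘(ℝ, EG) ∞ G]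
  [NormedAddCommGroup EP] [NormedSpace ℝ EP] [FiniteDimensional ℝ EP]
  [TopologicalSpace P] [ChartedSpace EP P] [IsManifold 𝓘(ℝ, EP) ∞ P]
  {B : PrincipalBundle EG G EP P E N} {conn : PrincipalConnection B}

/-- The holonomy expansion on a Carnot group. -/
theorem holonomyExpansion_carnot {S : CarnotStructure E N} {δ : ℝ → N → N} (hδ : S.IsDilation δ)
    {x : N} {σ : N → P} (hσ : conn.IsRadialGauge (dilationAt δ x) σ) {m : ℕ}
    (hm : IsOfWeightGE (dilationAt δ x) (conn.pullbackCurvature σ) m) :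
    HolonomyExpansion conn x (σ x) (metricLength S.ccDist)
      (diskIntegral (dilationAt δ x) (conn.pullbackCurvature σ)) (2 * m) := by
  have : CompleteSpace EG := FiniteDimensional.complete ℝ EG
  obtain ⟨n, ⟨Q⟩⟩ := CarnotStructure.exists_dilationChart hδ x
  refine Q.holonomyExpansion hσ ?_
  rcases m with _ | m
  · exact .inl rfl
  · exact .inr fun τ h => Q.form_isLittleO_of_weight hσ hm τ h

end CarnotHolonomy

end

/-! ### The theorem -/

theorem mainTheorem1
    {EG G : Type*} [NormedAddCommGroup EG] [NormedSpace ℝ EG] [FiniteDimensional ℝ EG]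
    [TopologicalSpace G] [T2Space G] [ChartedSpace EG G] [Group G] [LieGroup 𝓘(ℝ, EG) ∞ G]
    {EP P : Type*} [NormedAddCommGroup EP] [NormedSpace ℝ EP] [FiniteDimensional ℝ EP]
    [TopologicalSpace P] [T2Space P] [ChartedSpace EP P] [IsManifold 𝓘(ℝ, EP) ∞ P] :
    -- Carnot groups
    (∀ {EN N : Type*} [NormedAddCommGroup EN] [NormedSpace ℝ EN] [FiniteDimensional ℝ EN]
      [TopologicalSpace N] [T2Space N] [ChartedSpace EN N] [Group N] [LieGroup 𝓘(ℝ, EN) ∞ N]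
      [SimplyConnectedSpace N]
      (S : CarnotStructure EN N) (δ : ℝ → N → N), S.IsDilation δ →
      ∀ (B : PrincipalBundle EG G EP P EN N) (conn : PrincipalConnection B)
        (x : N) (p : P) (σ : N → P),
        conn.IsRadialGauge (dilationAt δ x) σ → σ x = p →
        ∀ m : ℕ, IsOfWeightGE (dilationAt δ x) (conn.pullbackCurvature σ) m →
          HolonomyExpansion conn x p (metricLength S.ccDist)
            (diskIntegral (dilationAt δ x) (conn.pullbackCurvature σ)) (2 * m)) ∧
    -- Euclidean space
    (∀ (n : ℕ) (B : PrincipalBundle EG G EP P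
          (EuclideanSpace ℝ (Fin n)) (EuclideanSpace ℝ (Fin n)))
      (conn : PrincipalConnection B)
      (x : EuclideanSpace ℝ (Fin n)) (p : P) (σ : EuclideanSpace ℝ (Fin n) → P),
      conn.IsRadialGauge (vectorDilationAt x) σ → σ x = p →
      HolonomyExpansion conn x p (metricLength edist)
        (diskIntegral (vectorDilationAt x) (conn.pullbackCurvature σ)) (2 * 2) ∧
      ∀ k : ℕ, conn.CurvatureVanishesToOrder x k →
        HolonomyExpansion conn x p (metricLength edist)
          (diskIntegral (vectorDilationAt x) (conn.pullbackCurvature σ)) (2 * (3 + k))) := by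
  refine ⟨?_, ?_⟩
  · rintro EN N _ _ _ _ _ _ _ _ _ S δ hδ B conn x _ σ hσ rfl m hm
    exact holonomyExpansion_carnot hδ hσ hm
  · rintro n B conn x _ σ hσ rfl
    exact holonomyExpansion_vector hσ
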